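/- Let $U\subset\mathbb R^n$ be an open neighbourhood of $0$ and let $S:U\to\mathbb R$ be real-analytic, not identically zero near $0$, with $S(0)=0$ and $\nabla S(0)=0$. Let $\sum_\alpha s_\alpha x^\alpha$ be its Taylor expansion at $0$. The Newton polyhedron $N(S)$ is the convex hull of the union of the octants $\{x\in\mathbb R^n: x_i\ge \alpha_i \text{ for all } i\}$ over all $\alpha$ with $s_\alpha\neq0$, and $d=\inf\{t:(t,\dots,t)\in N(S)\}$ is the Newton distance. A face of $N(S)$ is a nonempty proper subset of $N(S)$ which is the intersection of $N(S)$ with a supporting hyperplane (vertices are compact faces of dimension $0$). Let $C(S)$ be the face of $N(S)$, compact or not, whose relative interior meets the line $\{(t,\dots,t):t\in\mathbb R\}$ (the relative interior of a vertex being the vertex itself), and let $k$ be the dimension of $C(S)$. For a compact face $F$ put $S_F(x)=\sum_{\alpha\in F}s_\alpha x^\alpha$. The order of a zero of $S_F$ at a point is the least order of a partial derivative of $S_F$ that does not vanish there. For an open set $V$ with $0\in V\subset U$, an amplitude on $V$ is a smooth nonnegative function $\phi:\mathbb R^n\to\mathbb R$ with compact support contained in $V$ and $\phi(0)>0$. For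 such $\phi$ and $\epsilon>0$ let $$I_{|S|,\phi}(\epsilon)=\int_{\{x\in U:\,|S(x)|<\epsilon\}}\phi(x)\,dx .$$ **Theorem 1.2.** (a) For every amplitude $\phi$ on $U$ there is a constant $C>0$ such that, for all sufficiently small $\epsilon>0$, $$I_{|S|,\phi}(\epsilon)> C\,|\ln\epsilon|^{\,n-k-1}\,\epsilon^{1/d}.$$ Moreover, there is an open neighbourhood $V\subset U$ of $0$, depending only on $S$, such that for every amplitude $\phi$ on $V$ the following hold. (b) Suppose that for every compact face $F$ of $N(S)$ each zero of $S_F$ in $(\mathbb R\setminus\{0\})^n$ has order at most $d$. Then there is a constant $C'>0$ such that, for all sufficiently small $\epsilon>0$, $$I_{|S|,\phi}(\epsilon)< C'\,|\ln\epsilon|^{\,n-k}\,\epsilon^{1/d}.$$ If in addition there is no compact face $F$ of $N(S)$ with $F\subset C(S)$ for which $S_F$ has a zero of order $d$ in $(\mathbb R\setminus\{0\})^n$, then there is a constant $C'>0$ such that, for all sufficiently small $\epsilon>0$, $$I_{|S|,\phi}(\epsilon)< C'\,|\ln\epsilon|^{\,n-k-1}\,\epsilon^{1/d}.$$ (c)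 Suppose that the maximum order $d'$ of any zero in $(\mathbb R\setminus\{0\})^n$ of any $S_F$, over all compact faces $F$ of $N(S)$, satisfies $d'>d$. Then there is a constant $C'>0$ such that, for all sufficiently small $\epsilon>0$, $$I_{|S|,\phi}(\epsilon)< C'\,\epsilon^{1/d'}.$$ -/

import Mathlib

open Set Filter Topology MeasureTheory
open scoped ContDiff

noncomputable section

namespace NewtonPoly

variable {n : ℕ}

/-- The monomial `x ^ α = ∏ i, x i ^ α i`. -/
def monom (α : Fin n → ℕ) (x : Fin n → ℝ) : ℝ := ∏ i, x i ^ α i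

/-- The Taylor coefficient `s_α = (1 / α!) ∂^α S (0)`. The mixed partial derivative `∂^α S (0)` is
the `|α|`-th Fréchet derivative of `S` at `0`, evaluated at the list of `|α|` vectors in which
each standard basis vector `e_i` occurs exactly `α i` times. -/
def taylorCoeff (S : (Fin n → ℝ) → ℝ) (α : Fin n → ℕ) : ℝ :=
  (iteratedFDeriv ℝ (∑ i, α i) S 0
      fun j => Pi.single (finSigmaFinEquiv.symm j : (i : Fin n) × Fin (α i)).1 (1 : ℝ)) /
    ∏ i, (Nat.factorial (α i) : ℝ)

/-- A multi-index, viewed as a point of `ℝⁿ`. -/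
def toPoint (α : Fin n → ℕ) : Fin n → ℝ := fun i => (α i : ℝ)

/-- The Newton polyhedron `N(S)`: the convex hull of all the octants
`{x | x i ≥ α i for all i}` with `s_α ≠ 0`. -/
def newtonPolyhedron (S : (Fin n → ℝ) → ℝ) : Set (Fin n → ℝ) :=
  convexHull ℝ (⋃ α ∈ {α : Fin n → ℕ | taylorCoeff S α ≠ 0}, {x | ∀ i, toPoint α i ≤ x i})

/-- The Newton distance `inf {t | (t, …, t) ∈ N(S)}`. -/
def newtonDistance (S : (Fin n → ℝ) → ℝ) : ℝ :=
  sInf {t : ℝ | (fun _ : Fin n => t) ∈ newtonPolyhedron S}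

/-- (Proper, nonempty) faces of `N(S)`, of any dimension, compact or not: the intersections of
`N(S)` with its supporting hyperplanes. -/
def IsFace (S : (Fin n → ℝ) → ℝ) (F : Set (Fin n → ℝ)) : Prop :=
  F.Nonempty ∧ F ≠ newtonPolyhedron S ∧ IsExposed ℝ (newtonPolyhedron S) F

/-- Compact faces of `N(S)`; these include the vertices. -/
def IsCompactFace (S : (Fin n → ℝ) → ℝ) (F : Set (Fin n → ℝ)) : Prop :=
  IsFace S F ∧ IsCompact F

/-- `C` is the face `C(S)` of `N(S)`, compact or not, whose (relative) interior is met by the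
diagonal line. The relative interior of a vertex is the vertex itself. -/
def IsCentralFace (S : (Fin n → ℝ) → ℝ) (C : Set (Fin n → ℝ)) : Prop :=
  IsFace S C ∧ ∃ t : ℝ, (fun _ : Fin n => t) ∈ intrinsicInterior ℝ C

/-- The dimension of a face: that of the direction space of its affine span. -/
def faceDim (F : Set (Fin n → ℝ)) : ℕ := Module.finrank ℝ (vectorSpan ℝ F)

/-- The polynomial function `S_F(x) = ∑_{α ∈ F} s_α x^α` (a finite sum when `F` is compact). -/
def faceFun (S : (Fin n → ℝ) → ℝ) (F : Set (Fin n → ℝ)) (x : Fin n → ℝ) : ℝ :=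
  ∑ᶠ α ∈ {α : Fin n → ℕ | toPoint α ∈ F}, taylorCoeff S α * monom α x

/-- `f` has a zero of order `m` at `x`: `f` vanishes at `x`, and `m` is the least order of a
nonvanishing derivative of `f` at `x`. -/
def HasZeroOfOrder (f : (Fin n → ℝ) → ℝ) (x : Fin n → ℝ) (m : ℕ) : Prop :=
  f x = 0 ∧ (∀ j < m, iteratedFDeriv ℝ j f x = 0) ∧ iteratedFDeriv ℝ m f x ≠ 0

/-- `S_F` has a zero of order `m` somewhere in `(ℝ \ {0})ⁿ`. -/
def FaceHasZeroOfOrder (S : (Fin n → ℝ) → ℝ) (F : Set (Fin n → ℝ)) (m : ℕ) : Prop :=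
  ∃ x : Fin n → ℝ, (∀ i, x i ≠ 0) ∧ HasZeroOfOrder (faceFun S F) x m

/-- The admissible amplitudes on `V`: smooth nonnegative functions, compactly supported in `V`,
and positive at the origin. -/
structure IsAmplitude (V : Set (Fin n → ℝ)) (φ : (Fin n → ℝ) → ℝ) : Prop where
  smooth : ContDiff ℝ ∞ φ
  hasCompactSupport : HasCompactSupport φ
  tsupport_subset : tsupport φ ⊆ V
  nonneg : ∀ x, 0 ≤ φ x
  pos_zero : 0 < φ 0

/-- The sublevel integral `I_{|S|,φ}(ε)` of a function `S` with domain of definition `U`. -/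
def sublevelIntegral (U : Set (Fin n → ℝ)) (S φ : (Fin n → ℝ) → ℝ) (ε : ℝ) : ℝ :=
  ∫ x in {x | x ∈ U ∧ |S x| < ε}, φ x

end NewtonPoly

end

/-!
The proof is an elementary dyadic decomposition; it needs no resolution of singularities.

A box around `0` is, up to a null set, covered by the signed dyadic shells
`{x | 2 ^ (-j i) ≤ |x i| ≤ 2 ^ (1 - j i)}`, `j : Fin n → ℕ`. On the shell `j` put
`x i = y i / 2 ^ j i` with `1 ≤ |y i| ≤ 2`, and let `m(j) = minDeg S j` be the least value of
`j · α` over the exponents `α` of `S`. Then `2 ^ m(j) * S(x) = ∑ α, s_α 2 ^ (m(j) - j · α) y ^ α`, a power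
series in `y` with a summable majorant independent of `j` (`exists_scaled_expansion`).

*Uniform estimate on one shell* (`exists_scaled_sublevel_le`). If all zeros of the face polynomials
have order at most `D`, then the set where the rescaled function is smaller than `δ` has measure at
most a constant times `δ ^ (1 / D)`, uniformly in `j`. Indeed, along an ultrafilter of indices `j`
each gap `j · α - m(j)` is either eventually constant or tends to infinity, so the rescaled
functions converge to a face polynomial, composed with a diagonal linear map. Near a point where a directional
derivative of order at most `D` does not vanish, a van der Corput sublevel estimate holds, and it is
stable under small perturbations of the power series (`exists_nhds_volume_sublevel_le`); compactness
of the shell finishes the argument.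

*Summation.* For `D ≥ d` the measure of the sublevel set is thus bounded by a multiple of
`∑ j, 2 ^ (-|j|) * min 1 ((ε * 2 ^ m(j)) ^ (1 / D))`, `|j| = ∑ i, j i`. Since `(d, …, d)` is a
relative interior point of the central face `C`, the defect `|j| - m(j) / d` is nonnegative and
dominates the distance of `j` to the orthogonal complement of the directions of `C`, a subspace of
dimension `n - k` (`IsCentralFace.exists_basis`). If `D > d`, the terms decay geometrically in `|j|`
and no logarithm appears. If `D = d`, the terms are at most `ε ^ (1 / d)`, and they decay
exponentially in the defect and in the excess of `|j|` over `log₂ (1 / ε) / d`; counting lattice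
points near a subspace (`tsum_exp_neg_truncated_le`) gives `|log ε| ^ (n - k)`. If moreover no face
inside `C` has a zero of order `d`, then on the shells deep inside the normal cone of `C` the
estimate holds with some `D < d`, so that only those with `|j|` close to `log₂ (1 / ε) / d`
contribute; the other shells lie near the hyperplane on which some exponent outside `C` ties with
`C`. Either way one dimension, hence one logarithm, is saved.

*Lower bound* (`exists_le_volume_sublevel`). Conversely, the normal cone of `C` contains, up to
bounded distance, about `|log ε| ^ (n - k - 1)` lattice points `j` with `|j|` close to
`log₂ (1 / ε) / d` and `m(j)` close to `log₂ (1 / ε)`. On each of the corresponding boxes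
`|S| < ε`, the boxes are disjoint, and each has measure about `ε ^ (1 / d)`.
-/

noncomputable section

namespace NewtonPoly

/-! ### Sublevel sets of functions of one variable -/

/-- If the `m`-th derivative is at least `c` in absolute value, then the function cannot be small
at `2 ^ m` points that are `s`-separated. By the mean value theorem, applied to consecutive pairs,
the first derivative takes difference quotients as values at `2 ^ (m - 1)` points which are again
`s`-separated, so that induction applies. -/
theorem exists_le_abs_of_separated (m : ℕ) : ∀ (G : ℕ → ℝ → ℝ) (a b c s : ℝ), 0 < s →
    (∀ l < m, ∀ t ∈ Icc a b, HasDerivAt (G l) (G (l + 1) t) t) →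
    (∀ t ∈ Icc a b, c ≤ |G m t|) →
    ∀ t : ℕ → ℝ, (∀ i < 2 ^ m, t i ∈ Icc a b) → (∀ i, i + 1 < 2 ^ m → t i + s ≤ t (i + 1)) →
      ∃ i < 2 ^ m, c * (s / 2) ^ m ≤ |G 0 (t i)| := by
  induction m with
  | zero =>
    intro G a b c s _ _ hc t ht _
    exact ⟨0, by simp, by simpa using hc _ (ht 0 (by simp))⟩
  | succ m ih =>
    intro G a b c s hs hG hc t ht hsep
    have key : ∀ i, ∃ ξ, i < 2 ^ m → ξ ∈ Ioo (t (2 * i)) (t (2 * i + 1)) ∧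
        G 1 ξ = (G 0 (t (2 * i + 1)) - G 0 (t (2 * i))) / (t (2 * i + 1) - t (2 * i)) := by
      intro i
      by_cases hi : i < 2 ^ m
      · have h1 : 2 * i + 1 < 2 ^ (m + 1) := by rw [pow_succ]; omega
        have h2 := hsep (2 * i) h1
        have hA := ht (2 * i) (by omega)
        have hB := ht (2 * i + 1) h1
        have hsub : Icc (t (2 * i)) (t (2 * i + 1)) ⊆ Icc a b := Icc_subset_Icc hA.1 hB.2
        obtain ⟨ξ, hξ, h⟩ := exists_hasDerivAt_eq_slope (G 0) (G 1)
          (show t (2 * i) < t (2 * i + 1) by linarith)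
          (fun x hx => (hG 0 (by omega) x (hsub hx)).continuousAt.continuousWithinAt)
          (fun x hx => hG 0 (by omega) x (hsub (Ioo_subset_Icc_self hx)))
        exact ⟨ξ, fun _ => ⟨hξ, h⟩⟩
      · exact ⟨0, fun h => absurd h hi⟩
    choose ξ hξ using key
    have hpow : 2 ^ (m + 1) = 2 * 2 ^ m := by ring
    obtain ⟨i, hi, hle⟩ := ih (fun l => G (l + 1)) a b c s hs
      (fun l hl => hG (l + 1) (by omega)) hc ξ
      (fun i hi => by
        have h := (hξ i hi).1
        exact ⟨(ht (2 * i) (by omega)).1.trans h.1.le, h.2.le.trans (ht (2 * i + 1) (by omega)).2⟩)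
      (fun i hi => by
        have h1 := (hξ i (by omega)).1.2
        have h2 := (hξ (i + 1) hi).1.1
        have h3 := hsep (2 * i + 1) (by omega)
        rw [show 2 * i + 1 + 1 = 2 * (i + 1) by ring] at h3
        linarith)
    have hd := hsep (2 * i) (by omega)
    have hdpos : 0 < t (2 * i + 1) - t (2 * i) := by linarith
    simp only [zero_add] at hle
    rw [(hξ i hi).2, abs_div, abs_of_pos hdpos, le_div_iff₀ hdpos] at hle
    have htri := abs_sub (G 0 (t (2 * i + 1))) (G 0 (t (2 * i)))
    by_contra! hcon
    have hc1 := hcon (2 * i) (by omega)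
    have hc2 := hcon (2 * i + 1) (by omega)
    have hnn : 0 ≤ c * (s / 2) ^ m := by
      have := (abs_nonneg _).trans_lt hc1
      have h3 : 0 < (s / 2) * (c * (s / 2) ^ m) := by
        calc (0 : ℝ) < c * (s / 2) ^ (m + 1) := this
          _ = _ := by ring
      exact (pos_of_mul_pos_right h3 (by positivity)).le
    have h4 : c * (s / 2) ^ m * s ≤ c * (s / 2) ^ m * (t (2 * i + 1) - t (2 * i)) :=
      mul_le_mul_of_nonneg_left (by linarith) hnn
    have h5 : c * (s / 2) ^ m * s = 2 * (c * (s / 2) ^ (m + 1)) := by ring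
    linarith

/-- A set of measure more than `N * s` contains `N + 1` points that are `s`-separated. -/
theorem exists_separated {s : ℝ} (hs : 0 < s) : ∀ (N : ℕ) (E : Set ℝ), BddBelow E →
    ENNReal.ofReal (N * s) < volume E →
    ∃ t : ℕ → ℝ, (∀ i < N + 1, t i ∈ E) ∧ ∀ i, i + 1 < N + 1 → t i + s ≤ t (i + 1) := by
  intro N
  induction N with
  | zero =>
    intro E _ hE
    obtain ⟨x, hx⟩ := nonempty_of_measure_ne_zero (zero_le.trans_lt hE).ne'
    exact ⟨fun _ => x, fun _ _ => hx, fun i hi => by omega⟩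
  | succ N ih =>
    intro E hb hE
    obtain ⟨r, hr0, hr1, hr2⟩ := ENNReal.lt_iff_exists_real_btwn.1 hE
    have hne : E.Nonempty := nonempty_of_measure_ne_zero (zero_le.trans_lt hE).ne'
    have hr : ((N + 1 : ℕ) : ℝ) * s < r :=
      (ENNReal.ofReal_lt_ofReal_iff_of_nonneg (by positivity)).1 hr1
    push_cast at hr
    obtain ⟨x, hx, hxlt⟩ := exists_lt_of_csInf_lt hne
      (show sInf E < sInf E + (r - (N + 1) * s) by linarith)
    have hle := csInf_le hb hx
    have hE' : ENNReal.ofReal (N * s) < volume (E ∩ Ici (x + s)) := by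
      by_contra! hcon
      have hsub : E ⊆ Ico (sInf E) (x + s) ∪ (E ∩ Ici (x + s)) := by
        intro y hy
        by_cases h : y < x + s
        · exact Or.inl ⟨csInf_le hb hy, h⟩
        · exact Or.inr ⟨hy, not_lt.1 h⟩
      refine absurd hr2 (not_lt.2 ?_)
      calc volume E ≤ volume (Ico (sInf E) (x + s)) + volume (E ∩ Ici (x + s)) :=
            (measure_mono hsub).trans (measure_union_le _ _)
        _ ≤ ENNReal.ofReal (x + s - sInf E) + ENNReal.ofReal (N * s) := by
            rw [Real.volume_Ico]; gcongr
        _ = ENNReal.ofReal (x + s - sInf E + N * s) :=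
            (ENNReal.ofReal_add (by linarith) (by positivity)).symm
        _ ≤ ENNReal.ofReal r := ENNReal.ofReal_le_ofReal (by linarith)
    obtain ⟨t, ht1, ht2⟩ := ih _ (hb.mono inter_subset_left) hE'
    refine ⟨fun i => Nat.casesOn i x t, fun i hi => ?_, fun i hi => ?_⟩
    · cases i with
      | zero => exact hx
      | succ i => exact (ht1 i (by omega)).1
    · cases i with
      | zero => exact (ht1 0 (by omega)).2
      | succ i => exact ht2 i (by omega)

/-- Sublevel estimate of van der Corput type. -/
theorem volume_sublevel_le_of_deriv (m : ℕ) (G : ℕ → ℝ → ℝ) {a b c s δ : ℝ} (hs : 0 < s)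
    (hG : ∀ l < m, ∀ t ∈ Icc a b, HasDerivAt (G l) (G (l + 1) t) t)
    (hc : ∀ t ∈ Icc a b, c ≤ |G m t|) (hδ : δ ≤ c * (s / 2) ^ m) :
    volume {t | t ∈ Icc a b ∧ |G 0 t| < δ} ≤ ENNReal.ofReal (2 ^ m * s) := by
  by_contra! hcon
  have h1 : 1 ≤ 2 ^ m := Nat.one_le_two_pow
  obtain ⟨t, ht1, ht2⟩ := exists_separated hs (2 ^ m - 1) {t | t ∈ Icc a b ∧ |G 0 t| < δ}
    ⟨a, fun x hx => hx.1.1⟩ (lt_of_le_of_lt (ENNReal.ofReal_le_ofReal (by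
      push_cast [h1]; nlinarith)) hcon)
  rw [Nat.sub_add_cancel h1] at ht1 ht2
  obtain ⟨i, hi, hle⟩ := exists_le_abs_of_separated m G a b c s hs hG hc t
    (fun i hi => (ht1 i hi).1) ht2
  exact absurd (ht1 i hi).2 (not_lt.2 (hδ.trans hle))

/-- A bounded measurable set all of whose slices in a fixed direction are short has small measure:
average the measures of its translates in this direction and exchange the integrals. -/
theorem volume_le_of_slices {n : ℕ} {E : Set (Fin n → ℝ)} (hE : MeasurableSet E)
    (v y₀ : Fin n → ℝ) {r ρ b : ℝ} (hρ : 0 < ρ) (hEr : E ⊆ Metric.closedBall y₀ r)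
    (hb : ∀ y, volume {s : ℝ | s ∈ Icc (-ρ) ρ ∧ y + s • v ∈ E} ≤ ENNReal.ofReal b) :
    volume E ≤ ENNReal.ofReal b *
      volume (Metric.closedBall y₀ (r + ρ * ‖v‖)) / ENNReal.ofReal (2 * ρ) := by
  rw [ENNReal.le_div_iff_mul_le (Or.inl (by simpa using hρ)) (Or.inl ENNReal.ofReal_ne_top)]
  have hmeas : Measurable (Function.uncurry fun (s : ℝ) (y : Fin n → ℝ) =>
      E.indicator (1 : (Fin n → ℝ) → ENNReal) (y + s • v)) := by
    refine (measurable_one.indicator hE).comp ?_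
    fun_prop
  have h1 : volume E * ENNReal.ofReal (2 * ρ)
      = ∫⁻ s in Icc (-ρ) ρ, ∫⁻ y, E.indicator (1 : (Fin n → ℝ) → ENNReal) (y + s • v) := by
    have : ∀ s : ℝ, ∫⁻ y, E.indicator (1 : (Fin n → ℝ) → ENNReal) (y + s • v) = volume E := by
      intro s
      rw [lintegral_add_right_eq_self (fun y => E.indicator (1 : (Fin n → ℝ) → ENNReal) y) (s • v),
        lintegral_indicator_one hE]
    simp only [this, lintegral_const, Measure.restrict_apply MeasurableSet.univ, univ_inter,
      Real.volume_Icc]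
    congr 2; ring
  rw [h1, lintegral_lintegral_swap hmeas.aemeasurable]
  calc ∫⁻ y, ∫⁻ s in Icc (-ρ) ρ, E.indicator (1 : (Fin n → ℝ) → ENNReal) (y + s • v)
      ≤ ∫⁻ y, (Metric.closedBall y₀ (r + ρ * ‖v‖)).indicator (fun _ => ENNReal.ofReal b) y := by
        refine lintegral_mono fun y => ?_
        have hset : MeasurableSet {s : ℝ | y + s • v ∈ E} := by
          have : Measurable fun s : ℝ => y + s • v := by fun_prop
          exact this hE
        have heq : ∫⁻ s in Icc (-ρ) ρ, E.indicator (1 : (Fin n → ℝ) → ENNReal) (y + s • v)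
            = volume {s : ℝ | s ∈ Icc (-ρ) ρ ∧ y + s • v ∈ E} := by
          calc _ = ∫⁻ s in Icc (-ρ) ρ, {s : ℝ | y + s • v ∈ E}.indicator 1 s := rfl
            _ = _ := by
              rw [lintegral_indicator_one hset, Measure.restrict_apply hset]
              congr 1; ext s; simp [and_comm]
        rw [heq]
        by_cases hy : y ∈ Metric.closedBall y₀ (r + ρ * ‖v‖)
        · rw [indicator_of_mem hy]; exact hb y
        · rw [indicator_of_notMem hy]
          have : {s : ℝ | s ∈ Icc (-ρ) ρ ∧ y + s • v ∈ E} = ∅ := by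
            refine eq_empty_of_forall_notMem fun s hs => hy ?_
            have h2 := hEr hs.2
            rw [Metric.mem_closedBall, dist_eq_norm] at h2 ⊢
            have h3 : ‖s • v‖ ≤ ρ * ‖v‖ := by
              rw [norm_smul]
              exact mul_le_mul_of_nonneg_right (abs_le.2 ⟨hs.1.1, hs.1.2⟩) (norm_nonneg _)
            calc ‖y - y₀‖ = ‖(y + s • v - y₀) - s • v‖ := by congr 1; abel
              _ ≤ _ := (norm_sub_le _ _).trans (add_le_add h2 h3)
          rw [this, measure_empty]
    _ = _ := by
      rw [lintegral_indicator_const Metric.isClosed_closedBall.measurableSet]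

/-! ### Exponential sums over lattice points -/

theorem tsum_int_exp_neg_abs_le {κ : ℝ} (hκ : 0 < κ) :
    ∑' a : ℤ, ENNReal.ofReal (Real.exp (-(κ * |(a : ℝ)|))) ≤ ENNReal.ofReal (2 * (1 + κ⁻¹)) := by
  have hgeo : ∑' n : ℕ, ENNReal.ofReal (Real.exp (-(κ * n))) ≤ ENNReal.ofReal (1 + κ⁻¹) := by
    have h1 : ∀ n : ℕ, ENNReal.ofReal (Real.exp (-(κ * n)))
        = ENNReal.ofReal (Real.exp (-κ)) ^ n := by
      intro n
      rw [← ENNReal.ofReal_pow (Real.exp_pos _).le, ← Real.exp_nat_mul]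
      congr 2; ring
    have hlt : Real.exp (-κ) < 1 := Real.exp_zero ▸ Real.exp_lt_exp.2 (by linarith)
    simp only [h1, ENNReal.tsum_geometric]
    rw [← ENNReal.ofReal_one, ← ENNReal.ofReal_sub _ (Real.exp_pos _).le,
      ← ENNReal.ofReal_inv_of_pos (by linarith)]
    refine ENNReal.ofReal_le_ofReal ?_
    have h2 : Real.exp (-κ) ≤ (1 + κ)⁻¹ := by
      rw [Real.exp_neg]
      exact inv_anti₀ (by linarith) (by linarith [Real.add_one_le_exp κ])
    have h3 : κ / (1 + κ) ≤ 1 - Real.exp (-κ) := by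
      have : κ / (1 + κ) = 1 - (1 + κ)⁻¹ := by field_simp; ring
      linarith
    calc (1 - Real.exp (-κ))⁻¹ ≤ (κ / (1 + κ))⁻¹ := inv_anti₀ (by positivity) h3
      _ = 1 + κ⁻¹ := by field_simp; ring
  rw [tsum_of_nat_of_neg_add_one ENNReal.summable ENNReal.summable,
    two_mul, ENNReal.ofReal_add (by positivity) (by positivity)]
  refine add_le_add (le_trans (ENNReal.tsum_le_tsum fun n => ?_) hgeo)
    (le_trans (ENNReal.tsum_le_tsum fun n => ?_) hgeo)
  · simp
  · refine ENNReal.ofReal_le_ofReal (Real.exp_le_exp.2 (neg_le_neg ?_))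
    refine mul_le_mul_of_nonneg_left ?_ hκ.le
    push_cast
    rw [abs_of_nonpos (by linarith [(Nat.cast_nonneg n : (0 : ℝ) ≤ n)])]
    linarith

theorem tsum_pi_prod {α : Type*} : ∀ (N : ℕ) (f : Fin N → α → ENNReal),
    ∑' a : Fin N → α, ∏ i, f i (a i) = ∏ i, ∑' x, f i x := by
  intro N
  induction N with
  | zero => intro f; simp
  | succ N ih =>
    intro f
    rw [← (Fin.consEquiv fun _ => α).tsum_eq, ENNReal.tsum_prod', Fin.prod_univ_succ]
    simp only [Fin.consEquiv_apply, Fin.prod_univ_succ, Fin.cons_zero, Fin.cons_succ]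
    rw [← ih, ← ENNReal.tsum_mul_right]
    exact tsum_congr fun x => ENNReal.tsum_mul_left

/-- After scaling, the floor of an injective linear map is injective on lattice points, which
reduces the sum to a product of geometric series. -/
theorem tsum_exp_neg_le {n N : ℕ} (T : (Fin n → ℝ) →ₗ[ℝ] (Fin N → ℝ))
    (hT : Function.Injective T) :
    ∃ C : ℝ, 0 < C ∧ ∀ κ b : Fin N → ℝ, (∀ i, 0 < κ i ∧ κ i ≤ 1) →
      ∑' j : Fin n → ℕ, ENNReal.ofReal (Real.exp (-∑ i, κ i * |T (toPoint j) i - b i|)) ≤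
        ENNReal.ofReal (C * ∏ i, (κ i)⁻¹) := by
  obtain ⟨K, -, hK⟩ := T.exists_antilipschitzWith (LinearMap.ker_eq_bot.2 hT)
  set lam : ℝ := K + 1 with hlam
  have hlam1 : 1 ≤ lam := by have := K.2; change (0 : ℝ) ≤ K at this; linarith
  have hlam0 : 0 < lam := by linarith
  refine ⟨(Real.exp 1 * (4 * lam)) ^ N, by positivity, fun κ b hκ => ?_⟩
  let φ : (Fin n → ℕ) → (Fin N → ℤ) := fun j i => ⌊lam * (T (toPoint j) i - b i)⌋
  have hφ : Function.Injective φ := by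
    intro j j' h
    have h1 : dist (T (toPoint j)) (T (toPoint j')) ≤ lam⁻¹ := by
      rw [dist_pi_le_iff (by positivity)]
      intro i
      have h2 := Int.abs_sub_lt_one_of_floor_eq_floor (congrFun h i)
      rw [← mul_sub, abs_mul, abs_of_pos hlam0] at h2
      rw [Real.dist_eq, ← one_div, le_div_iff₀ hlam0, mul_comm]
      rw [sub_sub_sub_cancel_right] at h2
      exact h2.le
    have h3 : dist (toPoint j) (toPoint j') < 1 := by
      have h4 := hK.le_mul_dist (toPoint j) (toPoint j')
      have h5 : (K : ℝ) * dist (T (toPoint j)) (T (toPoint j')) ≤ K * lam⁻¹ :=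
        mul_le_mul_of_nonneg_left h1 K.2
      have h6 : (K : ℝ) * lam⁻¹ < 1 := by
        rw [← div_eq_mul_inv, div_lt_one hlam0]; linarith
      linarith
    funext i
    have h7 := (dist_le_pi_dist (toPoint j) (toPoint j') i).trans_lt h3
    simp only [toPoint, Real.dist_eq] at h7
    have h8 : |(j i : ℤ) - (j' i : ℤ)| < 1 := by exact_mod_cast h7
    have := Int.abs_lt_one_iff.1 h8
    omega
  let g : Fin N → ℤ → ENNReal := fun i a =>
    ENNReal.ofReal (Real.exp 1) * ENNReal.ofReal (Real.exp (-(κ i / lam * |(a : ℝ)|)))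
  calc ∑' j : Fin n → ℕ, ENNReal.ofReal (Real.exp (-∑ i, κ i * |T (toPoint j) i - b i|))
      ≤ ∑' j : Fin n → ℕ, ∏ i, g i (φ j i) := by
        refine ENNReal.tsum_le_tsum fun j => ?_
        rw [← Finset.sum_neg_distrib, Real.exp_sum, ENNReal.ofReal_prod_of_nonneg
          (fun i _ => (Real.exp_pos _).le)]
        refine Finset.prod_le_prod' fun i _ => ?_
        simp only [g, φ]
        rw [← ENNReal.ofReal_mul (Real.exp_pos _).le, ← Real.exp_add]
        refine ENNReal.ofReal_le_ofReal (Real.exp_le_exp.2 ?_)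
        set y := T (toPoint j) i - b i
        have h1 := Int.floor_le (lam * y)
        have h2 := Int.lt_floor_add_one (lam * y)
        have h3 : |(⌊lam * y⌋ : ℝ)| ≤ lam * |y| + 1 := by
          rw [← abs_of_pos hlam0, ← abs_mul, abs_of_pos hlam0]
          have : |(⌊lam * y⌋ : ℝ)| ≤ |lam * y| + |(⌊lam * y⌋ : ℝ) - lam * y| := by
            have := abs_add_le (lam * y) ((⌊lam * y⌋ : ℝ) - lam * y)
            simpa using this
          have h4 : |(⌊lam * y⌋ : ℝ) - lam * y| ≤ 1 := abs_le.2 ⟨by linarith, by linarith⟩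
          linarith
        have h5 : κ i / lam * |(⌊lam * y⌋ : ℝ)| ≤ κ i / lam * (lam * |y| + 1) :=
          mul_le_mul_of_nonneg_left h3 (div_pos (hκ i).1 hlam0).le
        have h6 : κ i / lam * (lam * |y| + 1) = κ i * |y| + κ i / lam := by
          field_simp
        have h7 : κ i / lam ≤ 1 := (div_le_one hlam0).2 ((hκ i).2.trans hlam1)
        linarith
    _ ≤ ∑' a : Fin N → ℤ, ∏ i, g i (a i) := ENNReal.tsum_comp_le_tsum_of_injective hφ _
    _ = ∏ i, ∑' a, g i a := tsum_pi_prod N g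
    _ ≤ ∏ i, ENNReal.ofReal (Real.exp 1 * (4 * lam) * (κ i)⁻¹) := by
        refine Finset.prod_le_prod' fun i _ => ?_
        simp only [g]
        rw [ENNReal.tsum_mul_left, mul_assoc, ENNReal.ofReal_mul (Real.exp_pos _).le]
        gcongr
        have hpos := div_pos (hκ i).1 hlam0
        refine (tsum_int_exp_neg_abs_le hpos).trans (ENNReal.ofReal_le_ofReal ?_)
        have h1 : (1 : ℝ) ≤ (κ i / lam)⁻¹ :=
          (one_le_inv₀ hpos).2 ((div_le_one hlam0).2 ((hκ i).2.trans hlam1))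
        have h2 : (κ i / lam)⁻¹ = lam * (κ i)⁻¹ := by rw [inv_div, div_eq_mul_inv]
        rw [h2] at h1 ⊢
        nlinarith
    _ = _ := by
        rw [← ENNReal.ofReal_prod_of_nonneg
          (fun i _ => by have := (hκ i).1; positivity), Finset.prod_mul_distrib]
        simp

theorem exists_single_notMem_span {n r : ℕ} (hr : r < n) (w : Fin r → Fin n → ℝ) :
    ∃ i : Fin n, (Pi.single i 1 : Fin n → ℝ) ∉ Submodule.span ℝ (range w) := by
  by_contra! hcon
  have htop : Submodule.span ℝ (range w) = ⊤ := by
    rw [eq_top_iff, ← (Pi.basisFun ℝ (Fin n)).span_eq, Submodule.span_le]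
    rintro _ ⟨i, rfl⟩
    simpa using hcon i
  have h1 := finrank_range_le_card (R := ℝ) w
  rw [Set.finrank, htop, finrank_top] at h1
  simp at h1
  omega

/-- Exponential sums over the lattice points near an affine subspace of codimension `r`, truncated
at height `L`: the number of essential terms is of order `L ^ (n - r)`. By induction on `n - r`:
the truncation, which bounds each coordinate by about `L`, is traded for a further linear form,
a coordinate function weighted with `1 / L`. -/
theorem tsum_exp_neg_truncated_le {n : ℕ} (t : ℕ) : ∀ (r : ℕ), r + t = n →
    ∀ (w : Fin r → Fin n → ℝ), LinearIndependent ℝ w → ∀ c : ℝ, 0 < c →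
    ∃ C : ℝ, 0 < C ∧ ∀ (κ b : Fin r → ℝ), (∀ i, 0 < κ i ∧ κ i ≤ 1) → ∀ L : ℝ, 1 ≤ L →
      ∑' j : Fin n → ℕ, ENNReal.ofReal (Real.exp (-(∑ i, κ i * |w i ⬝ᵥ toPoint j - b i| +
        c * max (∑ i, (j i : ℝ) - L) 0))) ≤ ENNReal.ofReal (C * (∏ i, (κ i)⁻¹) * L ^ t) := by
  induction t with
  | zero =>
    intro r hr w hw c hc
    obtain rfl : r = n := by simpa using hr
    have hinj : Function.Injective (Matrix.mulVecLin (Matrix.of w)) := by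
      have h1 : LinearIndependent ℝ (Matrix.of w).row := hw
      rw [Matrix.linearIndependent_rows_iff_isUnit, ← Matrix.mulVec_injective_iff_isUnit] at h1
      exact h1
    obtain ⟨C, hC, h⟩ := tsum_exp_neg_le _ hinj
    refine ⟨C, hC, fun κ b hκ L hL => ?_⟩
    rw [pow_zero, mul_one]
    refine le_trans (ENNReal.tsum_le_tsum fun j => ?_) (h κ b hκ)
    refine ENNReal.ofReal_le_ofReal (Real.exp_le_exp.2 (neg_le_neg ?_))
    have : 0 ≤ c * max (∑ i, (j i : ℝ) - L) 0 := by positivity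
    simp only [Matrix.mulVecLin_apply, Matrix.mulVec, Matrix.of_apply]
    linarith
  | succ t ih =>
    intro r hr w hw c hc
    obtain ⟨e, he⟩ := exists_single_notMem_span (show r < n by omega) w
    obtain ⟨C, hC, h⟩ := ih (r + 1) (by omega) (Fin.snoc w (Pi.single e 1))
      (linearIndependent_finSnoc.2 ⟨hw, he⟩) (c / 2) (by positivity)
    set c' := min (c / 2) 1 with hc'
    have hc'0 : 0 < c' := lt_min (by positivity) one_pos
    refine ⟨Real.exp c' * C * c'⁻¹, by positivity, fun κ b hκ L hL => ?_⟩
    have hL0 : 0 < L := by linarith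
    have h1 := h (Fin.snoc κ (c' / L)) (Fin.snoc b 0) (fun i => by
      refine Fin.lastCases ?_ (fun i => ?_) i
      · simp only [Fin.snoc_last]
        exact ⟨by positivity, (div_le_one hL0).2 ((min_le_right _ _).trans hL)⟩
      · simpa using hκ i) L hL
    calc _ ≤ ∑' j : Fin n → ℕ, ENNReal.ofReal (Real.exp c') * ENNReal.ofReal (Real.exp
            (-(∑ i, (Fin.snoc κ (c' / L) : Fin (r + 1) → ℝ) i *
              |(Fin.snoc w (Pi.single e 1) : Fin (r + 1) → Fin n → ℝ) i ⬝ᵥ toPoint j -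
                (Fin.snoc b 0 : Fin (r + 1) → ℝ) i| +
              c / 2 * max (∑ i, (j i : ℝ) - L) 0))) := by
          refine ENNReal.tsum_le_tsum fun j => ?_
          rw [← ENNReal.ofReal_mul (Real.exp_pos _).le, ← Real.exp_add]
          refine ENNReal.ofReal_le_ofReal (Real.exp_le_exp.2 ?_)
          rw [Fin.sum_univ_castSucc]
          simp only [Fin.snoc_castSucc, Fin.snoc_last, single_dotProduct, one_mul, sub_zero,
            toPoint, Nat.abs_cast]
          have hje : (j e : ℝ) ≤ ∑ i, (j i : ℝ) :=
            Finset.single_le_sum (f := fun i => (j i : ℝ)) (fun i _ => Nat.cast_nonneg _)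
              (Finset.mem_univ e)
          have h0 : (0 : ℝ) ≤ j e := Nat.cast_nonneg _
          set M := max (∑ i, (j i : ℝ) - L) 0 with hM
          have hM1 : ∑ i, (j i : ℝ) - L ≤ M := le_max_left _ _
          have hM0 : 0 ≤ M := le_max_right _ _
          have h2 : (j e : ℝ) / L ≤ M + 1 := by
            rw [div_le_iff₀ hL0]; nlinarith
          have h3 : c' / L * (j e : ℝ) ≤ c' * M + c' := by
            calc c' / L * (j e : ℝ) = c' * ((j e : ℝ) / L) := by ring
              _ ≤ c' * (M + 1) := mul_le_mul_of_nonneg_left h2 hc'0.le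
              _ = _ := by ring
          have h4 : c' * M ≤ c / 2 * M := mul_le_mul_of_nonneg_right (min_le_left _ _) hM0
          linarith
      _ ≤ ENNReal.ofReal (Real.exp c') * ENNReal.ofReal (C *
            (∏ i, ((Fin.snoc κ (c' / L) : Fin (r + 1) → ℝ) i)⁻¹) * L ^ t) := by
          rw [ENNReal.tsum_mul_left]
          gcongr
      _ = _ := by
          rw [← ENNReal.ofReal_mul (Real.exp_pos _).le, Fin.prod_univ_castSucc]
          simp only [Fin.snoc_castSucc, Fin.snoc_last]
          congr 1
          field_simp
          ring

/-! ### Stability of sublevel estimates under small analytic perturbations -/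

theorem abs_monom_le {n : ℕ} (α : Fin n → ℕ) {y : Fin n → ℝ} {R : ℝ} (hy : ∀ i, |y i| ≤ R) :
    |monom α y| ≤ R ^ ∑ i, α i := by
  rw [monom, Finset.abs_prod, ← Finset.prod_pow_eq_pow_sum]
  refine Finset.prod_le_prod (fun i _ => abs_nonneg _) fun i _ => ?_
  rw [abs_pow]
  exact pow_le_pow_left₀ (abs_nonneg _) (hy i) _

theorem continuous_monom {n : ℕ} (α : Fin n → ℕ) : Continuous (monom α) := by
  unfold monom; fun_prop

/-- The restriction of a power series with small coefficients to a line segment has small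
derivatives of all orders, by Cauchy's estimates on complex discs. -/
theorem exists_line_derivatives {n : ℕ} {e : (Fin n → ℕ) → ℝ}
    (he : Summable fun α => |e α| * 4 ^ ∑ i, α i) {y v : Fin n → ℝ} (hy : ‖y‖ ≤ 3)
    (hv : ‖v‖ ≤ 1 / 2) :
    ∃ G : ℕ → ℝ → ℝ, (∀ s : ℝ, |s| ≤ 1 / 2 → G 0 s = ∑' α, e α * monom α (y + s • v)) ∧
      (∀ l, ∀ s : ℝ, |s| ≤ 1 / 2 → HasDerivAt (G l) (G (l + 1) s) s) ∧
      ∀ l, ∀ s : ℝ, |s| ≤ 1 / 2 → |G l s| ≤ l.factorial * ∑' α, |e α| * 4 ^ ∑ i, α i := by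
  let T : (Fin n → ℕ) → ℂ → ℂ := fun α z => (e α : ℂ) * ∏ i, ((y i : ℂ) + z * v i) ^ α i
  let F : ℂ → ℂ := fun z => ∑' α, T α z
  have hT : ∀ α z, z ∈ Metric.ball (0 : ℂ) 2 → ‖T α z‖ ≤ |e α| * 4 ^ ∑ i, α i := by
    intro α z hz
    rw [Metric.mem_ball, dist_zero_right] at hz
    simp only [T]
    rw [norm_mul, Complex.norm_real, Real.norm_eq_abs, norm_prod, ← Finset.prod_pow_eq_pow_sum]
    refine mul_le_mul_of_nonneg_left (Finset.prod_le_prod (fun i _ => norm_nonneg _)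
      fun i _ => ?_) (abs_nonneg _)
    rw [norm_pow]
    refine pow_le_pow_left₀ (norm_nonneg _) ?_ _
    have h1 : |y i| ≤ 3 := (norm_le_pi_norm y i).trans hy
    have h2 : |v i| ≤ 1 / 2 := (norm_le_pi_norm v i).trans hv
    calc ‖(y i : ℂ) + z * v i‖ ≤ ‖(y i : ℂ)‖ + ‖z * v i‖ := norm_add_le _ _
      _ = |y i| + ‖z‖ * |v i| := by simp
      _ ≤ 3 + 2 * (1 / 2) := by gcongr
      _ = 4 := by norm_num
  have hF : DifferentiableOn ℂ F (Metric.ball 0 2) := by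
    refine Complex.differentiableOn_tsum_of_summable_norm he (fun α => ?_) Metric.isOpen_ball hT
    refine Differentiable.differentiableOn ?_
    simp only [T]
    fun_prop
  have hFa : AnalyticOnNhd ℂ F (Metric.ball 0 2) := hF.analyticOnNhd Metric.isOpen_ball
  have hmem : ∀ s : ℝ, |s| ≤ 1 / 2 → (s : ℂ) ∈ Metric.ball (0 : ℂ) 2 := by
    intro s hs
    rw [Metric.mem_ball, dist_zero_right, Complex.norm_real, Real.norm_eq_abs]
    linarith
  refine ⟨fun l s => (iteratedDeriv l F s).re, fun s hs => ?_, fun l s hs => ?_, fun l s hs => ?_⟩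
  · have : F s = ((∑' α, e α * monom α (y + s • v) : ℝ) : ℂ) := by
      rw [Complex.ofReal_tsum]
      refine tsum_congr fun α => ?_
      simp [T, monom]
    simp [this]
  · refine HasDerivAt.real_of_complex (e := iteratedDeriv l F) ?_
    rw [iteratedDeriv_succ]
    have := hFa.iterated_deriv l _ (hmem s hs)
    rw [← iteratedDeriv_eq_iterate] at this
    exact this.differentiableAt.hasDerivAt
  · refine (Complex.abs_re_le_norm _).trans ?_
    have hsub : Metric.closedBall (s : ℂ) 1 ⊆ Metric.ball 0 2 := by
      intro z hz
      rw [Metric.mem_closedBall, dist_eq_norm] at hz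
      rw [Metric.mem_ball, dist_zero_right]
      have h1 : ‖(s : ℂ)‖ ≤ 1 / 2 := by rwa [Complex.norm_real]
      have h2 := norm_add_le (z - s) (s : ℂ)
      rw [sub_add_cancel] at h2
      linarith
    have hd : DiffContOnCl ℂ F (Metric.ball (s : ℂ) 1) :=
      (hF.mono hsub).diffContOnCl_ball le_rfl
    have := Complex.norm_iteratedDeriv_le_of_forall_mem_sphere_norm_le
      (C := ∑' α, |e α| * 4 ^ ∑ i, α i) l one_pos hd fun z hz =>
        tsum_of_norm_bounded he.hasSum fun α => hT α z (hsub (Metric.sphere_subset_closedBall hz))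
    simpa using this

theorem hasDerivAt_iteratedFDeriv_line {n : ℕ} {f : (Fin n → ℝ) → ℝ} (hf : ContDiff ℝ ∞ f)
    (y v : Fin n → ℝ) (l : ℕ) (s : ℝ) :
    HasDerivAt (fun s : ℝ => iteratedFDeriv ℝ l f (y + s • v) fun _ => v)
      (iteratedFDeriv ℝ (l + 1) f (y + s • v) fun _ => v) s := by
  have h1 : HasDerivAt (fun s : ℝ => y + s • v) v s := by
    simpa using ((hasDerivAt_id s).smul_const v).const_add y
  have h2 : DifferentiableAt ℝ (iteratedFDeriv ℝ l f) (y + s • v) :=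
    (hf.differentiable_iteratedFDeriv (by exact_mod_cast WithTop.coe_lt_top _)).differentiableAt
  have h3 := h2.hasFDerivAt.comp_hasDerivAt s h1
  have h4 := (ContinuousMultilinearMap.apply ℝ (fun _ : Fin l => Fin n → ℝ) ℝ
    (fun _ => v)).hasFDerivAt.comp_hasDerivAt s h3
  exact h4

theorem continuousOn_tsum_monom {n : ℕ} {e : (Fin n → ℕ) → ℝ}
    (he : Summable fun α => |e α| * 4 ^ ∑ i, α i) :
    ContinuousOn (fun y : Fin n → ℝ => ∑' α, e α * monom α y) (Metric.closedBall 0 4) := by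
  refine continuousOn_tsum (fun α => (continuous_const.mul (continuous_monom α)).continuousOn) he
    fun α y hy => ?_
  rw [Metric.mem_closedBall, dist_zero_right] at hy
  rw [norm_mul, Real.norm_eq_abs, Real.norm_eq_abs]
  exact mul_le_mul_of_nonneg_left (abs_monom_le α fun i => (norm_le_pi_norm y i).trans hy)
    (abs_nonneg _)

/-- Near a point where an `m`-th directional derivative of `f` does not vanish, the measure of the
sublevel set `{|g| < δ}` is `O(δ ^ (1 / D))`, `m ≤ D`, uniformly for all analytic functions `g`
close to `f`. -/
theorem exists_nhds_volume_sublevel_le {n : ℕ} {f : (Fin n → ℝ) → ℝ} (hf : ContDiff ℝ ∞ f)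
    {y₀ : Fin n → ℝ} (hy₀ : ‖y₀‖ ≤ 2) {m : ℕ} {v : Fin n → ℝ}
    (hv : iteratedFDeriv ℝ m f y₀ (fun _ => v) ≠ 0) {D : ℝ} (hD : 0 < D) (hm : (m : ℝ) ≤ D) :
    ∃ W ∈ 𝓝 y₀, ∃ η C : ℝ, 0 < η ∧ 0 < C ∧ ∀ e : (Fin n → ℕ) → ℝ,
      (Summable fun α => |e α| * 4 ^ ∑ i, α i) → ∑' α, |e α| * 4 ^ ∑ i, α i ≤ η →
      ∀ δ : ℝ, 0 < δ → volume {y | y ∈ W ∧ |f y + ∑' α, e α * monom α y| < δ} ≤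
        ENNReal.ofReal (C * δ ^ (1 / D)) := by
  wlog hv2 : ‖v‖ ≤ 1 / 2 generalizing v
  · set τ : ℝ := (2 * (‖v‖ + 1))⁻¹ with hτ
    have hτ0 : 0 < τ := by positivity
    refine this (v := τ • v) ?_ ?_
    · rw [(iteratedFDeriv ℝ m f y₀).map_smul_univ (fun _ => τ) (fun _ => v)]
      simp [hτ0.ne', hv]
    · rw [norm_smul, Real.norm_eq_abs, abs_of_pos hτ0, hτ, ← div_eq_inv_mul,
        div_le_iff₀ (by positivity)]
      linarith
  set h : (Fin n → ℝ) → ℝ := fun y => iteratedFDeriv ℝ m f y fun _ => v with hh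
  have hcont : Continuous h :=
    (ContinuousMultilinearMap.apply ℝ (fun _ : Fin m => Fin n → ℝ) ℝ (fun _ => v)).continuous.comp
      (hf.continuous_iteratedFDeriv (by exact_mod_cast le_top))
  set c : ℝ := |h y₀| / 3 with hc
  have hc0 : 0 < c := by have := abs_pos.2 hv; positivity
  have hev : ∀ᶠ y in 𝓝 y₀, 2 * c < |h y| :=
    hcont.abs.continuousAt.eventually_const_lt (by
      have := abs_pos.2 hv; change 2 * (|h y₀| / 3) < |h y₀|; linarith)
  obtain ⟨R', hR'0, hR'⟩ := Metric.eventually_nhds_iff_ball.1 hev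
  set R := min R' 1 with hR
  have hR0 : 0 < R := lt_min hR'0 one_pos
  have hR1 : R ≤ 1 := min_le_right _ _
  set ρ := R / 2 with hρ
  have hρ0 : 0 < ρ := by positivity
  set B : ENNReal := volume (Metric.closedBall y₀ (ρ + ρ * ‖v‖)) with hB
  have hBtop : B ≠ ⊤ := (isCompact_closedBall _ _).measure_lt_top.ne
  -- Cauchy's estimate costs a factor `m!`, so this `η` keeps the `m`-th derivative above `c`
  refine ⟨Metric.ball y₀ ρ, Metric.ball_mem_nhds _ hρ0, c / m.factorial,
    ((2 ^ m * 2) * B.toReal / (2 * ρ) + B.toReal + 1) * (c⁻¹) ^ (1 / D), by positivity,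
    by positivity, fun e he heη δ hδ => ?_⟩
  have hδc : (c⁻¹) ^ (1 / D) * δ ^ (1 / D) = (δ / c) ^ (1 / D) := by
    rw [← Real.mul_rpow (by positivity) hδ.le, div_eq_inv_mul δ]
  rw [mul_assoc, hδc]
  set g : (Fin n → ℝ) → ℝ := fun y => f y + ∑' α, e α * monom α y with hg
  have hsub : {y | y ∈ Metric.ball y₀ ρ ∧ |g y| < δ} ⊆ Metric.closedBall y₀ ρ :=
    fun y hy => Metric.ball_subset_closedBall hy.1
  -- for `δ > c` the volume of the ball suffices
  by_cases hcase : δ ≤ c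
  · set s : ℝ := 2 * (δ / c) ^ (1 / D) with hs
    have hs0 : 0 < s := by positivity
    have hmeas : MeasurableSet {y | y ∈ Metric.ball y₀ ρ ∧ |g y| < δ} := by
      have hgc : ContinuousOn g (Metric.ball y₀ ρ) := by
        refine hf.continuous.continuousOn.add ((continuousOn_tsum_monom he).mono fun y hy => ?_)
        rw [Metric.mem_ball, dist_eq_norm] at hy
        rw [Metric.mem_closedBall, dist_zero_right]
        have := norm_add_le (y - y₀) y₀
        rw [sub_add_cancel] at this
        linarith
      exact (hgc.abs.isOpen_inter_preimage Metric.isOpen_ball isOpen_Iio).measurableSet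
    have hslice : ∀ y, volume {t : ℝ | t ∈ Icc (-ρ) ρ ∧
        y + t • v ∈ {y | y ∈ Metric.ball y₀ ρ ∧ |g y| < δ}} ≤ ENNReal.ofReal (2 ^ m * s) := by
      intro y
      rcases eq_empty_or_nonempty {t : ℝ | t ∈ Icc (-ρ) ρ ∧
        y + t • v ∈ {y | y ∈ Metric.ball y₀ ρ ∧ |g y| < δ}} with h0 | ⟨t₀, ht₀, ht₀'⟩
      · rw [h0]; simp
      have hnear : ∀ t ∈ Icc (-ρ) ρ, y + t • v ∈ Metric.ball y₀ R := by
        intro t ht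
        have h1 := ht₀'.1
        rw [Metric.mem_ball, dist_eq_norm] at h1 ⊢
        have h2 : ‖(t - t₀) • v‖ ≤ ρ := by
          rw [norm_smul, Real.norm_eq_abs]
          have : |t - t₀| ≤ 2 * ρ := abs_le.2 ⟨by linarith [ht.1, ht₀.2], by linarith [ht.2, ht₀.1]⟩
          calc |t - t₀| * ‖v‖ ≤ 2 * ρ * (1 / 2) :=
                mul_le_mul this hv2 (norm_nonneg _) (by positivity)
            _ = ρ := by ring
        calc ‖y + t • v - y₀‖ = ‖(y + t₀ • v - y₀) + (t - t₀) • v‖ := by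
              congr 1; rw [sub_smul]; abel
          _ < R := by
              have := norm_add_le (y + t₀ • v - y₀) ((t - t₀) • v)
              linarith
      have hy3 : ‖y‖ ≤ 3 := by
        have h1 := hnear 0 ⟨by linarith, by linarith⟩
        rw [zero_smul, add_zero, Metric.mem_ball, dist_eq_norm] at h1
        have := norm_add_le (y - y₀) y₀
        rw [sub_add_cancel] at this
        linarith
      have hρs : ∀ t ∈ Icc (-ρ) ρ, |t| ≤ 1 / 2 := fun t ht =>
        (abs_le.2 ⟨ht.1, ht.2⟩).trans (by linarith)
      obtain ⟨G, hG0, hG1, hG2⟩ := exists_line_derivatives he hy3 hv2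
      refine le_trans (measure_mono ?_) (volume_sublevel_le_of_deriv m
        (fun l t => iteratedFDeriv ℝ l f (y + t • v) (fun _ => v) + G l t) (a := -ρ) (b := ρ)
        (c := c) (δ := δ) hs0
        (fun l _ t ht => (hasDerivAt_iteratedFDeriv_line hf y v l t).add (hG1 l t (hρs t ht)))
        (fun t ht => ?_) ?_)
      · rintro t ⟨ht, -, ht2⟩
        refine ⟨ht, ?_⟩
        simpa [hG0 t (hρs t ht), hg] using ht2
      · have h1 : 2 * c < |h (y + t • v)| :=
          hR' _ (Metric.ball_subset_ball (min_le_left _ _) (hnear t ht))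
        have h2 : |G m t| ≤ c := by
          refine (hG2 m t (hρs t ht)).trans ?_
          rw [le_div_iff₀' (by positivity)] at heη
          exact heη
        have h3 := abs_sub_abs_le_abs_add (h (y + t • v)) (G m t)
        change c ≤ |h (y + t • v) + G m t|
        linarith
      · have h1 : s / 2 = (δ / c) ^ (1 / D) := by rw [hs]; ring
        rw [h1, ← Real.rpow_natCast, ← Real.rpow_mul (by positivity)]
        have h2 : (δ / c) ^ (1 : ℝ) ≤ (δ / c) ^ (1 / D * m) := by
          refine Real.rpow_le_rpow_of_exponent_ge (by positivity) ((div_le_one hc0).2 hcase) ?_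
          rw [one_div, inv_mul_le_iff₀ hD, mul_one]
          exact hm
        rw [Real.rpow_one, div_le_iff₀' hc0] at h2
        exact h2
    refine (volume_le_of_slices hmeas v y₀ hρ0 hsub hslice).trans ?_
    rw [← hB]
    conv_lhs => rw [← ENNReal.ofReal_toReal hBtop]
    rw [← ENNReal.ofReal_mul (by positivity),
      ← ENNReal.ofReal_div_of_pos (by positivity)]
    refine ENNReal.ofReal_le_ofReal ?_
    have h1 : 2 ^ m * s * B.toReal / (2 * ρ)
        = (2 ^ m * 2) * B.toReal / (2 * ρ) * (δ / c) ^ (1 / D) := by rw [hs]; ring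
    rw [h1]
    refine mul_le_mul_of_nonneg_right ?_ (by positivity)
    have := ENNReal.toReal_nonneg (a := B)
    linarith
  · have h1 : (1 : ℝ) ≤ (δ / c) ^ (1 / D) :=
      Real.one_le_rpow ((one_le_div hc0).2 (not_le.1 hcase).le) (by positivity)
    calc volume {y | y ∈ Metric.ball y₀ ρ ∧ |g y| < δ} ≤ B :=
          measure_mono (hsub.trans (Metric.closedBall_subset_closedBall
            (le_add_of_nonneg_right (by positivity))))
      _ = ENNReal.ofReal B.toReal := (ENNReal.ofReal_toReal hBtop).symm
      _ ≤ _ := by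
        refine ENNReal.ofReal_le_ofReal ?_
        have h2 := ENNReal.toReal_nonneg (a := B)
        have h3 : (0 : ℝ) ≤ (2 ^ m * 2) * B.toReal / (2 * ρ) := by positivity
        nlinarith

/-- The product of dyadic shells `{y | 1 ≤ |y i| ≤ 2 for all i}`. -/
def shell (n : ℕ) : Set (Fin n → ℝ) := {y | ∀ i, 1 ≤ |y i| ∧ |y i| ≤ 2}

theorem norm_le_of_mem_shell {n : ℕ} {y : Fin n → ℝ} (hy : y ∈ shell n) : ‖y‖ ≤ 2 :=
  (pi_norm_le_iff_of_nonneg (by norm_num)).2 fun i => (hy i).2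

theorem isCompact_shell (n : ℕ) : IsCompact (shell n) := by
  refine Metric.isCompact_of_isClosed_isBounded ?_ ((Metric.isBounded_closedBall
    (x := (0 : Fin n → ℝ)) (r := 2)).subset fun y hy => by simpa using norm_le_of_mem_shell hy)
  have : shell n = ⋂ i, {y | 1 ≤ |y i| ∧ |y i| ≤ 2} := by ext y; simp [shell]
  rw [this]
  refine isClosed_iInter fun i => ?_
  exact (isClosed_le (f := fun _ => (1 : ℝ)) (g := fun y : Fin n → ℝ => |y i|) (by fun_prop)
    (by fun_prop)).inter (isClosed_le (f := fun y : Fin n → ℝ => |y i|) (by fun_prop)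
    (by fun_prop))

theorem exists_volume_shell_sublevel_le {n : ℕ} {f : (Fin n → ℝ) → ℝ} (hf : ContDiff ℝ ∞ f)
    {D : ℝ} (hD : 0 < D) (hfD : ∀ y ∈ shell n, ∃ (m : ℕ) (v : Fin n → ℝ), (m : ℝ) ≤ D ∧
      iteratedFDeriv ℝ m f y (fun _ => v) ≠ 0) :
    ∃ η C : ℝ, 0 < η ∧ 0 < C ∧ ∀ e : (Fin n → ℕ) → ℝ,
      (Summable fun α => |e α| * 4 ^ ∑ i, α i) → ∑' α, |e α| * 4 ^ ∑ i, α i ≤ η →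
      ∀ δ : ℝ, 0 < δ → volume {y | y ∈ shell n ∧ |f y + ∑' α, e α * monom α y| < δ} ≤
        ENNReal.ofReal (C * δ ^ (1 / D)) := by
  refine (isCompact_shell n).induction_on (p := fun A => ∃ η C : ℝ, 0 < η ∧ 0 < C ∧
      ∀ e : (Fin n → ℕ) → ℝ,
      (Summable fun α => |e α| * 4 ^ ∑ i, α i) → ∑' α, |e α| * 4 ^ ∑ i, α i ≤ η →
      ∀ δ : ℝ, 0 < δ → volume {y | y ∈ A ∧ |f y + ∑' α, e α * monom α y| < δ} ≤
        ENNReal.ofReal (C * δ ^ (1 / D))) ?_ ?_ ?_ ?_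
  · exact ⟨1, 1, one_pos, one_pos, fun e _ _ δ _ => by simp⟩
  · rintro A A' hAA ⟨η, C, hη, hC, h⟩
    exact ⟨η, C, hη, hC, fun e he heη δ hδ =>
      (measure_mono (t := {y | y ∈ A' ∧ |f y + ∑' α, e α * monom α y| < δ})
        fun y hy => ⟨hAA hy.1, hy.2⟩).trans (h e he heη δ hδ)⟩
  · rintro A A' ⟨η, C, hη, hC, h⟩ ⟨η', C', hη', hC', h'⟩
    refine ⟨min η η', C + C', lt_min hη hη', by positivity, fun e he heη δ hδ => ?_⟩
    rw [add_mul, ENNReal.ofReal_add (by positivity) (by positivity)]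
    have hsub : {y | y ∈ A ∪ A' ∧ |f y + ∑' α, e α * monom α y| < δ} ⊆
        {y | y ∈ A ∧ |f y + ∑' α, e α * monom α y| < δ} ∪
          {y | y ∈ A' ∧ |f y + ∑' α, e α * monom α y| < δ} := by
      rintro y ⟨hy | hy, hy'⟩
      exacts [Or.inl ⟨hy, hy'⟩, Or.inr ⟨hy, hy'⟩]
    exact (measure_mono hsub).trans ((measure_union_le _ _).trans (add_le_add
      (h e he (heη.trans (min_le_left _ _)) δ hδ) (h' e he (heη.trans (min_le_right _ _)) δ hδ)))
  · intro y hy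
    obtain ⟨m, v, hm, hv⟩ := hfD y hy
    obtain ⟨W, hW, h⟩ := exists_nhds_volume_sublevel_le hf (norm_le_of_mem_shell hy) hv hD hm
    exact ⟨W, mem_nhdsWithin_of_mem_nhds hW, h⟩

/-- A nonvanishing derivative of least order does not vanish on the diagonal: the full multilinear
map is the polarization of its diagonal. -/
theorem exists_iteratedFDeriv_diag_ne_zero {n : ℕ} {f : (Fin n → ℝ) → ℝ} {x : Fin n → ℝ}
    (hf : AnalyticAt ℝ f x) {m : ℕ} (hm : iteratedFDeriv ℝ m f x ≠ 0) :
    ∃ v : Fin n → ℝ, iteratedFDeriv ℝ m f x (fun _ => v) ≠ 0 := by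
  by_contra! hcon
  obtain ⟨p, r, hp⟩ := hf
  have h0 : (fun y => p m fun _ => y) = fun _ => 0 := by
    funext y
    have h1 := hp.factorial_smul y m
    rw [hcon y, smul_eq_zero] at h1
    exact h1.resolve_left m.factorial_ne_zero
  refine hm (ContinuousMultilinearMap.ext fun v => ?_)
  rw [hp.iteratedFDeriv_eq_sum_of_completeSpace v, ← (p m).iteratedFDeriv_comp_diagonal 0 v, h0]
  simp

/-! ### The Taylor series in several variables -/

/-- The multi-index of a word in the variables: it counts how often each variable occurs. -/
def wordCount {n N : ℕ} (f : Fin N → Fin n) : Fin n → ℕ :=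
  fun i => (Finset.univ.filter fun k => f k = i).card

theorem sum_wordCount {n N : ℕ} (f : Fin N → Fin n) : ∑ i, wordCount f i = N := by
  have := Finset.card_eq_sum_card_fiberwise (f := f) (s := Finset.univ) (t := Finset.univ)
    (fun _ _ => Finset.mem_coe.2 (Finset.mem_univ _))
  simpa [wordCount] using this.symm

theorem prod_word_eq_monom {n N : ℕ} (f : Fin N → Fin n) (x : Fin n → ℝ) :
    ∏ k, x (f k) = monom (wordCount f) x := by
  rw [← Finset.prod_fiberwise' Finset.univ f x]
  simp [monom, wordCount, Finset.prod_const]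

theorem wordCount_comp_perm {n N : ℕ} (f : Fin N → Fin n) (σ : Equiv.Perm (Fin N)) :
    wordCount (f ∘ σ) = wordCount f := by
  funext i
  exact Finset.card_equiv σ (by simp)

/-- Words with the same multi-index are permutations of each other. -/
theorem exists_perm_of_wordCount_eq {n N : ℕ} {f g : Fin N → Fin n}
    (h : wordCount f = wordCount g) : ∃ σ : Equiv.Perm (Fin N), f ∘ σ = g := by
  have e : ∀ i, Nonempty ({k // g k = i} ≃ {k // f k = i}) := fun i => by
    refine ⟨Fintype.equivOfCardEq ?_⟩
    rw [Fintype.card_subtype, Fintype.card_subtype]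
    exact (congrFun h i).symm
  exact ⟨Equiv.ofFiberEquiv fun i => (e i).some, funext fun k => Equiv.ofFiberEquiv_map _ k⟩

theorem sum_perm_word {n N : ℕ} (f : Fin N → Fin n) (g : (Fin N → Fin n) → ℝ) :
    ∑ σ : Equiv.Perm (Fin N), g (f ∘ σ) =
      (∏ i, (Nat.factorial (wordCount f i) : ℝ)) *
        ∑ h ∈ Finset.univ.filter (fun h => wordCount h = wordCount f), g h := by
  rw [← Finset.sum_fiberwise_of_maps_to (s := Finset.univ)
    (t := Finset.univ.filter (fun h => wordCount h = wordCount f))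
    (g := fun σ : Equiv.Perm (Fin N) => f ∘ σ) (by simp [wordCount_comp_perm]), Finset.mul_sum]
  refine Finset.sum_congr rfl fun h hh => ?_
  obtain ⟨σ₁, rfl⟩ := exists_perm_of_wordCount_eq (Finset.mem_filter.1 hh).2.symm
  have h1 : ∑ σ ∈ Finset.univ.filter (fun σ : Equiv.Perm (Fin N) => f ∘ σ = f ∘ σ₁), g (f ∘ σ)
      = ∑ σ ∈ Finset.univ.filter (fun σ : Equiv.Perm (Fin N) => f ∘ σ = f ∘ σ₁), g (f ∘ σ₁) :=
    Finset.sum_congr rfl fun σ hσ => by rw [(Finset.mem_filter.1 hσ).2]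
  rw [h1, Finset.sum_const, nsmul_eq_mul]
  congr 1
  have h2 : (Finset.univ.filter (fun σ : Equiv.Perm (Fin N) => f ∘ σ = f ∘ σ₁)).card
      = (Finset.univ.filter (fun τ : Equiv.Perm (Fin N) => f ∘ τ = f)).card := by
    refine Finset.card_equiv (Equiv.mulRight σ₁⁻¹) fun σ => ?_
    simp only [Finset.mem_filter, Finset.mem_univ, true_and, Equiv.coe_mulRight]
    constructor
    · intro hσ
      funext k
      have := congrFun hσ (σ₁⁻¹ k)
      simpa using this
    · intro hσ
      funext k
      have := congrFun hσ (σ₁ k)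
      simpa using this
  rw [h2, ← Fintype.card_subtype, DomMulAct.stabilizer_card]
  push_cast
  refine Finset.prod_congr rfl fun i _ => ?_
  rw [Fintype.card_subtype, wordCount]

theorem wordCount_sortedWord {n : ℕ} (α : Fin n → ℕ) :
    wordCount (fun j => (finSigmaFinEquiv.symm j : (i : Fin n) × Fin (α i)).1) = α := by
  funext i
  have h1 : wordCount (fun j => (finSigmaFinEquiv.symm j : (i : Fin n) × Fin (α i)).1) i
      = (Finset.univ.filter fun s : (i : Fin n) × Fin (α i) => s.1 = i).card :=
    Finset.card_equiv finSigmaFinEquiv.symm (by simp)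
  rw [h1]
  have h2 : (Finset.univ.filter fun s : (i : Fin n) × Fin (α i) => s.1 = i)
      = (Finset.univ : Finset (Fin (α i))).map (Function.Embedding.sigmaMk i) := by
    ext ⟨i', k⟩
    simp only [Finset.mem_filter, Finset.mem_univ, true_and, Finset.mem_map,
      Function.Embedding.sigmaMk_apply]
    constructor
    · rintro rfl; exact ⟨k, rfl⟩
    · rintro ⟨k', h⟩; exact (congrArg Sigma.fst h).symm
  rw [h2, Finset.card_map, Finset.card_univ, Fintype.card_fin]

theorem taylorCoeff_eq_sum {n : ℕ} {S : (Fin n → ℝ) → ℝ}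
    {p : FormalMultilinearSeries ℝ (Fin n → ℝ) ℝ} {ρ : ENNReal}
    (hp : HasFPowerSeriesOnBall S p 0 ρ) (α : Fin n → ℕ) :
    taylorCoeff S α = ∑ f ∈ Finset.univ.filter
      (fun f : Fin (∑ i, α i) → Fin n => wordCount f = α),
        p (∑ i, α i) fun k => Pi.single (f k) 1 := by
  have h := sum_perm_word (fun j => (finSigmaFinEquiv.symm j : (i : Fin n) × Fin (α i)).1)
    (fun f => p (∑ i, α i) fun k => Pi.single (f k) 1)
  rw [wordCount_sortedWord] at h
  rw [taylorCoeff, hp.iteratedFDeriv_eq_sum_of_completeSpace, div_eq_iff, mul_comm, ← h]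
  · rfl
  · exact Finset.prod_ne_zero_iff.2 fun i _ => by exact_mod_cast (α i).factorial_ne_zero

theorem tsum_wordCount_fiber {n : ℕ} (F : (Σ N : ℕ, (Fin N → Fin n)) → ℝ) (α : Fin n → ℕ) :
    ∑' b : (fun b : Σ N : ℕ, (Fin N → Fin n) => wordCount b.2) ⁻¹' {α}, F b =
      ∑ f ∈ Finset.univ.filter (fun f : Fin (∑ i, α i) → Fin n => wordCount f = α),
        F ⟨∑ i, α i, f⟩ := by
  rw [tsum_subtype _ F, tsum_eq_sum (s := (Finset.univ.filter
    (fun f : Fin (∑ i, α i) → Fin n => wordCount f = α)).map (Function.Embedding.sigmaMk _)),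
    Finset.sum_map]
  · refine Finset.sum_congr rfl fun f hf => ?_
    exact indicator_of_mem (by simpa using hf) _
  · rintro ⟨N, f⟩ hb
    refine indicator_of_notMem (fun h => hb ?_) _
    have h1 : wordCount f = α := h
    have h2 : N = ∑ i, α i := by rw [← h1, sum_wordCount]
    subst h2
    simpa using h1

theorem multilinear_diag_eq_sum {n N : ℕ}
    (p : ContinuousMultilinearMap ℝ (fun _ : Fin N => Fin n → ℝ) ℝ) (x : Fin n → ℝ) :
    p (fun _ => x) = ∑ f : Fin N → Fin n, (p fun k => Pi.single (f k) 1) * monom (wordCount f) x := by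
  have hx : x = ∑ i, x i • (Pi.single i (1 : ℝ) : Fin n → ℝ) := pi_eq_sum_univ' x
  calc p (fun _ => x) = p (fun _ : Fin N => ∑ i, x i • (Pi.single i (1 : ℝ) : Fin n → ℝ)) := by
        rw [← hx]
    _ = ∑ f : Fin N → Fin n, p fun k => x (f k) • (Pi.single (f k) (1 : ℝ) : Fin n → ℝ) :=
        p.map_sum fun _ i => x i • (Pi.single i (1 : ℝ) : Fin n → ℝ)
    _ = _ := by
        refine Finset.sum_congr rfl fun f _ => ?_
        rw [p.map_smul_univ (fun k => x (f k)), prod_word_eq_monom, smul_eq_mul, mul_comm]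

/-- An analytic function is the sum of its absolutely convergent multivariate Taylor series. -/
theorem exists_taylor_expansion {n : ℕ} {S : (Fin n → ℝ) → ℝ} (hS : AnalyticAt ℝ S 0) :
    ∃ r : ℝ, 0 < r ∧ (Summable fun α => |taylorCoeff S α| * r ^ ∑ i, α i) ∧
      ∀ x : Fin n → ℝ, (∀ i, |x i| ≤ r) → HasSum (fun α => taylorCoeff S α * monom α x) (S x) := by
  obtain ⟨p, ρ, hp⟩ := hS
  obtain ⟨r₁, hr₁0, hr₁⟩ := ENNReal.lt_iff_exists_nnreal_btwn.1 hp.r_pos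
  have hr₁0' : (0 : ℝ) < r₁ := by exact_mod_cast hr₁0
  obtain ⟨C, hC, hpC⟩ := p.norm_mul_pow_le_of_lt_radius (hr₁.trans_le hp.r_le)
  set r : ℝ := r₁ / (2 * (n + 1)) with hr
  have hr0 : 0 < r := by positivity
  have hrn : n * r ≤ r₁ * (1 / 2) := by
    rw [hr, mul_div_assoc', div_le_iff₀ (by positivity)]
    nlinarith
  have hrr : r < r₁ := by
    rw [hr, div_lt_iff₀ (by positivity)]
    have : (0 : ℝ) ≤ n := Nat.cast_nonneg n
    nlinarith
  let a : (Σ N : ℕ, (Fin N → Fin n)) → ℝ := fun b => p b.1 fun k => Pi.single (b.2 k) 1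
  have ha : ∀ b, |a b| ≤ ‖p b.1‖ := fun b => by
    refine ((p b.1).le_opNorm _).trans (le_of_eq ?_)
    have : ∀ k, ‖(Pi.single (b.2 k) 1 : Fin n → ℝ)‖ = 1 := fun k => by
      rw [Pi.norm_single, norm_one]
    simp only [this, Finset.prod_const_one, mul_one]
  have hsum : Summable fun b => |a b| * r ^ b.1 := by
    refine (summable_sigma_of_nonneg fun b => by positivity).2 ⟨fun N => (hasSum_fintype _).summable,
      ?_⟩
    refine Summable.of_nonneg_of_le (fun N => tsum_nonneg fun f => by positivity) (fun N => ?_)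
      ((summable_geometric_of_lt_one (by norm_num) (by norm_num : (1 / 2 : ℝ) < 1)).mul_left C)
    rw [tsum_fintype]
    calc ∑ f : Fin N → Fin n, |a ⟨N, f⟩| * r ^ N ≤ ∑ f : Fin N → Fin n, ‖p N‖ * r ^ N :=
          Finset.sum_le_sum fun f _ => mul_le_mul_of_nonneg_right (ha ⟨N, f⟩) (by positivity)
      _ = ‖p N‖ * (n * r) ^ N := by simp [mul_pow]; ring
      _ ≤ ‖p N‖ * (r₁ * (1 / 2)) ^ N := by gcongr
      _ = ‖p N‖ * r₁ ^ N * (1 / 2) ^ N := by rw [mul_pow]; ring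
      _ ≤ C * (1 / 2) ^ N := by gcongr; exact hpC N
  refine ⟨r, hr0, ?_, fun x hx => ?_⟩
  · refine Summable.of_nonneg_of_le (fun α => by positivity) (fun α => ?_)
      (hsum.hasSum.tsum_fiberwise fun b => wordCount b.2).summable
    rw [tsum_wordCount_fiber (fun b => |a b| * r ^ b.1), taylorCoeff_eq_sum hp]
    dsimp only
    rw [← Finset.sum_mul]
    exact mul_le_mul_of_nonneg_right (Finset.abs_sum_le_sum_abs _ _) (by positivity)
  · have hx1 : ‖x‖ ≤ r := (pi_norm_le_iff_of_nonneg hr0.le).2 hx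
    have hS : HasSum (fun N => p N fun _ => x) (S x) := by
      have := hp.hasSum (y := x) (by
        rw [Metric.mem_eball, edist_zero_right]
        refine lt_trans ?_ hr₁
        rw [← ofReal_norm, ENNReal.ofReal_lt_iff_lt_toReal (norm_nonneg _) ENNReal.coe_ne_top]
        exact hx1.trans_lt hrr)
      rwa [zero_add] at this
    have hs2 : HasSum (fun b : Σ N : ℕ, (Fin N → Fin n) => a b * monom (wordCount b.2) x) (S x) := by
      refine HasSum.sigma_of_hasSum hS (fun N => ?_) (Summable.of_norm_bounded hsum fun b => ?_)
      · rw [multilinear_diag_eq_sum]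
        exact hasSum_fintype _
      · rw [norm_mul, Real.norm_eq_abs, Real.norm_eq_abs]
        refine mul_le_mul_of_nonneg_left ?_ (abs_nonneg _)
        simpa [sum_wordCount] using abs_monom_le (wordCount b.2) hx
    have h3 := hs2.tsum_fiberwise fun b => wordCount b.2
    refine (congrArg (fun F : (Fin n → ℕ) → ℝ => HasSum F (S x)) (funext fun α => ?_)).mp h3
    rw [tsum_wordCount_fiber (fun b => a b * monom (wordCount b.2) x), taylorCoeff_eq_sum hp,
      Finset.sum_mul]
    refine Finset.sum_congr rfl fun f hf => ?_
    simp only [(Finset.mem_filter.1 hf).2, a]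

/-! ### The Newton polyhedron and its faces -/

/-- The exponents of the monomials that occur in the Taylor series. -/
def taylorSupport {n : ℕ} (S : (Fin n → ℝ) → ℝ) : Set (Fin n → ℕ) := {α | taylorCoeff S α ≠ 0}

theorem taylorCoeff_zero {n : ℕ} {S : (Fin n → ℝ) → ℝ} (hS : AnalyticAt ℝ S 0) :
    taylorCoeff S 0 = S 0 := by
  obtain ⟨r, hr, -, h⟩ := exists_taylor_expansion hS
  have h1 := h 0 (fun i => by simpa using hr.le)
  have h2 := hasSum_single (f := fun α => taylorCoeff S α * monom α (0 : Fin n → ℝ)) 0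
    fun α hα => by
      obtain ⟨i, hi⟩ := Function.ne_iff.1 hα
      have : monom α (0 : Fin n → ℝ) = 0 :=
        Finset.prod_eq_zero (Finset.mem_univ i) (by simpa using hi)
      rw [this, mul_zero]
  have h3 := h1.unique h2
  simpa [monom] using h3.symm

theorem taylorSupport_nonempty {n : ℕ} {S : (Fin n → ℝ) → ℝ} (hS : AnalyticAt ℝ S 0)
    (hne : ¬ ∀ᶠ x in 𝓝 (0 : Fin n → ℝ), S x = 0) : (taylorSupport S).Nonempty := by
  by_contra hcon
  rw [not_nonempty_iff_eq_empty] at hcon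
  obtain ⟨r, hr, -, h⟩ := exists_taylor_expansion hS
  refine hne ?_
  filter_upwards [Metric.closedBall_mem_nhds (0 : Fin n → ℝ) hr] with x hx
  rw [Metric.mem_closedBall, dist_zero_right] at hx
  have h1 := h x fun i => (norm_le_pi_norm x i).trans hx
  have h2 : ∀ α, taylorCoeff S α = 0 := fun α => by
    by_contra hα
    have : α ∈ taylorSupport S := hα
    rw [hcon] at this
    exact this
  simp only [h2, zero_mul] at h1
  exact h1.unique hasSum_zero

/-- The minimal exponents of the Taylor series. -/
def minExponents {n : ℕ} (S : (Fin n → ℝ) → ℝ) : Set (Fin n → ℕ) :=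
  {α | Minimal (· ∈ taylorSupport S) α}

/-- Dickson's lemma. -/
theorem finite_minExponents {n : ℕ} (S : (Fin n → ℝ) → ℝ) : (minExponents S).Finite :=
  WellQuasiOrderedLE.finite_of_isAntichain (setOfPred_minimal_antichain _)

theorem exists_minExponent_le {n : ℕ} {S : (Fin n → ℝ) → ℝ} {α : Fin n → ℕ}
    (hα : α ∈ taylorSupport S) : ∃ β ∈ minExponents S, β ≤ α := by
  obtain ⟨β, h1, h2⟩ := exists_minimal_le_of_wellFoundedLT (· ∈ taylorSupport S) α hα
  exact ⟨β, h2, h1⟩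

theorem minExponents_subset {n : ℕ} (S : (Fin n → ℝ) → ℝ) : minExponents S ⊆ taylorSupport S :=
  fun _ h => h.1

theorem mem_newtonPolyhedron {n : ℕ} {S : (Fin n → ℝ) → ℝ} {α : Fin n → ℕ}
    (hα : α ∈ taylorSupport S) {p : Fin n → ℝ} (hp : toPoint α ≤ p) : p ∈ newtonPolyhedron S :=
  subset_convexHull ℝ _ (mem_biUnion hα hp)

theorem newtonPolyhedron_subset {n : ℕ} {S : (Fin n → ℝ) → ℝ} {X : Set (Fin n → ℝ)}
    (hX : Convex ℝ X) (h : ∀ α ∈ taylorSupport S, ∀ p, toPoint α ≤ p → p ∈ X) :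
    newtonPolyhedron S ⊆ X :=
  convexHull_min (iUnion₂_subset fun α hα p hp => h α hα p hp) hX

theorem convex_newtonPolyhedron {n : ℕ} (S : (Fin n → ℝ) → ℝ) :
    Convex ℝ (newtonPolyhedron S) := convex_convexHull ℝ _

theorem newtonPolyhedron_mono {n : ℕ} {S : (Fin n → ℝ) → ℝ} {p p' : Fin n → ℝ}
    (hp : p ∈ newtonPolyhedron S) (h : p ≤ p') : p' ∈ newtonPolyhedron S := by
  have hX : Convex ℝ {x | x + (p' - p) ∈ newtonPolyhedron S} := by
    intro x hx y hy a b ha hb hab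
    have := convex_newtonPolyhedron S hx hy ha hb hab
    rw [smul_add, smul_add] at this
    have h2 : a • x + a • (p' - p) + (b • y + b • (p' - p)) = a • x + b • y + (p' - p) := by
      rw [add_add_add_comm, ← add_smul, hab, one_smul]
    rwa [h2] at this
  have := newtonPolyhedron_subset hX (fun α hα x hx => mem_newtonPolyhedron hα
    (hx.trans (le_add_of_nonneg_right (sub_nonneg.2 h)))) hp
  simpa using this

theorem dotProduct_le_dotProduct_of_le {n : ℕ} {l p p' : Fin n → ℝ} (hl : ∀ i, 0 ≤ l i)
    (h : p ≤ p') : l ⬝ᵥ p ≤ l ⬝ᵥ p' :=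
  Finset.sum_le_sum fun i _ => mul_le_mul_of_nonneg_left (h i) (hl i)

theorem toPoint_mono {n : ℕ} {α β : Fin n → ℕ} (h : α ≤ β) : toPoint α ≤ toPoint β :=
  fun i => Nat.cast_le.2 (h i)

theorem le_dotProduct_of_mem_newtonPolyhedron {n : ℕ} {S : (Fin n → ℝ) → ℝ} {l : Fin n → ℝ}
    (hl : ∀ i, 0 ≤ l i) {c : ℝ} (hc : ∀ α ∈ taylorSupport S, c ≤ l ⬝ᵥ toPoint α) {p : Fin n → ℝ}
    (hp : p ∈ newtonPolyhedron S) : c ≤ l ⬝ᵥ p := by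
  have hX : Convex ℝ {x : Fin n → ℝ | c ≤ l ⬝ᵥ x} :=
    convex_halfSpace_ge ⟨fun x y => dotProduct_add _ _ _, fun a x => dotProduct_smul _ _ _⟩ c
  exact newtonPolyhedron_subset hX (fun α hα x hx =>
    (hc α hα).trans (dotProduct_le_dotProduct_of_le hl hx)) hp

theorem clm_eq_dotProduct {n : ℕ} (l : StrongDual ℝ (Fin n → ℝ)) (p : Fin n → ℝ) :
    l p = (fun i => l (Pi.single i 1)) ⬝ᵥ p := by
  conv_lhs => rw [pi_eq_sum_univ' p]
  rw [map_sum]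
  exact Finset.sum_congr rfl fun i _ => by rw [map_smul, smul_eq_mul, mul_comm]

/-- The faces of a Newton polyhedron minimize linear forms with nonnegative coefficients. -/
theorem IsFace.exists_form {n : ℕ} {S : (Fin n → ℝ) → ℝ} {F : Set (Fin n → ℝ)}
    (hF : IsFace S F) : ∃ (l : Fin n → ℝ) (c : ℝ), (∀ i, 0 ≤ l i) ∧ 0 < ∑ i, l i ∧
      (∀ p ∈ newtonPolyhedron S, c ≤ l ⬝ᵥ p) ∧
      ∀ p, p ∈ F ↔ p ∈ newtonPolyhedron S ∧ l ⬝ᵥ p = c := by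
  obtain ⟨⟨p₀, hp₀⟩, hne, hexp⟩ := hF
  obtain ⟨l', hl'⟩ := hexp ⟨p₀, hp₀⟩
  set l : Fin n → ℝ := fun i => -l' (Pi.single i 1) with hl
  have hdot : ∀ p, l ⬝ᵥ p = -l' p := fun p => by
    rw [clm_eq_dotProduct l' p, ← neg_dotProduct]; rfl
  have hp₀' := hp₀
  rw [hl'] at hp₀'
  have hl0 : ∀ i, 0 ≤ l i := fun i => by
    have h1 : p₀ + Pi.single i 1 ∈ newtonPolyhedron S := newtonPolyhedron_mono hp₀'.1
      (le_add_of_nonneg_right (Pi.single_nonneg.2 zero_le_one))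
    have h2 := hp₀'.2 _ h1
    rw [map_add] at h2
    simp only [hl]; linarith
  have hmem : ∀ p, p ∈ F ↔ p ∈ newtonPolyhedron S ∧ l ⬝ᵥ p = l ⬝ᵥ p₀ := by
    intro p
    rw [hdot, hdot, neg_inj, hl']
    constructor
    · rintro ⟨h1, h2⟩
      exact ⟨h1, le_antisymm (hp₀'.2 p h1) (h2 p₀ hp₀'.1)⟩
    · rintro ⟨h1, h2⟩
      exact ⟨h1, fun y hy => h2 ▸ hp₀'.2 y hy⟩
  refine ⟨l, l ⬝ᵥ p₀, hl0, ?_, fun p hp => ?_, hmem⟩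
  · refine lt_of_le_of_ne (Finset.sum_nonneg fun i _ => hl0 i) fun h => hne ?_
    have h1 : l = 0 := funext fun i =>
      (Finset.sum_eq_zero_iff_of_nonneg (fun i _ => hl0 i)).1 h.symm i (Finset.mem_univ i)
    ext p
    rw [hmem, h1]
    simp
  · rw [hdot, hdot]; exact neg_le_neg (hp₀'.2 p hp)

/-- The central face: the point at which the diagonal enters the Newton polyhedron is `(d, …, d)`,
`d` the Newton distance, and it is an inner point of the central face. -/
theorem IsCentralFace.exists_form {n : ℕ} {S : (Fin n → ℝ) → ℝ} {C : Set (Fin n → ℝ)}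
    (hC : IsCentralFace S C) (h0 : taylorCoeff S 0 = 0) :
    0 < newtonDistance S ∧ ∃ l : Fin n → ℝ, (∀ i, 0 ≤ l i) ∧ 0 < ∑ i, l i ∧
      (∀ p ∈ newtonPolyhedron S, l ⬝ᵥ (fun _ => newtonDistance S) ≤ l ⬝ᵥ p) ∧
      (∀ p, p ∈ C ↔ p ∈ newtonPolyhedron S ∧ l ⬝ᵥ p = l ⬝ᵥ fun _ => newtonDistance S) ∧
      ∃ η : ℝ, 0 < η ∧ ∀ u ∈ vectorSpan ℝ C, ‖u‖ ≤ η → (fun _ => newtonDistance S) + u ∈ C := by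
  obtain ⟨hF, t, ht⟩ := hC
  obtain ⟨l, c, hl0, hlpos, hlc, hlC⟩ := hF.exists_form
  have htC : (fun _ => t) ∈ C := intrinsicInterior_subset ht
  have htN := ((hlC _).1 htC).1
  have hn : 0 < n := by
    rcases Nat.eq_zero_or_pos n with rfl | h
    · simp at hlpos
    · exact h
  have hconst : ∀ (l : Fin n → ℝ) (t : ℝ), (l ⬝ᵥ fun _ => t) = (∑ i, l i) * t := fun l t => by
    rw [dotProduct, Finset.sum_mul]
  have hpos : ∀ t : ℝ, (fun _ : Fin n => t) ∈ newtonPolyhedron S → 1 / n ≤ t := by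
    intro t ht
    have := le_dotProduct_of_mem_newtonPolyhedron (l := fun _ => 1) (c := 1)
      (fun _ => zero_le_one) (fun α hα => ?_) ht
    · rw [hconst] at this
      rw [div_le_iff₀' (by exact_mod_cast hn)]
      simpa using this
    · have h1 : α ≠ 0 := fun h => hα (h ▸ h0)
      obtain ⟨i, hi⟩ := Function.ne_iff.1 h1
      have h2 : 1 ≤ α i := Nat.one_le_iff_ne_zero.2 hi
      calc (1 : ℝ) ≤ α i := by exact_mod_cast h2
        _ ≤ ∑ i, (α i : ℝ) := Finset.single_le_sum (f := fun i => (α i : ℝ))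
            (fun i _ => Nat.cast_nonneg _) (Finset.mem_univ i)
        _ = _ := by simp [dotProduct, toPoint]
  have hbdd : BddBelow {t : ℝ | (fun _ : Fin n => t) ∈ newtonPolyhedron S} :=
    ⟨1 / n, fun t ht => hpos t ht⟩
  have htd : t = newtonDistance S := by
    refine le_antisymm ?_ (csInf_le hbdd htN)
    by_contra! hlt
    obtain ⟨t', ht', htt'⟩ := exists_lt_of_csInf_lt ⟨t, htN⟩ hlt
    have h1 := hlc _ ht'
    rw [← ((hlC _).1 htC).2, hconst, hconst] at h1
    exact absurd (le_of_mul_le_mul_left h1 hlpos) (not_le.2 htt')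
  subst htd
  refine ⟨lt_of_lt_of_le (by positivity) (hpos _ htN), l, hl0, hlpos, ?_, ?_, ?_⟩
  · rw [((hlC _).1 htC).2]; exact hlc
  · rw [((hlC _).1 htC).2]; exact hlC
  · obtain ⟨y, hy, hyt⟩ := mem_intrinsicInterior.1 ht
    obtain ⟨η, hη, hball⟩ := Metric.isOpen_iff.1 isOpen_interior y hy
    refine ⟨η / 2, by positivity, fun u hu hun => ?_⟩
    have hmem : u +ᵥ (fun _ => newtonDistance S : Fin n → ℝ) ∈ affineSpan ℝ C :=
      AffineSubspace.vadd_mem_of_mem_direction (by rwa [direction_affineSpan])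
        (subset_affineSpan ℝ C htC)
    have h1 : (⟨_, hmem⟩ : affineSpan ℝ C) ∈ Metric.ball y η := by
      rw [Metric.mem_ball, Subtype.dist_eq, hyt, dist_eq_norm]
      simp only [vadd_eq_add, add_sub_cancel_right]
      linarith
    have h2 := interior_subset (hball h1)
    simpa [add_comm] using h2

/-- A set of exponents on which a linear form with positive coefficients is minimal spans a compact
face. -/
theorem isCompactFace_convexHull {n : ℕ} (hn : 0 < n) {S : (Fin n → ℝ) → ℝ} {l : Fin n → ℝ}
    (hl : ∀ i, 0 < l i) {μ : ℝ} {A : Set (Fin n → ℕ)} (hAf : A.Finite) (hAne : A.Nonempty)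
    (hAS : A ⊆ taylorSupport S)
    (hA : ∀ α ∈ A, l ⬝ᵥ toPoint α = μ) (hA' : ∀ α ∈ taylorSupport S, α ∉ A → μ < l ⬝ᵥ toPoint α) :
    IsCompactFace S (convexHull ℝ (toPoint '' A)) ∧
      ∀ α ∈ taylorSupport S, toPoint α ∈ convexHull ℝ (toPoint '' A) → α ∈ A := by
  have hlin : IsLinearMap ℝ fun x : Fin n → ℝ => l ⬝ᵥ x :=
    ⟨fun x y => dotProduct_add _ _ _, fun a x => dotProduct_smul _ _ _⟩
  have hlvl : ∀ p ∈ convexHull ℝ (toPoint '' A), l ⬝ᵥ p = μ := fun p hp =>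
    convexHull_min (by rintro _ ⟨α, hα, rfl⟩; exact hA α hα) (convex_hyperplane hlin μ) hp
  have hsub : convexHull ℝ (toPoint '' A) ⊆ newtonPolyhedron S :=
    convexHull_min (by rintro _ ⟨α, hα, rfl⟩; exact mem_newtonPolyhedron (hAS hα) le_rfl)
      (convex_newtonPolyhedron S)
  have hstrict : ∀ p p' : Fin n → ℝ, p ≤ p' → p ≠ p' → l ⬝ᵥ p < l ⬝ᵥ p' := by
    intro p p' h hne
    obtain ⟨i, hi⟩ := Function.ne_iff.1 hne
    exact Finset.sum_lt_sum (fun i _ => mul_le_mul_of_nonneg_left (h i) (hl i).le)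
      ⟨i, Finset.mem_univ i, mul_lt_mul_of_pos_left (lt_of_le_of_ne (h i) hi) (hl i)⟩
  -- every other point of the polyhedron lies strictly above the supporting hyperplane
  have hN : ∀ p ∈ newtonPolyhedron S, p ∈ convexHull ℝ (toPoint '' A) ∨ μ < l ⬝ᵥ p := by
    have hX : Convex ℝ {p | p ∈ convexHull ℝ (toPoint '' A) ∨ μ < l ⬝ᵥ p} := by
      have hge : ∀ p, p ∈ convexHull ℝ (toPoint '' A) ∨ μ < l ⬝ᵥ p → μ ≤ l ⬝ᵥ p := by
        rintro p (hp | hp)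
        exacts [(hlvl p hp).ge, hp.le]
      refine convex_iff_pairwise_pos.2 fun x hx y hy hxy a b ha hb hab => ?_
      by_cases hxy' : x ∈ convexHull ℝ (toPoint '' A) ∧ y ∈ convexHull ℝ (toPoint '' A)
      · exact Or.inl (convex_convexHull ℝ _ hxy'.1 hxy'.2 ha.le hb.le hab)
      · right
        rw [dotProduct_add, dotProduct_smul, dotProduct_smul, smul_eq_mul, smul_eq_mul]
        have h1 := hge x hx
        have h2 := hge y hy
        have h3 : μ < l ⬝ᵥ x ∨ μ < l ⬝ᵥ y := by
          rcases hx with hx | hx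
          · rcases hy with hy | hy
            · exact absurd ⟨hx, hy⟩ hxy'
            · exact Or.inr hy
          · exact Or.inl hx
        have hμ : μ = a * μ + b * μ := by rw [← add_mul, hab, one_mul]
        rw [hμ]
        rcases h3 with h3 | h3
        · exact add_lt_add_of_lt_of_le (mul_lt_mul_of_pos_left h3 ha)
            (mul_le_mul_of_nonneg_left h2 hb.le)
        · exact add_lt_add_of_le_of_lt (mul_le_mul_of_nonneg_left h1 ha.le)
            (mul_lt_mul_of_pos_left h3 hb)
    refine fun p hp => newtonPolyhedron_subset hX (fun α hα p hp => ?_) hp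
    by_cases hαA : α ∈ A
    · by_cases hpα : toPoint α = p
      · exact Or.inl (hpα ▸ subset_convexHull ℝ _ (mem_image_of_mem _ hαA))
      · exact Or.inr ((hA α hαA).symm.trans_lt (hstrict _ _ hp hpα))
    · exact Or.inr ((hA' α hα hαA).trans_le
        (dotProduct_le_dotProduct_of_le (fun i => (hl i).le) hp))
  have hNge : ∀ p ∈ newtonPolyhedron S, μ ≤ l ⬝ᵥ p := fun p hp =>
    (hN p hp).elim (fun h => (hlvl p h).ge) le_of_lt
  have hne : (convexHull ℝ (toPoint '' A)).Nonempty := (hAne.image _).convexHull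
  refine ⟨⟨⟨hne, fun heq => ?_, fun _ => ?_⟩, (hAf.image _).isCompact_convexHull ℝ⟩,
    fun α hα hαF => ?_⟩
  · obtain ⟨p, hp⟩ := hne
    have h1 : p + 1 ∈ newtonPolyhedron S :=
      newtonPolyhedron_mono (hsub hp) (le_add_of_nonneg_right zero_le_one)
    rw [← heq] at h1
    have h2 := hstrict p (p + 1) (le_add_of_nonneg_right zero_le_one) fun h => by
      have := congrFun h ⟨0, hn⟩
      simp at this
    rw [hlvl p hp, hlvl _ h1] at h2
    exact lt_irrefl _ h2
  · refine ⟨-(LinearMap.toContinuousLinearMap (hlin.mk' _)), ?_⟩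
    ext p
    simp only [mem_ofPred_eq]
    have hv : ∀ x : Fin n → ℝ, (-(LinearMap.toContinuousLinearMap (hlin.mk' _)) :
        StrongDual ℝ (Fin n → ℝ)) x = -(l ⬝ᵥ x) := fun x => rfl
    simp only [hv, neg_le_neg_iff]
    constructor
    · exact fun hp => ⟨hsub hp, fun y hy => (hlvl p hp).le.trans (hNge y hy)⟩
    · rintro ⟨hp, hmin⟩
      refine (hN p hp).resolve_right fun h => ?_
      obtain ⟨y, hy⟩ := hne
      have := hmin y (hsub hy)
      rw [hlvl y hy] at this
      exact absurd this (not_le.2 h)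
  · by_contra hαA
    exact (hA' α hα hαA).ne' (hlvl _ hαF)

theorem faceFun_eq_sum {n : ℕ} {S : (Fin n → ℝ) → ℝ} {F : Set (Fin n → ℝ)}
    {A : Finset (Fin n → ℕ)} (h1 : ∀ α ∈ A, toPoint α ∈ F)
    (h2 : ∀ α ∈ taylorSupport S, toPoint α ∈ F → α ∈ A) (x : Fin n → ℝ) :
    faceFun S F x = ∑ α ∈ A, taylorCoeff S α * monom α x := by
  rw [faceFun]
  refine finsum_mem_eq_sum_of_inter_support_eq _ ?_
  ext α
  simp only [mem_inter_iff, mem_ofPred_eq, Function.mem_support, Finset.mem_coe]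
  constructor
  · rintro ⟨h, hne⟩
    exact ⟨h2 α (left_ne_zero_of_mul hne) h, hne⟩
  · rintro ⟨h, hne⟩
    exact ⟨h1 α h, hne⟩

/-! ### The order of a Newton polyhedron along a lattice direction -/

/-- The pairing of a direction with an exponent. -/
def dot {n : ℕ} (j α : Fin n → ℕ) : ℕ := ∑ i, j i * α i

theorem toPoint_dotProduct_toPoint {n : ℕ} (j α : Fin n → ℕ) :
    toPoint j ⬝ᵥ toPoint α = (dot j α : ℝ) := by
  simp [dotProduct, toPoint, dot]

theorem dot_mono {n : ℕ} (j : Fin n → ℕ) {α β : Fin n → ℕ} (h : α ≤ β) : dot j α ≤ dot j β :=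
  Finset.sum_le_sum fun i _ => Nat.mul_le_mul_left _ (h i)

/-- The order of the Taylor series along `j`: the least value of `j` on an exponent. It is the junk
value `0` if there are no exponents. -/
def minDeg {n : ℕ} (S : (Fin n → ℝ) → ℝ) (j : Fin n → ℕ) : ℕ := sInf (dot j '' taylorSupport S)

theorem minDeg_le {n : ℕ} {S : (Fin n → ℝ) → ℝ} (j : Fin n → ℕ) {α : Fin n → ℕ}
    (hα : α ∈ taylorSupport S) : minDeg S j ≤ dot j α :=
  Nat.sInf_le (mem_image_of_mem _ hα)

theorem exists_dot_eq_minDeg {n : ℕ} {S : (Fin n → ℝ) → ℝ} (hS : (taylorSupport S).Nonempty)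
    (j : Fin n → ℕ) : ∃ β ∈ minExponents S, dot j β = minDeg S j := by
  obtain ⟨α, hα, h⟩ := Nat.sInf_mem (hS.image (dot j))
  obtain ⟨β, hβ, hβα⟩ := exists_minExponent_le hα
  exact ⟨β, hβ, le_antisymm ((dot_mono j hβα).trans h.le) (minDeg_le j (minExponents_subset S hβ))⟩

theorem minDeg_le_of_mem_newtonPolyhedron {n : ℕ} {S : (Fin n → ℝ) → ℝ} (j : Fin n → ℕ)
    {p : Fin n → ℝ} (hp : p ∈ newtonPolyhedron S) : (minDeg S j : ℝ) ≤ toPoint j ⬝ᵥ p :=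
  le_dotProduct_of_mem_newtonPolyhedron (l := toPoint j) (fun i => Nat.cast_nonneg _)
    (fun α hα => by
    rw [toPoint_dotProduct_toPoint]; exact_mod_cast minDeg_le j hα) hp

/-! ### Orders of zeros of face polynomials -/

theorem contDiff_sum_monom {n : ℕ} (A : Finset (Fin n → ℕ)) (c : (Fin n → ℕ) → ℝ) (N : WithTop ℕ∞) :
    ContDiff ℝ N fun x : Fin n → ℝ => ∑ α ∈ A, c α * monom α x := by
  unfold monom
  refine ContDiff.sum fun α _ => contDiff_const.mul (contDiff_prod fun i _ => ?_)
  exact (contDiff_apply ℝ ℝ i).pow _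

theorem exists_sum_monom_ne_zero {n : ℕ} {A : Finset (Fin n → ℕ)} {c : (Fin n → ℕ) → ℝ}
    {α : Fin n → ℕ} (hα : α ∈ A) (hc : c α ≠ 0) :
    ∃ x : Fin n → ℝ, ∑ α ∈ A, c α * monom α x ≠ 0 := by
  by_contra! hcon
  let p : MvPolynomial (Fin n) ℝ :=
    ∑ α ∈ A, MvPolynomial.monomial (Finsupp.equivFunOnFinite.symm α) (c α)
  have hp : p = 0 := by
    refine MvPolynomial.funext fun x => ?_
    rw [map_zero, ← hcon x, map_sum]
    refine Finset.sum_congr rfl fun α _ => ?_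
    rw [MvPolynomial.eval_monomial, monom, Finsupp.prod_fintype _ _ (by simp)]
    rfl
  refine hc ?_
  have h1 := congrArg (MvPolynomial.coeff (Finsupp.equivFunOnFinite.symm α)) hp
  rw [MvPolynomial.coeff_zero, MvPolynomial.coeff_sum, Finset.sum_eq_single_of_mem α hα] at h1
  · simpa using h1
  · intro β _ hβ
    rw [MvPolynomial.coeff_monomial, if_neg]
    exact fun h => hβ (Finsupp.equivFunOnFinite.symm.injective h)

/-- A nonzero polynomial all of whose zeros at a given point have order at most `D` has a
nonvanishing directional derivative of order at most `D` there. -/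
theorem exists_directional_derivative_ne_zero {n : ℕ} {A : Finset (Fin n → ℕ)}
    {c : (Fin n → ℕ) → ℝ} {α : Fin n → ℕ} (hα : α ∈ A) (hc : c α ≠ 0) {D : ℝ} (hD : 0 ≤ D)
    (x : Fin n → ℝ)
    (h : ∀ m, HasZeroOfOrder (fun x => ∑ α ∈ A, c α * monom α x) x m → (m : ℝ) ≤ D) :
    ∃ (m : ℕ) (v : Fin n → ℝ), (m : ℝ) ≤ D ∧
      iteratedFDeriv ℝ m (fun x => ∑ α ∈ A, c α * monom α x) x (fun _ => v) ≠ 0 := by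
  classical
  set P : (Fin n → ℝ) → ℝ := fun x => ∑ α ∈ A, c α * monom α x with hP
  have han : AnalyticOnNhd ℝ P univ := contDiff_omega_iff_analyticOnNhd.1 (contDiff_sum_monom A c ω)
  by_cases hx : P x = 0
  swap
  · exact ⟨0, 0, by simpa using hD, by simpa using hx⟩
  have hex : ∃ m, iteratedFDeriv ℝ m P x ≠ 0 := by
    by_contra! hcon
    obtain ⟨p, r, hp⟩ := han x (mem_univ x)
    have hev : P =ᶠ[𝓝 x] 0 := by
      filter_upwards [Metric.eball_mem_nhds x hp.r_pos] with y hy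
      have h1 := hp.hasSum_iteratedFDeriv (y := y - x) (by
        rw [Metric.mem_eball, edist_zero_right, ← edist_eq_enorm_sub]; exact hy)
      simp only [hcon, zero_apply, smul_zero, add_sub_cancel] at h1
      exact h1.unique hasSum_zero
    obtain ⟨z, hz⟩ := exists_sum_monom_ne_zero hα hc
    exact hz (han.eqOn_zero_of_preconnected_of_eventuallyEq_zero isPreconnected_univ (mem_univ x)
      hev (mem_univ z))
  have hord : HasZeroOfOrder P x (Nat.find hex) :=
    ⟨hx, fun j hj => not_not.1 (Nat.find_min hex hj), Nat.find_spec hex⟩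
  obtain ⟨v, hv⟩ := exists_iteratedFDeriv_diag_ne_zero (han x (mem_univ x)) (Nat.find_spec hex)
  exact ⟨_, v, h _ hord, hv⟩

/-- The dyadic rescaling `y ↦ 2 ^ (-j) y`. -/
def dyadicScale {n : ℕ} (j : Fin n → ℕ) (y : Fin n → ℝ) : Fin n → ℝ := fun i => y i / 2 ^ j i

theorem monom_dyadicScale {n : ℕ} (j α : Fin n → ℕ) (y : Fin n → ℝ) :
    monom α (dyadicScale j y) = monom α y / 2 ^ dot j α := by
  simp only [monom, dyadicScale, div_pow, Finset.prod_div_distrib, dot, ← pow_mul,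
    Finset.prod_pow_eq_pow_sum]

theorem HasZeroOfOrder.of_comp_dyadicScale {n : ℕ} {g : (Fin n → ℝ) → ℝ} (hg : ContDiff ℝ ∞ g)
    (j : Fin n → ℕ) {κ : ℝ} (hκ : κ ≠ 0) {y : Fin n → ℝ} {m : ℕ}
    (h : HasZeroOfOrder (fun y => κ * g (dyadicScale j y)) y m) :
    HasZeroOfOrder g (dyadicScale j y) m := by
  let Λ : (Fin n → ℝ) →L[ℝ] (Fin n → ℝ) :=
    ContinuousLinearMap.pi fun i => (2 ^ j i : ℝ)⁻¹ • ContinuousLinearMap.proj i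
  have hΛ : ∀ y, Λ y = dyadicScale j y := fun y => by
    ext i; simp [Λ, dyadicScale, div_eq_inv_mul]
  have hd : ∀ l, iteratedFDeriv ℝ l (fun y => κ * g (dyadicScale j y)) y =
      κ • (iteratedFDeriv ℝ l g (dyadicScale j y)).compContinuousLinearMap fun _ => Λ := by
    intro l
    have h1 : (fun y => κ * g (dyadicScale j y)) = κ • (g ∘ Λ) := by
      ext y; simp [hΛ]
    have hgl : ContDiff ℝ l g := hg.of_le (by exact_mod_cast le_top)
    rw [h1, iteratedFDeriv_const_smul_apply (hgl.comp Λ.contDiff).contDiffAt,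
      Λ.iteratedFDeriv_comp_right hgl y le_rfl, hΛ]
  obtain ⟨h0, h1, h2⟩ := h
  refine ⟨(mul_eq_zero.1 h0).resolve_left hκ, fun l hl => ?_, fun h3 => h2 ?_⟩
  · have h3 := h1 l hl
    rw [hd, smul_eq_zero] at h3
    have h4 := h3.resolve_left hκ
    ext v
    have h5 := congrArg (fun T => T fun k => (fun i => 2 ^ j i * v k i : Fin n → ℝ)) h4
    simp only [ContinuousMultilinearMap.compContinuousLinearMap_apply,
      zero_apply] at h5
    rw [zero_apply, ← h5]
    congr 1
    funext k i
    rw [hΛ]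
    simp [dyadicScale]
  · rw [hd, h3]
    ext v
    simp

/-! ### Uniform sublevel estimates on dyadic shells -/

/-- The Taylor coefficients of the rescaled function `y ↦ 2 ^ (minDeg S j) * S (2 ^ (-j) y)`. -/
def scaledCoeff {n : ℕ} (S : (Fin n → ℝ) → ℝ) (j α : Fin n → ℕ) : ℝ :=
  2 ^ minDeg S j * (taylorCoeff S α / 2 ^ dot j α)

theorem scaledCoeff_eq {n : ℕ} {S : (Fin n → ℝ) → ℝ} (j : Fin n → ℕ) {α : Fin n → ℕ}
    (hα : α ∈ taylorSupport S) :
    scaledCoeff S j α = taylorCoeff S α * (1 / 2) ^ (dot j α - minDeg S j) := by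
  have h := minDeg_le j hα
  rw [scaledCoeff]
  nth_rewrite 1 [← Nat.add_sub_cancel' h]
  rw [pow_add, one_div, inv_pow]
  field_simp

theorem sum_eq_add_sum_sub {n : ℕ} (j : Fin n → ℕ) {J : ℕ} (hj : ∀ i, J ≤ j i) {α β : Fin n → ℕ}
    (h : β ≤ α) : dot j β + J * ∑ i, α i ≤ dot j α + J * ∑ i, β i := by
  simp only [dot, Finset.mul_sum, ← Finset.sum_add_distrib]
  refine Finset.sum_le_sum fun i _ => ?_
  obtain ⟨k, hk⟩ := Nat.exists_eq_add_of_le (h i)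
  have := hj i
  rw [hk]
  nlinarith

/-- Near the origin the rescaled functions `2 ^ (minDeg S j) * S (2 ^ (-j) y)` are given on the
polydisc of radius `4` by power series with a common summable majorant. -/
theorem exists_scaled_expansion {n : ℕ} {S : (Fin n → ℝ) → ℝ} (hS : AnalyticAt ℝ S 0) :
    ∃ (J : ℕ) (b : (Fin n → ℕ) → ℝ), Summable b ∧ ∀ j : Fin n → ℕ, (∀ i, J ≤ j i) →
      (∀ α, |scaledCoeff S j α| * 4 ^ ∑ i, α i ≤ b α) ∧
      ∀ y : Fin n → ℝ, (∀ i, |y i| ≤ 4) → HasSum (fun α => scaledCoeff S j α * monom α y)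
        (2 ^ minDeg S j * S (dyadicScale j y)) := by
  obtain ⟨r, hr, hsum, hexp⟩ := exists_taylor_expansion hS
  obtain ⟨J, hJ⟩ := exists_pow_lt_of_lt_one (show 0 < r / 4 by positivity)
    (show (1 / 2 : ℝ) < 1 by norm_num)
  have hJ' : 4 / 2 ^ J ≤ r := by
    rw [one_div, inv_pow] at hJ
    rw [div_eq_mul_inv]; linarith
  obtain ⟨B, hB⟩ := ((finite_minExponents S).image fun α => ∑ i, α i).bddAbove
  refine ⟨J, fun α => 2 ^ (J * B) * (|taylorCoeff S α| * r ^ ∑ i, α i), hsum.mul_left _,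
    fun j hj => ⟨fun α => ?_, fun y hy => ?_⟩⟩
  · by_cases hα : α ∈ taylorSupport S
    · obtain ⟨β, hβ, hβα⟩ := exists_minExponent_le hα
      have h1 := sum_eq_add_sum_sub j hj hβα
      have h2 : ∑ i, β i ≤ B := hB (mem_image_of_mem _ hβ)
      have h3 := minDeg_le j (minExponents_subset S hβ)
      have h4 : minDeg S j + J * ∑ i, α i ≤ J * B + dot j α := by
        have := Nat.mul_le_mul_left J h2
        omega
      have h5 : (2 : ℝ) ^ minDeg S j * 2 ^ (J * ∑ i, α i) ≤ 2 ^ (J * B) * 2 ^ dot j α := by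
        rw [← pow_add, ← pow_add]
        exact pow_le_pow_right₀ one_le_two h4
      have h6 : (2 : ℝ) ^ minDeg S j / 2 ^ dot j α * 4 ^ (∑ i, α i)
          ≤ 2 ^ (J * B) * r ^ ∑ i, α i := by
        calc (2 : ℝ) ^ minDeg S j / 2 ^ dot j α * 4 ^ (∑ i, α i)
            = (2 ^ minDeg S j * 2 ^ (J * ∑ i, α i)) / 2 ^ dot j α * (4 / 2 ^ J) ^ ∑ i, α i := by
              rw [div_pow, ← pow_mul]; field_simp
          _ ≤ (2 ^ (J * B) * 2 ^ dot j α) / 2 ^ dot j α * r ^ ∑ i, α i := by gcongr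
          _ = _ := by field_simp
      rw [scaledCoeff, abs_mul, abs_div, abs_of_pos (by positivity : (0 : ℝ) < 2 ^ minDeg S j),
        abs_of_pos (by positivity : (0 : ℝ) < 2 ^ dot j α)]
      calc _ = |taylorCoeff S α| * ((2 : ℝ) ^ minDeg S j / 2 ^ dot j α * 4 ^ (∑ i, α i)) := by ring
        _ ≤ |taylorCoeff S α| * (2 ^ (J * B) * r ^ ∑ i, α i) := by gcongr
        _ = _ := by ring
    · have : taylorCoeff S α = 0 := not_not.1 hα
      simp [scaledCoeff, this]
  · have h1 := (hexp (dyadicScale j y) fun i => ?_).mul_left (2 ^ minDeg S j)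
    · refine (congrArg (fun F : (Fin n → ℕ) → ℝ => HasSum F _) (funext fun α => ?_)).mp h1
      rw [monom_dyadicScale, scaledCoeff]
      ring
    · rw [dyadicScale, abs_div, abs_of_pos (by positivity : (0 : ℝ) < 2 ^ j i)]
      refine le_trans ?_ hJ'
      gcongr
      exacts [hy i, one_le_two, hj i]

theorem ultrafilter_tendsto_atTop_or_eventually_eq {ι : Type*} (𝒰 : Ultrafilter ι) (g : ι → ℕ) :
    Tendsto g 𝒰 atTop ∨ ∃ c, ∀ᶠ N in (𝒰 : Filter ι), g N = c := by
  by_cases h : Tendsto g 𝒰 atTop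
  · exact Or.inl h
  · right
    rw [tendsto_atTop] at h
    push Not at h
    obtain ⟨b, hb⟩ := h
    have hb' : Iio b ∈ 𝒰.map g := hb
    obtain ⟨c, -, hc⟩ := Ultrafilter.eq_pure_of_finite_mem (finite_Iio b) hb'
    refine ⟨c, ?_⟩
    have h2 : {c} ∈ 𝒰.map g := by rw [hc]; exact rfl
    exact h2

/-- Uniformly over all sufficiently large dyadic scales `j`, the sublevel sets of the rescaled
function have measure `O(δ ^ (1 / D))`, if `D` bounds the orders of the zeros of the face
polynomials that occur in the limit. The set `Q` restricts the scales to those for which only the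
exponents in `Q` can contribute to the limit.

By contradiction: along an ultrafilter of scales `j N` the gaps `dot (j N) β - minDeg S (j N)`, `β`
a minimal exponent, are either constant or tend to infinity. Those `β` with constant gap span a
compact face, exposed by a difference `j N - j M`; hence the rescaled functions converge to a
rescaled face polynomial, for which stability of the sublevel estimate applies. -/
theorem exists_scaled_sublevel_le {n : ℕ} (hn : 0 < n) {S : (Fin n → ℝ) → ℝ}
    (hS : AnalyticAt ℝ S 0) (hne : (taylorSupport S).Nonempty) {D : ℝ} (hD : 0 < D)
    (Q : Set (Fin n → ℕ))
    (hQ : ∀ A ⊆ Q, IsCompactFace S (convexHull ℝ (toPoint '' A)) →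
      ∀ m, FaceHasZeroOfOrder S (convexHull ℝ (toPoint '' A)) m → (m : ℝ) ≤ D) :
    ∃ (J : ℕ) (C : ℝ), 0 < C ∧ ∀ j : Fin n → ℕ, (∀ i, J ≤ j i) →
      (∀ β ∈ minExponents S, β ∉ Q → minDeg S j + J ≤ dot j β) → ∀ δ : ℝ, 0 < δ →
      volume {y | y ∈ shell n ∧ |2 ^ minDeg S j * S (dyadicScale j y)| < δ} ≤
        ENNReal.ofReal (C * δ ^ (1 / D)) := by
  classical
  obtain ⟨J₀, b, hb, hexp⟩ := exists_scaled_expansion hS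
  by_contra! hcon
  choose j hj hjQ δ hδ hvol using fun N : ℕ => hcon N (N + 1) (by positivity)
  set 𝒰 : Ultrafilter ℕ := hyperfilter ℕ with h𝒰
  have hle : (𝒰 : Filter ℕ) ≤ atTop := by
    rw [← Nat.cofinite_eq_atTop]; exact hyperfilter_le_cofinite
  have hlarge : ∀ k : ℕ, ∀ᶠ N in (𝒰 : Filter ℕ), k ≤ N := fun k => hle (eventually_ge_atTop k)
  set gap : (Fin n → ℕ) → ℕ → ℕ := fun β N => dot (j N) β - minDeg S (j N) with hgap
  have hgapeq : ∀ β ∈ taylorSupport S, ∀ N, dot (j N) β = minDeg S (j N) + gap β N :=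
    fun β hβ N => (Nat.add_sub_cancel' (minDeg_le (j N) hβ)).symm
  have hdich := fun β => ultrafilter_tendsto_atTop_or_eventually_eq 𝒰 (gap β)
  set A : Finset (Fin n → ℕ) := (finite_minExponents S).toFinset.filter
    fun β => ∃ c, ∀ᶠ N in (𝒰 : Filter ℕ), gap β N = c with hA
  have hAmin : ∀ β ∈ A, β ∈ minExponents S := fun β hβ => by
    simpa using (Finset.mem_filter.1 hβ).1
  have hAS : ∀ β ∈ A, β ∈ taylorSupport S := fun β hβ => minExponents_subset S (hAmin β hβ)
  have hAc : ∀ β, ∃ c, β ∈ A → ∀ᶠ N in (𝒰 : Filter ℕ), gap β N = c := fun β => by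
    by_cases h : β ∈ A
    · obtain ⟨c, hc⟩ := (Finset.mem_filter.1 h).2
      exact ⟨c, fun _ => hc⟩
    · exact ⟨0, fun h' => absurd h' h⟩
  choose c hc using hAc
  have hnotA : ∀ β ∈ minExponents S, β ∉ A → Tendsto (gap β) 𝒰 atTop := fun β hβ hβA =>
    (hdich β).resolve_right fun h => hβA (Finset.mem_filter.2 ⟨by simpa using hβ, h⟩)
  -- exponents that are not minimal have large gaps
  have hnotmin : ∀ α ∈ taylorSupport S, α ∉ minExponents S → ∀ N, N ≤ gap α N := by
    intro α hα hαm N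
    obtain ⟨β, hβ, hβα⟩ := exists_minExponent_le hα
    obtain ⟨i, hi⟩ : ∃ i, β i < α i := by
      by_contra! h
      exact hαm ((le_antisymm hβα h : β = α) ▸ hβ)
    have h1 : dot (j N) β + j N i ≤ dot (j N) α := by
      calc dot (j N) β + j N i = ∑ k, (j N k * β k + if k = i then j N i else 0) := by
            rw [Finset.sum_add_distrib]; simp [dot]
        _ ≤ ∑ k, j N k * α k := by
            refine Finset.sum_le_sum fun k _ => ?_
            split_ifs with hk
            · subst hk; nlinarith
            · simpa using Nat.mul_le_mul_left _ (hβα k)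
    have h2 := minDeg_le (j N) (minExponents_subset S hβ)
    have h3 := hj N i
    simp only [hgap]; omega
  have hAQ : ∀ β ∈ A, β ∈ Q := by
    intro β hβ
    by_contra hβQ
    obtain ⟨N, h1, h2⟩ := ((hc β hβ).and (hlarge (c β + 1))).exists
    have := hjQ N β (hAmin β hβ) hβQ
    simp only [hgap] at h1
    omega
  have hAne : A.Nonempty := by
    rw [Finset.nonempty_iff_ne_empty]
    intro hempty
    have h1 : ∀ᶠ N in (𝒰 : Filter ℕ), ∀ β ∈ minExponents S, 1 ≤ gap β N := by
      rw [eventually_all_finite (finite_minExponents S)]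
      intro β hβ
      exact (hnotA β hβ (by simp [hempty])).eventually_ge_atTop 1
    obtain ⟨N, hN⟩ := h1.exists
    obtain ⟨β, hβ, h2⟩ := exists_dot_eq_minDeg hne (j N)
    have := hN β hβ
    simp only [hgap] at this
    omega
  have hconst : ∀ᶠ N in (𝒰 : Filter ℕ), ∀ β ∈ A, gap β N = c β :=
    (eventually_all_finset A).2 fun β hβ => hc β hβ
  -- a reference index; the face polynomial rescaled by `j M` is the limit of the rescaled functions
  obtain ⟨M, hM, hMJ⟩ := (hconst.and (hlarge J₀)).exists
  -- the exponents in `A` span a compact face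
  have hface : IsCompactFace S (convexHull ℝ (toPoint '' (A : Set (Fin n → ℕ)))) ∧
      ∀ α ∈ taylorSupport S, toPoint α ∈ convexHull ℝ (toPoint '' (A : Set (Fin n → ℕ))) →
        α ∈ (A : Set (Fin n → ℕ)) := by
    have h1 : ∀ᶠ N in (𝒰 : Filter ℕ), ∀ β ∈ minExponents S, β ∉ A → gap β M < gap β N := by
      rw [eventually_all_finite (finite_minExponents S)]
      intro β hβ
      by_cases hβA : β ∈ A
      · exact Eventually.of_forall fun N h => absurd hβA h
      · filter_upwards [(hnotA β hβ hβA).eventually_gt_atTop (gap β M)] with N hN _ using hN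
    obtain ⟨N, ⟨hN1, hN2⟩, hN3⟩ := ((hconst.and h1).and (hlarge ((∑ i, j M i) + 1))).exists
    have hlt : ∀ i, j M i < j N i := fun i => by
      have h2 := Finset.single_le_sum (f := j M) (fun i _ => Nat.zero_le _) (Finset.mem_univ i)
      have h3 := hj N i
      omega
    have hl : ∀ α ∈ taylorSupport S, (toPoint (j N) - toPoint (j M)) ⬝ᵥ toPoint α =
        (minDeg S (j N) : ℝ) - minDeg S (j M) + ((gap α N : ℝ) - gap α M) := by
      intro α hα
      rw [sub_dotProduct, toPoint_dotProduct_toPoint, toPoint_dotProduct_toPoint, hgapeq α hα N,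
        hgapeq α hα M]
      push_cast; ring
    refine isCompactFace_convexHull hn (l := toPoint (j N) - toPoint (j M))
      (μ := (minDeg S (j N) : ℝ) - minDeg S (j M)) (fun i => ?_) A.finite_toSet
      (by simpa using hAne)
      hAS (fun α hα => ?_) fun α hα hαA => ?_
    · simpa [toPoint] using hlt i
    · rw [hl α (hAS α hα), hN1 α hα, hM α hα]; ring
    · have hmin : ∀ β ∈ minExponents S, (minDeg S (j N) : ℝ) - minDeg S (j M) ≤
          (toPoint (j N) - toPoint (j M)) ⬝ᵥ toPoint β ∧ (β ∉ A →
          (minDeg S (j N) : ℝ) - minDeg S (j M) <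
            (toPoint (j N) - toPoint (j M)) ⬝ᵥ toPoint β) := by
        intro β hβ
        rw [hl β (minExponents_subset S hβ)]
        by_cases hβA : β ∈ A
        · rw [hN1 β hβA, hM β hβA]; simp [hβA]
        · have h2 : (gap β M : ℝ) < gap β N := by exact_mod_cast hN2 β hβ hβA
          exact ⟨by linarith, fun _ => by linarith⟩
      by_cases hαm : α ∈ minExponents S
      · exact (hmin α hαm).2 hαA
      · obtain ⟨β, hβ, hβα⟩ := exists_minExponent_le hα
        obtain ⟨i, hi⟩ : ∃ i, β i < α i := by
          by_contra! h
          exact hαm ((le_antisymm hβα h : β = α) ▸ hβ)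
        refine (hmin β hβ).1.trans_lt (Finset.sum_lt_sum (fun k _ => ?_) ⟨i, Finset.mem_univ i, ?_⟩)
        · exact mul_le_mul_of_nonneg_left (toPoint_mono hβα k) (by
            simpa [toPoint] using (hlt k).le)
        · exact mul_lt_mul_of_pos_left (by simpa [toPoint] using hi) (by
            simpa [toPoint] using hlt i)
  have hord := hQ A hAQ hface.1
  have hfun := faceFun_eq_sum (S := S) (F := convexHull ℝ (toPoint '' (A : Set (Fin n → ℕ))))
    (A := A) (fun α hα => subset_convexHull ℝ _ (mem_image_of_mem _ hα)) hface.2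
  set f : (Fin n → ℝ) → ℝ := fun y => ∑ α ∈ A, scaledCoeff S (j M) α * monom α y with hf
  have hscale : f = fun y => 2 ^ minDeg S (j M) *
      faceFun S (convexHull ℝ (toPoint '' (A : Set (Fin n → ℕ)))) (dyadicScale (j M) y) := by
    funext y
    rw [hfun, Finset.mul_sum]
    refine Finset.sum_congr rfl fun α _ => ?_
    rw [monom_dyadicScale, scaledCoeff]
    ring
  obtain ⟨α₀, hα₀⟩ := hAne
  have hderiv : ∀ y ∈ shell n, ∃ (m : ℕ) (v : Fin n → ℝ), (m : ℝ) ≤ D ∧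
      iteratedFDeriv ℝ m f y (fun _ => v) ≠ 0 := by
    intro y hy
    refine exists_directional_derivative_ne_zero hα₀ ?_ hD.le y fun m hm => ?_
    · rw [scaledCoeff_eq _ (hAS α₀ hα₀)]
      exact mul_ne_zero (hAS α₀ hα₀) (by positivity)
    · refine hord m ⟨dyadicScale (j M) y, fun i => ?_, ?_⟩
      · have h1 : y i ≠ 0 := fun h => by have := (hy i).1; rw [h] at this; norm_num at this
        exact div_ne_zero h1 (by positivity)
      · refine HasZeroOfOrder.of_comp_dyadicScale ?_ (j M)
          (κ := 2 ^ minDeg S (j M)) (by positivity) (hscale ▸ hm)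
        rw [funext hfun]
        exact contDiff_sum_monom A _ _
  obtain ⟨η, C, hη, hC, hest⟩ :=
    exists_volume_shell_sublevel_le (contDiff_sum_monom A (scaledCoeff S (j M)) ∞) hD hderiv
  -- the perturbation `e N` tends to `0` in the weighted `ℓ¹` norm, by dominated convergence
  set e : ℕ → (Fin n → ℕ) → ℝ := fun N α =>
    scaledCoeff S (j N) α - if α ∈ A then scaledCoeff S (j M) α else 0 with he
  have hMJ' : ∀ i, J₀ ≤ j M i := fun i => hMJ.trans (hj M i)
  have hbnn : ∀ α, 0 ≤ b α := fun α => le_trans (by positivity) ((hexp (j M) hMJ').1 α)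
  have hebound : ∀ N, J₀ ≤ N → ∀ α, |e N α| * 4 ^ ∑ i, α i ≤ 2 * b α := by
    intro N hN α
    have h1 := (hexp (j N) fun i => hN.trans (hj N i)).1 α
    have h2 := (hexp (j M) hMJ').1 α
    have h3 : |e N α| ≤ |scaledCoeff S (j N) α| + |scaledCoeff S (j M) α| := by
      simp only [he]
      split_ifs
      · exact abs_sub _ _
      · rw [sub_zero]; exact le_add_of_nonneg_right (abs_nonneg _)
    have h4 : (0 : ℝ) ≤ 4 ^ ∑ i, α i := by positivity
    nlinarith
  have hlim : Tendsto (fun N => ∑' α, |e N α| * 4 ^ ∑ i, α i) 𝒰 (𝓝 0) := by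
    have h0 : ∑' _ : Fin n → ℕ, (0 : ℝ) = 0 := tsum_zero
    rw [← h0]
    refine tendsto_tsum_of_dominated_convergence (hb.mul_left 2) (fun α => ?_) ?_
    · have hsuff : Tendsto (fun N => e N α) 𝒰 (𝓝 0) → Tendsto (fun N => |e N α| * 4 ^ ∑ i, α i) 𝒰
          (𝓝 0) := fun h => by
        have := (h.abs.mul_const ((4 : ℝ) ^ ∑ i, α i))
        simpa using this
      refine hsuff ?_
      by_cases hα : α ∈ taylorSupport S
      · by_cases hαA : α ∈ A
        · refine tendsto_const_nhds.congr' ?_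
          filter_upwards [hconst] with N hN
          have h1 : gap α N = gap α M := by rw [hN α hαA, hM α hαA]
          simp only [he, if_pos hαA, scaledCoeff_eq _ hα]
          simp only [hgap] at h1
          rw [h1, sub_self]
        · have h1 : Tendsto (gap α) 𝒰 atTop := by
            by_cases hαm : α ∈ minExponents S
            · exact hnotA α hαm hαA
            · exact tendsto_atTop_mono (hnotmin α hα hαm) (tendsto_id.mono_left hle)
          have h2 : Tendsto (fun N => taylorCoeff S α * (1 / 2 : ℝ) ^ gap α N) 𝒰 (𝓝 0) := by
            have := ((tendsto_pow_atTop_nhds_zero_of_lt_one (by norm_num)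
              (by norm_num : (1 / 2 : ℝ) < 1)).comp h1).const_mul (taylorCoeff S α)
            simpa using this
          refine h2.congr fun N => ?_
          simp only [he, if_neg hαA, sub_zero, scaledCoeff_eq _ hα, hgap]
      · have h1 : taylorCoeff S α = 0 := not_not.1 hα
        have h2 : ∀ N, e N α = 0 := fun N => by simp [he, scaledCoeff, h1]
        simp only [h2]
        exact tendsto_const_nhds
    · filter_upwards [hlarge J₀] with N hN α
      rw [Real.norm_eq_abs, abs_of_nonneg (by positivity)]
      exact hebound N hN α
  obtain ⟨N, ⟨hN1, hN2⟩, hN3⟩ :=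
    (((hlim.eventually (gt_mem_nhds hη)).and (hlarge J₀)).and (hlarge ⌈C⌉₊)).exists
  have hsumm : Summable fun α => |e N α| * 4 ^ ∑ i, α i :=
    Summable.of_nonneg_of_le (fun α => by positivity) (hebound N hN2) (hb.mul_left 2)
  refine absurd (hvol N) (not_lt.2 ?_)
  calc volume {y | y ∈ shell n ∧ |2 ^ minDeg S (j N) * S (dyadicScale (j N) y)| < δ N}
      = volume {y | y ∈ shell n ∧ |f y + ∑' α, e N α * monom α y| < δ N} := by
        congr 1
        ext y
        simp only [mem_ofPred_eq, and_congr_right_iff]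
        intro hy
        have hy4 : ∀ i, |y i| ≤ 4 := fun i => (hy i).2.trans (by norm_num)
        have h1 := (hexp (j N) fun i => hN2.trans (hj N i)).2 y hy4
        have h2 : HasSum (fun α => (if α ∈ A then scaledCoeff S (j M) α else 0) * monom α y)
            (f y) := by
          have h3 : HasSum (fun α => (if α ∈ A then scaledCoeff S (j M) α else 0) * monom α y)
              (∑ α ∈ A, (if α ∈ A then scaledCoeff S (j M) α else 0) * monom α y) :=
            hasSum_sum_of_ne_finset_zero fun α hα => by simp [hα]
          rwa [Finset.sum_congr rfl (g := fun α => scaledCoeff S (j M) α * monom α y)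
            fun α hα => by rw [if_pos hα]] at h3
        have h3 := (h1.sub h2).tsum_eq
        have h4 : ∀ α, e N α * monom α y = scaledCoeff S (j N) α * monom α y -
            (if α ∈ A then scaledCoeff S (j M) α else 0) * monom α y := fun α => by
          simp only [he, sub_mul]
        simp only [h4, h3, add_sub_cancel]
    _ ≤ ENNReal.ofReal (C * δ N ^ (1 / D)) := hest (e N) hsumm hN1.le (δ N) (hδ N)
    _ ≤ ENNReal.ofReal ((N + 1) * δ N ^ (1 / D)) := by
        refine ENNReal.ofReal_le_ofReal (mul_le_mul_of_nonneg_right ?_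
          (Real.rpow_nonneg (hδ N).le _))
        have h1 := Nat.le_ceil C
        have h2 : (⌈C⌉₊ : ℝ) ≤ N := by exact_mod_cast hN3
        linarith

/-! ### Dyadic decomposition of sublevel sets -/

theorem volume_image_dyadicScale {n : ℕ} (j : Fin n → ℕ) (A : Set (Fin n → ℝ)) :
    volume (dyadicScale j '' A) = ENNReal.ofReal ((1 / 2) ^ ∑ i, j i) * volume A := by
  have h1 : dyadicScale j = Matrix.toLin' (Matrix.diagonal fun i => ((1 : ℝ) / 2) ^ j i) := by
    funext y i
    rw [Matrix.toLin'_apply, Matrix.mulVec_diagonal, dyadicScale]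
    rw [div_pow, one_pow]; ring
  rw [h1, Measure.addHaar_image_linearMap, LinearMap.det_toLin', Matrix.det_diagonal,
    Finset.prod_pow_eq_pow_sum, abs_of_pos (by positivity)]

theorem exists_mem_shell {n : ℕ} {J : ℕ} {x : Fin n → ℝ} (hx0 : ∀ i, x i ≠ 0)
    (hx : ∀ i, |x i| < (1 / 2) ^ J) :
    ∃ j : Fin n → ℕ, (∀ i, J ≤ j i) ∧ ∃ y ∈ shell n, dyadicScale j y = x := by
  have h : ∀ i, ∃ k : ℕ, J ≤ k + 1 ∧ (1 / 2 : ℝ) ^ (k + 1) < |x i| ∧ |x i| ≤ (1 / 2) ^ k := by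
    intro i
    have h1 : |x i| ≤ 1 := (hx i).le.trans (pow_le_one₀ (by norm_num) (by norm_num))
    obtain ⟨k, hk1, hk2⟩ := exists_nat_pow_near_of_lt_one (abs_pos.2 (hx0 i)) h1
      (show (0 : ℝ) < 1 / 2 by norm_num) (by norm_num)
    refine ⟨k, ?_, hk1, hk2⟩
    have h2 := hk1.trans (hx i)
    exact ((pow_lt_pow_iff_right_of_lt_one₀ (by norm_num) (by norm_num)).1 h2).le
  choose k hJ hk1 hk2 using h
  refine ⟨fun i => k i + 1, hJ, fun i => x i * 2 ^ (k i + 1), fun i => ?_, ?_⟩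
  · rw [abs_mul, abs_of_pos (by positivity : (0 : ℝ) < 2 ^ (k i + 1))]
    have h1 := hk1 i
    have h2 := hk2 i
    rw [div_pow, one_pow, div_lt_iff₀ (by positivity)] at h1
    rw [div_pow, one_pow, le_div_iff₀ (by positivity)] at h2
    refine ⟨h1.le, ?_⟩
    rw [pow_succ]; linarith
  · funext i
    rw [dyadicScale, mul_div_cancel_right₀ _ (by positivity)]

theorem volume_sublevel_le_tsum {n : ℕ} (S : (Fin n → ℝ) → ℝ) (J : ℕ) (ε : ℝ)
    (T : (Fin n → ℕ) → ENNReal)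
    (hT : ∀ j : Fin n → ℕ, (∀ i, J ≤ j i) →
      volume {y | y ∈ shell n ∧ |S (dyadicScale j y)| < ε} ≤ T j) :
    volume {x : Fin n → ℝ | (∀ i, |x i| < (1 / 2) ^ J) ∧ |S x| < ε} ≤
      ∑' j, ENNReal.ofReal ((1 / 2) ^ ∑ i, j i) * T j := by
  classical
  have hsub : {x : Fin n → ℝ | (∀ i, |x i| < (1 / 2) ^ J) ∧ |S x| < ε} ⊆
      (⋃ i, {x : Fin n → ℝ | x i = 0}) ∪ ⋃ j : Fin n → ℕ, {x | (∀ i, J ≤ j i) ∧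
        x ∈ dyadicScale j '' {y | y ∈ shell n ∧ |S (dyadicScale j y)| < ε}} := by
    rintro x ⟨hx, hSx⟩
    by_cases h0 : ∃ i, x i = 0
    · exact Or.inl (mem_iUnion.2 h0)
    · push Not at h0
      obtain ⟨j, hj, y, hy, rfl⟩ := exists_mem_shell h0 hx
      exact Or.inr (mem_iUnion.2 ⟨j, hj, y, ⟨hy, hSx⟩, rfl⟩)
  have hnull : volume (⋃ i, {x : Fin n → ℝ | x i = 0}) = 0 := by
    refine measure_iUnion_null fun i => ?_
    rw [volume_pi]
    exact Measure.pi_hyperplane _ i 0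
  calc _ ≤ volume (⋃ i, {x : Fin n → ℝ | x i = 0}) + volume (⋃ j : Fin n → ℕ, {x | (∀ i, J ≤ j i) ∧
        x ∈ dyadicScale j '' {y | y ∈ shell n ∧ |S (dyadicScale j y)| < ε}}) :=
        (measure_mono hsub).trans (measure_union_le _ _)
    _ ≤ ∑' j : Fin n → ℕ, volume {x | (∀ i, J ≤ j i) ∧
        x ∈ dyadicScale j '' {y | y ∈ shell n ∧ |S (dyadicScale j y)| < ε}} := by
        rw [hnull, zero_add]; exact measure_iUnion_le _
    _ ≤ _ := by
        refine ENNReal.tsum_le_tsum fun j => ?_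
        by_cases hj : ∀ i, J ≤ j i
        · calc _ ≤ volume (dyadicScale j '' {y | y ∈ shell n ∧ |S (dyadicScale j y)| < ε}) :=
                measure_mono fun x hx => hx.2
            _ ≤ _ := by
                rw [volume_image_dyadicScale]
                gcongr
                exact hT j hj
        · have : {x | (∀ i, J ≤ j i) ∧
              x ∈ dyadicScale j '' {y | y ∈ shell n ∧ |S (dyadicScale j y)| < ε}} = ∅ :=
            eq_empty_of_forall_notMem fun x hx => hj hx.1
          rw [this, measure_empty]
          exact zero_le

theorem volume_shell_le (n : ℕ) : volume (shell n) ≤ ENNReal.ofReal (4 ^ n) := by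
  calc volume (shell n) ≤ volume (Metric.closedBall (0 : Fin n → ℝ) 2) :=
        measure_mono fun y hy => by simpa using norm_le_of_mem_shell hy
    _ = _ := by
        rw [Real.volume_pi_closedBall _ (by norm_num)]
        norm_num

/-- The total weight of a dyadic shell, as an exponential. -/
theorem shell_term_le {n : ℕ} {S : (Fin n → ℝ) → ℝ} {j : Fin n → ℕ} {C D ε : ℝ} (hC : 0 < C)
    (hε : 0 < ε) (h : ∀ δ : ℝ, 0 < δ →
      volume {y | y ∈ shell n ∧ |2 ^ minDeg S j * S (dyadicScale j y)| < δ} ≤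
        ENNReal.ofReal (C * δ ^ (1 / D))) :
    volume {y | y ∈ shell n ∧ |S (dyadicScale j y)| < ε} ≤
      ENNReal.ofReal ((C + 4 ^ n) *
        Real.exp (-max 0 ((-Real.log ε - Real.log 2 * minDeg S j) / D))) := by
  by_cases hcase : 0 ≤ (-Real.log ε - Real.log 2 * minDeg S j) / D
  · have h1 := h (2 ^ minDeg S j * ε) (by positivity)
    have h2 : {y | y ∈ shell n ∧ |2 ^ minDeg S j * S (dyadicScale j y)| < 2 ^ minDeg S j * ε} =
        {y | y ∈ shell n ∧ |S (dyadicScale j y)| < ε} := by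
      ext y
      simp only [mem_ofPred_eq, and_congr_right_iff]
      intro _
      rw [abs_mul, abs_of_pos (by positivity : (0 : ℝ) < 2 ^ minDeg S j)]
      exact mul_lt_mul_iff_right₀ (by positivity)
    rw [h2] at h1
    refine h1.trans (ENNReal.ofReal_le_ofReal ?_)
    have h3 : (2 ^ minDeg S j * ε) ^ (1 / D) =
        Real.exp (-max 0 ((-Real.log ε - Real.log 2 * minDeg S j) / D)) := by
      rw [max_eq_right hcase, Real.rpow_def_of_pos (by positivity), Real.log_mul (by positivity)
        hε.ne', Real.log_pow]
      congr 1
      ring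
    rw [h3]
    have : (0 : ℝ) ≤ 4 ^ n := by positivity
    exact mul_le_mul_of_nonneg_right (by linarith) (Real.exp_pos _).le
  · rw [max_eq_left (not_le.1 hcase).le, neg_zero, Real.exp_zero, mul_one]
    calc _ ≤ volume (shell n) := measure_mono fun y hy => hy.1
      _ ≤ _ := (volume_shell_le n).trans (ENNReal.ofReal_le_ofReal (by linarith))

theorem half_pow_eq_exp (k : ℕ) : (1 / 2 : ℝ) ^ k = Real.exp (-(Real.log 2 * k)) := by
  rw [one_div, inv_pow, Real.exp_neg, mul_comm, Real.exp_nat_mul, Real.exp_log (by norm_num)]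

/-! ### Convergence of the dyadic sums -/

theorem tsum_exp_neg_near_subspace_le {n r t : ℕ} (hr : r + t = n) {w : Fin r → Fin n → ℝ}
    (hw : LinearIndependent ℝ w) {c : ℝ} (hc : 0 < c) :
    ∃ C : ℝ, 0 < C ∧ ∀ (b : Fin r → ℝ) (L : ℝ), 1 ≤ L →
      ∑' j : Fin n → ℕ, ENNReal.ofReal (Real.exp (-(c * ∑ i, |w i ⬝ᵥ toPoint j - b i| +
        c * max (∑ i, (j i : ℝ) - L) 0))) ≤ ENNReal.ofReal (C * L ^ t) := by
  obtain ⟨C, hC, h⟩ := tsum_exp_neg_truncated_le t r hr w hw c hc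
  have hm : 0 < min c 1 := lt_min hc one_pos
  refine ⟨C * ∏ _i : Fin r, (min c 1)⁻¹, by positivity, fun b L hL => ?_⟩
  refine le_trans (ENNReal.tsum_le_tsum fun j => ?_)
    (h (fun _ => min c 1) b (fun _ => ⟨hm, min_le_right _ _⟩) L hL)
  refine ENNReal.ofReal_le_ofReal (Real.exp_le_exp.2 (neg_le_neg (add_le_add_left ?_ _)))
  rw [← Finset.mul_sum]
  exact mul_le_mul_of_nonneg_right (min_le_left _ _) (Finset.sum_nonneg fun i _ => abs_nonneg _)

theorem tsum_le_of_le_exp {n : ℕ} {F : (Fin n → ℕ) → ENNReal} {g : (Fin n → ℕ) → ℝ} {A a K : ℝ}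
    (hA : 0 ≤ A) (hK : ∑' j, ENNReal.ofReal (Real.exp (-g j)) ≤ ENNReal.ofReal K)
    (hF : ∀ j, F j ≤ ENNReal.ofReal (A * Real.exp (-(a + g j)))) :
    ∑' j, F j ≤ ENNReal.ofReal (A * Real.exp (-a) * K) := by
  calc ∑' j, F j ≤ ∑' j, ENNReal.ofReal (A * Real.exp (-a)) * ENNReal.ofReal (Real.exp (-g j)) := by
        refine ENNReal.tsum_le_tsum fun j => (hF j).trans_eq ?_
        rw [← ENNReal.ofReal_mul (by positivity), mul_assoc, ← Real.exp_add]
        congr 3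
        ring
    _ ≤ _ := by
        rw [ENNReal.tsum_mul_left, ENNReal.ofReal_mul (p := A * Real.exp (-a)) (by positivity)]
        exact mul_le_mul' le_rfl hK

/-- The weight `exp (-(weight))` of the shell at scale `j` in the dyadic sum for the level
`ε = exp (-Λ)`, when the sublevel estimate holds with exponent `1 / D`. -/
def weight {n : ℕ} (S : (Fin n → ℝ) → ℝ) (D Λ : ℝ) (j : Fin n → ℕ) : ℝ :=
  Real.log 2 * ∑ i, (j i : ℝ) + max 0 ((Λ - Real.log 2 * minDeg S j) / D)

theorem ofReal_half_pow_mul_shell_term {n : ℕ} (S : (Fin n → ℝ) → ℝ) (A D Λ : ℝ)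
    (j : Fin n → ℕ) :
    ENNReal.ofReal ((1 / 2) ^ ∑ i, j i) * ENNReal.ofReal (A * Real.exp
      (-max 0 ((Λ - Real.log 2 * minDeg S j) / D))) =
        ENNReal.ofReal (A * Real.exp (-weight S D Λ j)) := by
  rw [half_pow_eq_exp, ← ENNReal.ofReal_mul (Real.exp_pos _).le, mul_left_comm, ← Real.exp_add,
    weight]
  congr 3
  push_cast
  ring

/-! ### Linear forms on the central face -/

/-- The directions of the central face, scaled so that `(d, …, d) ± u i` stays in the face, are
linear forms in `j` bounded by the defect `d * |j| - minDeg S j`. -/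
theorem IsCentralFace.exists_basis {n : ℕ} {S : (Fin n → ℝ) → ℝ} {C : Set (Fin n → ℝ)}
    (hC : IsCentralFace S C) (h0 : taylorCoeff S 0 = 0) :
    ∃ (k : ℕ) (u : Fin k → Fin n → ℝ), k = faceDim C ∧ LinearIndependent ℝ u ∧
      (∀ i, u i ∈ vectorSpan ℝ C) ∧
      ∀ (j : Fin n → ℕ) i, |u i ⬝ᵥ toPoint j| ≤
        newtonDistance S * ∑ i, (j i : ℝ) - minDeg S j := by
  obtain ⟨-, l, -, -, -, hlC, η, hη, hball⟩ := hC.exists_form h0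
  let b := Module.finBasis ℝ (vectorSpan ℝ C)
  let τ : Fin (faceDim C) → ℝ := fun i => η / (‖(b i : Fin n → ℝ)‖ + 1)
  have hτ : ∀ i, 0 < τ i := fun i => by positivity
  have hb : LinearIndependent ℝ fun i => ((b i : vectorSpan ℝ C) : Fin n → ℝ) :=
    b.linearIndependent.map' (vectorSpan ℝ C).subtype (Submodule.ker_subtype _)
  refine ⟨_, fun i => τ i • (b i : Fin n → ℝ), rfl,
    hb.units_smul fun i => Units.mk0 (τ i) (hτ i).ne',
    fun i => Submodule.smul_mem _ _ (b i).2, fun j i => ?_⟩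
  have hnorm : ‖τ i • (b i : Fin n → ℝ)‖ ≤ η := by
    rw [norm_smul, Real.norm_eq_abs, abs_of_pos (hτ i)]
    simp only [τ]
    rw [div_mul_eq_mul_div, div_le_iff₀ (by positivity)]
    nlinarith [norm_nonneg (b i : Fin n → ℝ)]
  have hmem : τ i • (b i : Fin n → ℝ) ∈ vectorSpan ℝ C := Submodule.smul_mem _ _ (b i).2
  have h1 := minDeg_le_of_mem_newtonPolyhedron j ((hlC _).1 (hball _ hmem hnorm)).1
  have h2 := minDeg_le_of_mem_newtonPolyhedron j ((hlC _).1
    (hball _ (neg_mem hmem) (by rwa [norm_neg]))).1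
  rw [dotProduct_add] at h1 h2
  rw [dotProduct_neg] at h2
  have h3 : (toPoint j ⬝ᵥ fun _ => newtonDistance S) = newtonDistance S * ∑ i, (j i : ℝ) := by
    simp only [dotProduct, toPoint]; rw [← Finset.sum_mul, mul_comm]
  rw [h3] at h1 h2
  rw [dotProduct_comm, abs_le]
  constructor <;> linarith

theorem minDeg_le_newtonDistance {n : ℕ} {S : (Fin n → ℝ) → ℝ} {C : Set (Fin n → ℝ)}
    (hC : IsCentralFace S C) (h0 : taylorCoeff S 0 = 0) (j : Fin n → ℕ) :
    (minDeg S j : ℝ) ≤ newtonDistance S * ∑ i, (j i : ℝ) := by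
  obtain ⟨-, l, -, -, -, hlC, η, hη, hball⟩ := hC.exists_form h0
  have h1 := hball 0 (zero_mem _) (by simpa using hη.le)
  rw [add_zero] at h1
  have h2 := minDeg_le_of_mem_newtonPolyhedron j ((hlC _).1 h1).1
  have h3 : (toPoint j ⬝ᵥ fun _ => newtonDistance S) = newtonDistance S * ∑ i, (j i : ℝ) := by
    simp only [dotProduct, toPoint]; rw [← Finset.sum_mul, mul_comm]
  rwa [h3] at h2

/-- A linear form that is constant on the central face separates its direction space from every
vector on which the form does not vanish. -/
theorem linearIndependent_snoc_of_form {n k : ℕ} {C : Set (Fin n → ℝ)} {u : Fin k → Fin n → ℝ}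
    (hu : LinearIndependent ℝ u) (huC : ∀ i, u i ∈ vectorSpan ℝ C) {l : Fin n → ℝ} {c : ℝ}
    (hl : ∀ p ∈ C, l ⬝ᵥ p = c) {v : Fin n → ℝ} (hv : l ⬝ᵥ v ≠ 0) :
    LinearIndependent ℝ (Fin.snoc u v : Fin (k + 1) → Fin n → ℝ) := by
  have hspan : ∀ x ∈ vectorSpan ℝ C, l ⬝ᵥ x = 0 := by
    intro x hx
    have hle : vectorSpan ℝ C ≤ LinearMap.ker (dotProductBilin ℝ ℝ l) := by
      rw [vectorSpan_def, Submodule.span_le]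
      rintro _ ⟨p, hp, p', hp', rfl⟩
      simp [hl p hp, hl p' hp', dotProduct_sub]
    exact hle hx
  refine linearIndependent_finSnoc.2 ⟨hu, fun h => hv (hspan v ?_)⟩
  exact Submodule.span_le.2 (by rintro _ ⟨i, rfl⟩; exact huC i) h

/-! ### Upper bounds for the measure of sublevel sets -/

theorem exp_neg_div_eq_rpow {ε D : ℝ} (hε : 0 < ε) :
    Real.exp (-(-Real.log ε / D)) = ε ^ (1 / D) := by
  rw [Real.rpow_def_of_pos hε]
  congr 1
  ring

theorem volume_sublevel_le_tsum_weight {n : ℕ} (hn : 0 < n) {S : (Fin n → ℝ) → ℝ}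
    (hS : AnalyticAt ℝ S 0) (hne : (taylorSupport S).Nonempty) {D : ℝ} (hD : 0 < D)
    (hQ : ∀ F, IsCompactFace S F → ∀ m, FaceHasZeroOfOrder S F m → (m : ℝ) ≤ D) :
    ∃ (J : ℕ) (A : ℝ), 0 < A ∧ ∀ ε : ℝ, 0 < ε →
      volume {x : Fin n → ℝ | (∀ i, |x i| < (1 / 2) ^ J) ∧ |S x| < ε} ≤
        ∑' j, ENNReal.ofReal (A * Real.exp (-weight S D (-Real.log ε) j)) := by
  obtain ⟨J, C, hC, h⟩ := exists_scaled_sublevel_le hn hS hne hD univ fun A _ hA => hQ _ hA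
  refine ⟨J, C + 4 ^ n, by positivity, fun ε hε => ?_⟩
  refine (volume_sublevel_le_tsum S J ε _ fun j hj => shell_term_le hC hε
    (h j hj fun β _ hβ => absurd (mem_univ β) hβ)).trans_eq (tsum_congr fun j => ?_)
  exact ofReal_half_pow_mul_shell_term S _ D _ j

/-- If the orders of zeros are bounded by a number `D` larger than the Newton distance, then the
dyadic sum is dominated by a convergent geometric series. -/
theorem exists_volume_sublevel_le_of_lt {n : ℕ} (hn : 0 < n) {S : (Fin n → ℝ) → ℝ}
    (hS : AnalyticAt ℝ S 0) (hne : (taylorSupport S).Nonempty) (h0 : taylorCoeff S 0 = 0)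
    {C : Set (Fin n → ℝ)} (hC : IsCentralFace S C) {D : ℝ} (hD : newtonDistance S < D)
    (hQ : ∀ F, IsCompactFace S F → ∀ m, FaceHasZeroOfOrder S F m → (m : ℝ) ≤ D) :
    ∃ (J : ℕ) (K : ℝ), 0 < K ∧ ∀ᶠ ε in 𝓝[>] (0 : ℝ),
      volume {x : Fin n → ℝ | (∀ i, |x i| < (1 / 2) ^ J) ∧ |S x| < ε} ≤
        ENNReal.ofReal (K * ε ^ (1 / D)) := by
  obtain ⟨hd, -⟩ := hC.exists_form h0
  set d := newtonDistance S with hdef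
  have hD0 : 0 < D := hd.trans hD
  have hlog : 0 < Real.log 2 := Real.log_pos one_lt_two
  obtain ⟨J, A, hA, h⟩ := volume_sublevel_le_tsum_weight hn hS hne hD0 hQ
  have hθ : 0 < 1 - d / D := sub_pos.2 ((div_lt_one hD0).2 hD)
  set c : ℝ := Real.log 2 * (1 - d / D) / 2 with hc
  have hw : LinearIndependent ℝ fun i : Fin n => (Pi.single i 1 : Fin n → ℝ) := by
    convert (Pi.basisFun ℝ (Fin n)).linearIndependent using 1
    ext i
    rw [Pi.basisFun_apply]
  obtain ⟨K, hK, hsum⟩ := tsum_exp_neg_near_subspace_le (t := 0) (add_zero n) hw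
    (show 0 < c by positivity)
  refine ⟨J, A * K, by positivity, ?_⟩
  filter_upwards [self_mem_nhdsWithin] with ε hε
  have hε : 0 < ε := hε
  refine (h ε hε).trans ((tsum_le_of_le_exp hA.le (hsum 0 1 le_rfl)
    (a := -Real.log ε / D) fun j => ENNReal.ofReal_le_ofReal (mul_le_mul_of_nonneg_left
      (Real.exp_le_exp.2 (neg_le_neg ?_)) hA.le)).trans_eq ?_)
  · have hP : 0 ≤ ∑ i, (j i : ℝ) := Finset.sum_nonneg fun i _ => Nat.cast_nonneg _
    have hm := minDeg_le_newtonDistance hC h0 j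
    have h1 : ∑ i, |(Pi.single i 1 : Fin n → ℝ) ⬝ᵥ toPoint j - (0 : Fin n → ℝ) i| =
        ∑ i, (j i : ℝ) := by
      simp [toPoint]
    rw [h1, weight]
    set P := ∑ i, (j i : ℝ) with hPdef
    have h2 : max (P - 1) 0 ≤ P := max_le (by linarith) hP
    have h3 : (-Real.log ε - Real.log 2 * (d * P)) / D ≤
        max 0 ((-Real.log ε - Real.log 2 * minDeg S j) / D) := by
      refine le_trans ?_ (le_max_right _ _)
      gcongr
    have h4 : (-Real.log ε - Real.log 2 * (d * P)) / D =
        -Real.log ε / D - Real.log 2 * (d / D) * P := by field_simp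
    have h5 : c * max (P - 1) 0 ≤ c * P := mul_le_mul_of_nonneg_left h2 (by positivity)
    have h6 : c * P + c * P = Real.log 2 * P - Real.log 2 * (d / D) * P := by rw [hc]; ring
    linarith
  · rw [exp_neg_div_eq_rpow hε]
    congr 1
    ring

/-- In terms of the height `P = |j|` and the defect `d * P - m`, the exponent `weight` exceeds
`Λ / d` by a multiple of the defect and of the excess of `P` over `Λ / (d * a)`, `a = log 2`. -/
theorem weight_ge_of_defect {a d Λ P m N H σ : ℝ} (ha : 0 < a) (hd : 0 < d) (hN : 0 < N)
    (hH : 0 ≤ H) (hm : m ≤ d * P) (hσ : σ ≤ N * (d * P - m) + H) :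
    Λ / d - a * H + (a * min (1 / 2) (1 / (2 * N * d)) * σ +
      a * min (1 / 2) (1 / (2 * N * d)) * max (P - Λ / (d * a)) 0) ≤
        a * P + max 0 ((Λ - a * m) / d) := by
  set c := min (1 / 2) (1 / (2 * N * d)) with hc
  have hc0 : 0 < c := lt_min (by norm_num) (by positivity)
  have hc1 : c ≤ 1 / 2 := min_le_left _ _
  have hc2 : c * (N * d) ≤ 1 / 2 := by
    have : c ≤ 1 / (2 * N * d) := min_le_right _ _
    rw [le_div_iff₀ (by positivity)] at this
    linarith
  set L := Λ / (d * a) with hL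
  have hΛ : Λ = d * a * L := by rw [hL]; field_simp
  set h := P - m / d with hh
  have hmh : m = d * (P - h) := by rw [hh]; field_simp; ring
  have hh0 : 0 ≤ h := by
    rw [hh, sub_nonneg, div_le_iff₀ hd]; linarith
  have h1 : (Λ - a * m) / d = a * (L - P + h) := by rw [hΛ, hmh]; field_simp; ring
  have h2 : Λ / d = a * L := by rw [hΛ]; field_simp
  have h3 : c * σ ≤ 1 / 2 * h + H := by
    have h4 : N * (d * P - m) = N * d * h := by rw [hmh]; ring
    rw [h4] at hσ
    calc c * σ ≤ c * (N * d * h + H) := mul_le_mul_of_nonneg_left hσ hc0.le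
      _ = c * (N * d) * h + c * H := by ring
      _ ≤ _ := by nlinarith
  have h4 : c * max (P - L) 0 ≤ 1 / 2 * max (P - L) 0 :=
    mul_le_mul_of_nonneg_right hc1 (le_max_right _ _)
  have h5 : a * (h + L) ≤ a * P + max 0 (a * (L - P + h)) := by
    have := le_max_right 0 (a * (L - P + h)); linarith
  have h6 : a * max (P - L) 0 ≤ a * P - a * L + max 0 (a * (L - P + h)) := by
    rcases max_cases (P - L) 0 with ⟨h7, _⟩ | ⟨h7, h8⟩
    · rw [h7]; have := le_max_left 0 (a * (L - P + h)); linarith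
    · rw [h7]; have := mul_nonneg ha.le hh0; linarith
  have h7 : a * (c * σ + c * max (P - L) 0) ≤ a * (1 / 2 * h + H + 1 / 2 * max (P - L) 0) :=
    mul_le_mul_of_nonneg_left (by linarith) ha.le
  rw [h1, h2]
  linarith

/-- If the sublevel estimate holds with an exponent `D < d`, then the exponent `weight` also exceeds
`Λ / d` by a multiple of the distance of `P = |j|` from `Λ / (d * a)`, `a = log 2`, on both
sides. -/
theorem weight_ge_of_gain {a d D Λ P m k σ : ℝ} (ha : 0 < a) (hD : 0 < D) (hd : D < d) (hk : 0 ≤ k)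
    (hm : m ≤ d * P) (hσ : σ ≤ k * (d * P - m)) :
    Λ / d + (a * min (1 / 2) (d / D - 1) / (2 + k * d) * (σ + |P - Λ / (d * a)|) +
      a * min (1 / 2) (d / D - 1) / (2 + k * d) * max (P - Λ / (d * a)) 0) ≤
        a * P + max 0 ((Λ - a * m) / D) := by
  have hd0 : 0 < d := hD.trans hd
  have hθ : 0 < d / D - 1 := sub_pos.2 ((one_lt_div hD).2 hd)
  set c₀ := min (1 / 2) (d / D - 1) with hc₀
  have hc₀0 : 0 < c₀ := lt_min (by norm_num) hθ
  have hc1 : c₀ ≤ 1 / 2 := min_le_left _ _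
  have hc2 : c₀ ≤ d / D - 1 := min_le_right _ _
  have hkd : 0 ≤ k * d := by positivity
  set L := Λ / (d * a) with hL
  have hΛ : Λ = d * a * L := by rw [hL]; field_simp
  set h := P - m / d with hh
  have hmh : m = d * (P - h) := by rw [hh]; field_simp; ring
  have hh0 : 0 ≤ h := by
    rw [hh, sub_nonneg, div_le_iff₀ hd0]; linarith
  have h1 : (Λ - a * m) / D = a * (d / D * (L - P + h)) := by rw [hΛ, hmh]; field_simp; ring
  have h2 : Λ / d = a * L := by rw [hΛ]; field_simp
  have hσ' : σ ≤ k * d * h := by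
    have h4 : k * (d * P - m) = k * d * h := by rw [hmh]; ring
    rwa [h4] at hσ
  have h3 : max (P - L) 0 ≤ |P - L| := max_le (le_abs_self _) (abs_nonneg _)
  have h4 : σ + |P - L| + max (P - L) 0 ≤ (2 + k * d) * (|P - L| + h) := by
    have := abs_nonneg (P - L)
    nlinarith
  have h5 : a * c₀ / (2 + k * d) * (σ + |P - L|) + a * c₀ / (2 + k * d) * max (P - L) 0 ≤
      a * (c₀ * (|P - L| + h)) := by
    calc _ = a * c₀ / (2 + k * d) * (σ + |P - L| + max (P - L) 0) := by ring
      _ ≤ a * c₀ / (2 + k * d) * ((2 + k * d) * (|P - L| + h)) :=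
          mul_le_mul_of_nonneg_left h4 (by positivity)
      _ = _ := by field_simp
  have h6 : c₀ * (|P - L| + h) ≤ P - L + max 0 (d / D * (L - P + h)) := by
    rcases abs_cases (P - L) with ⟨h7, h8⟩ | ⟨h7, h8⟩
    · rw [h7]
      have h9 := le_max_left 0 (d / D * (L - P + h))
      have h10 := le_max_right 0 (d / D * (L - P + h))
      rcases le_total (L - P + h) 0 with h11 | h11
      · nlinarith
      · have h12 : L - P + h ≤ d / D * (L - P + h) := by nlinarith
        nlinarith
    · rw [h7]
      have h10 := le_max_right 0 (d / D * (L - P + h))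
      nlinarith
  have h7 : max 0 (a * (d / D * (L - P + h))) = a * max 0 (d / D * (L - P + h)) := by
    rw [mul_max_of_nonneg _ _ ha.le, mul_zero]
  have h8 := mul_le_mul_of_nonneg_left h6 ha.le
  rw [h1, h2, h7]
  linarith

theorem eventually_le_neg_log (M : ℝ) : ∀ᶠ ε in 𝓝[>] (0 : ℝ), M ≤ -Real.log ε := by
  have := Real.tendsto_log_nhdsGT_zero.eventually (eventually_le_atBot (-M))
  filter_upwards [this] with ε h
  linarith

/-- If the orders of zeros are bounded by the Newton distance, the shells that matter lie near the
subspace orthogonal to the central face and below the height `log₂ (1 / ε) / d`. -/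
theorem exists_volume_sublevel_le_of_le {n : ℕ} (hn : 0 < n) {S : (Fin n → ℝ) → ℝ}
    (hS : AnalyticAt ℝ S 0) (hne : (taylorSupport S).Nonempty) (h0 : taylorCoeff S 0 = 0)
    {C : Set (Fin n → ℝ)} (hC : IsCentralFace S C)
    (hQ : ∀ F, IsCompactFace S F → ∀ m, FaceHasZeroOfOrder S F m → (m : ℝ) ≤ newtonDistance S) :
    ∃ (J : ℕ) (K : ℝ), 0 < K ∧ ∀ᶠ ε in 𝓝[>] (0 : ℝ),
      volume {x : Fin n → ℝ | (∀ i, |x i| < (1 / 2) ^ J) ∧ |S x| < ε} ≤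
        ENNReal.ofReal (K * |Real.log ε| ^ (n - faceDim C) * ε ^ (1 / newtonDistance S)) := by
  obtain ⟨hd, -⟩ := hC.exists_form h0
  obtain ⟨k, u, hk, hu, -, hudef⟩ := hC.exists_basis h0
  set d := newtonDistance S with hdef
  rw [← hk]
  have hlog : 0 < Real.log 2 := Real.log_pos one_lt_two
  obtain ⟨J, A, hA, h⟩ := volume_sublevel_le_tsum_weight hn hS hne hd hQ
  have hkn : k ≤ n := by
    have := hu.fintype_card_le_finrank
    simpa using this
  have hN : (0 : ℝ) < k + 1 := by positivity
  set c : ℝ := Real.log 2 * min (1 / 2) (1 / (2 * (k + 1) * d)) with hc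
  have hc0 : 0 < c := mul_pos hlog (lt_min (by norm_num) (by positivity))
  obtain ⟨K, hK, hsum⟩ := tsum_exp_neg_near_subspace_le (t := n - k) (by omega) hu hc0
  refine ⟨J, A * K * ((d * Real.log 2)⁻¹) ^ (n - k), by positivity, ?_⟩
  filter_upwards [self_mem_nhdsWithin, eventually_le_neg_log (d * Real.log 2)] with ε hε hεL
  have hε : 0 < ε := hε
  set Λ := -Real.log ε with hΛ
  have hL : 1 ≤ Λ / (d * Real.log 2) := (one_le_div (by positivity)).2 hεL
  refine (h ε hε).trans ((tsum_le_of_le_exp hA.le (hsum 0 _ hL)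
    (a := Λ / d) fun j => ENNReal.ofReal_le_ofReal (mul_le_mul_of_nonneg_left
      (Real.exp_le_exp.2 (neg_le_neg ?_)) hA.le)).trans_eq ?_)
  · have hm := minDeg_le_newtonDistance hC h0 j
    have hσ : ∑ i, |u i ⬝ᵥ toPoint j - (0 : Fin k → ℝ) i| ≤
        ((k : ℝ) + 1) * (d * ∑ i, (j i : ℝ) - minDeg S j) + 0 := by
      calc _ ≤ ∑ _i : Fin k, (d * ∑ i, (j i : ℝ) - minDeg S j) :=
            Finset.sum_le_sum fun i _ => by simpa using hudef j i
        _ = (k : ℝ) * (d * ∑ i, (j i : ℝ) - minDeg S j) := by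
            rw [Finset.sum_const, Finset.card_univ, Fintype.card_fin, nsmul_eq_mul]
        _ ≤ _ := by nlinarith
    have := weight_ge_of_defect (Λ := Λ) hlog hd hN le_rfl hm hσ
    rw [mul_zero, sub_zero] at this
    exact this
  · rw [hΛ, exp_neg_div_eq_rpow hε, ← hΛ, abs_of_nonpos (by
      have : 0 < d * Real.log 2 := by positivity
      linarith), ← hΛ]
    congr 1
    rw [div_eq_mul_inv Λ (d * Real.log 2), mul_pow]
    ring

/-- If no zeros of order `d` occur on the central face, the shells along the normal cone of the
central face satisfy a better sublevel estimate, so that only those with `|j|` about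
`log₂ (1 / ε) / d` contribute; each remaining shell is nearly orthogonal to a vector
`β - (d, …, d)`, where `β` is one of the finitely many minimal exponents outside the face. -/
theorem exists_volume_sublevel_le_of_central {n : ℕ} (hn : 0 < n) {S : (Fin n → ℝ) → ℝ}
    (hS : AnalyticAt ℝ S 0) (hne : (taylorSupport S).Nonempty) (h0 : taylorCoeff S 0 = 0)
    {C : Set (Fin n → ℝ)} (hC : IsCentralFace S C)
    (hQ : ∀ F, IsCompactFace S F → ∀ m, FaceHasZeroOfOrder S F m → (m : ℝ) ≤ newtonDistance S)
    (hQC : ¬ ∃ F, IsCompactFace S F ∧ F ⊆ C ∧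
      ∃ m : ℕ, (m : ℝ) = newtonDistance S ∧ FaceHasZeroOfOrder S F m) :
    ∃ (J : ℕ) (K : ℝ), 0 < K ∧ ∀ᶠ ε in 𝓝[>] (0 : ℝ),
      volume {x : Fin n → ℝ | (∀ i, |x i| < (1 / 2) ^ J) ∧ |S x| < ε} ≤
        ENNReal.ofReal (K * |Real.log ε| ^ (n - faceDim C - 1) * ε ^ (1 / newtonDistance S)) := by
  classical
  obtain ⟨hd, l, hl0, hlpos, hlN, hlC, -⟩ := hC.exists_form h0
  obtain ⟨k, u, hk, hu, huC, hudef⟩ := hC.exists_basis h0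
  have hm := minDeg_le_newtonDistance hC h0
  set d := newtonDistance S with hdef
  rw [← hk]
  have hlog : 0 < Real.log 2 := Real.log_pos one_lt_two
  -- an exponent `D < d` that bounds all integers less than `d`
  set D : ℝ := max (d / 2) (⌈d⌉₊ - 1 : ℝ) with hDdef
  have hD0 : 0 < D := lt_of_lt_of_le (by positivity) (le_max_left _ _)
  have hDd : D < d := max_lt (by linarith) (by have := Nat.ceil_lt_add_one hd.le; linarith)
  have hDint : ∀ m : ℕ, (m : ℝ) < d → (m : ℝ) ≤ D := fun m hm => by
    refine le_trans ?_ (le_max_right _ _)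
    have h1 : m + 1 ≤ ⌈d⌉₊ := Nat.lt_ceil.2 hm
    have h2 : ((m + 1 : ℕ) : ℝ) ≤ ⌈d⌉₊ := by exact_mod_cast h1
    push_cast at h2
    linarith
  have hCconv : Convex ℝ C := by
    have hlin : IsLinearMap ℝ fun x : Fin n → ℝ => l ⬝ᵥ x :=
      ⟨fun x y => dotProduct_add _ _ _, fun a x => dotProduct_smul _ _ _⟩
    have h1 : C = newtonPolyhedron S ∩ {p | l ⬝ᵥ p = l ⬝ᵥ fun _ => d} := by
      ext p; exact hlC p
    rw [h1]
    exact (convex_newtonPolyhedron S).inter (convex_hyperplane hlin _)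
  obtain ⟨J₁, A₁, hA₁, h₁⟩ := exists_scaled_sublevel_le hn hS hne hD0 {α | toPoint α ∈ C}
    fun A hA hF m hFm => hDint m <| lt_of_le_of_ne (hQ _ hF m hFm) fun heq =>
      hQC ⟨_, hF, convexHull_min (by rintro _ ⟨α, hα, rfl⟩; exact hA hα) hCconv, m, heq, hFm⟩
  obtain ⟨J₂, A₂, hA₂, h₂⟩ := exists_scaled_sublevel_le hn hS hne hd univ fun A _ hA => hQ _ hA
  set B : Finset (Fin n → ℕ) :=
    (finite_minExponents S).toFinset.filter fun β => toPoint β ∉ C with hB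
  have hBmem : ∀ β, β ∈ B ↔ β ∈ minExponents S ∧ toPoint β ∉ C := fun β => by simp [hB]
  -- the vectors transversal to the central face
  have hones : LinearIndependent ℝ (Fin.snoc u (fun _ => 1) : Fin (k + 1) → Fin n → ℝ) :=
    linearIndependent_snoc_of_form hu huC (fun p hp => ((hlC p).1 hp).2) (by
      simpa [dotProduct] using hlpos.ne')
  have hβind : ∀ β ∈ B, LinearIndependent ℝ
      (Fin.snoc u (toPoint β - fun _ => d) : Fin (k + 1) → Fin n → ℝ) := by
    intro β hβ
    refine linearIndependent_snoc_of_form hu huC (fun p hp => ((hlC p).1 hp).2) fun h => ?_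
    rw [dotProduct_sub, sub_eq_zero] at h
    have h1 := ((hBmem β).1 hβ)
    exact h1.2 ((hlC _).2 ⟨mem_newtonPolyhedron (minExponents_subset S h1.1) le_rfl, h⟩)
  have hkn : k + 1 ≤ n := by
    have := hones.fintype_card_le_finrank
    simpa using this
  have hN : (0 : ℝ) < k + 1 := by positivity
  set c₁ : ℝ := Real.log 2 * min (1 / 2) (d / D - 1) / (2 + k * d) with hc₁
  have hc₁0 : 0 < c₁ := by
    have : 0 < min (1 / 2) (d / D - 1) :=
      lt_min (by norm_num) (sub_pos.2 ((one_lt_div hD0).2 hDd))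
    positivity
  set c₂ : ℝ := Real.log 2 * min (1 / 2) (1 / (2 * (k + 1) * d)) with hc₂
  have hc₂0 : 0 < c₂ := mul_pos hlog (lt_min (by norm_num) (by positivity))
  obtain ⟨K₁, hK₁, hsum₁⟩ :=
    tsum_exp_neg_near_subspace_le (t := n - k - 1) (by omega) hones hc₁0
  have hex : ∀ β : Fin n → ℕ, ∃ K : ℝ, 0 < K ∧ (β ∈ B → ∀ L : ℝ, 1 ≤ L →
      ∑' j : Fin n → ℕ, ENNReal.ofReal (Real.exp (-(c₂ * ∑ i,
        |(Fin.snoc u (toPoint β - fun _ => d) : Fin (k + 1) → Fin n → ℝ) i ⬝ᵥ toPoint j -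
          (0 : Fin (k + 1) → ℝ) i| + c₂ * max (∑ i, (j i : ℝ) - L) 0))) ≤
            ENNReal.ofReal (K * L ^ (n - k - 1))) := by
    intro β
    by_cases hβ : β ∈ B
    · obtain ⟨K, hK, h⟩ :=
        tsum_exp_neg_near_subspace_le (t := n - k - 1) (by omega) (hβind β hβ) hc₂0
      exact ⟨K, hK, fun _ => h 0⟩
    · exact ⟨1, one_pos, fun h => absurd h hβ⟩
  choose K₂ hK₂ hsum₂ using hex
  set A := A₁ + A₂ + 4 ^ n with hA
  have hA0 : 0 < A := by positivity
  set τ : ℝ := Real.exp (Real.log 2 * J₁) with hτ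
  refine ⟨max J₁ J₂, A * (K₁ + ∑ β ∈ B, τ * K₂ β) * ((d * Real.log 2)⁻¹) ^ (n - k - 1),
    by have := Finset.sum_nonneg fun β (_ : β ∈ B) => (mul_pos (Real.exp_pos (Real.log 2 * J₁))
        (hK₂ β)).le
       positivity, ?_⟩
  filter_upwards [self_mem_nhdsWithin, eventually_le_neg_log (d * Real.log 2)] with ε hε hεL
  have hε : 0 < ε := hε
  set Λ := -Real.log ε with hΛ
  set L := Λ / (d * Real.log 2) with hLdef
  have hL : 1 ≤ L := (one_le_div (by positivity)).2 hεL
  -- on the scales `j` that are good, only the exponents in `C` contribute to the rescaled function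
  let good : (Fin n → ℕ) → Prop := fun j =>
    ∀ β ∈ minExponents S, toPoint β ∉ C → minDeg S j + J₁ ≤ dot j β
  let T₁ : (Fin n → ℕ) → ENNReal := fun j => ENNReal.ofReal (A * Real.exp (-weight S D Λ j))
  let T₂ : (Fin n → ℕ) → (Fin n → ℕ) → ENNReal := fun β j =>
    if dot j β < minDeg S j + J₁ then ENNReal.ofReal (A * Real.exp (-weight S d Λ j)) else 0
  have hvol := volume_sublevel_le_tsum S (max J₁ J₂) ε
    (fun j => if good j then
      ENNReal.ofReal (A * Real.exp (-max 0 ((Λ - Real.log 2 * minDeg S j) / D)))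
      else ENNReal.ofReal (A * Real.exp (-max 0 ((Λ - Real.log 2 * minDeg S j) / d))))
    fun j hj => by
      by_cases hg : good j
      · rw [if_pos hg]
        refine (shell_term_le hA₁ hε (h₁ j (fun i => (le_max_left _ _).trans (hj i)) hg)).trans
          (ENNReal.ofReal_le_ofReal (mul_le_mul_of_nonneg_right ?_ (Real.exp_pos _).le))
        rw [hA]; linarith
      · rw [if_neg hg]
        refine (shell_term_le hA₂ hε (h₂ j (fun i => (le_max_right _ _).trans (hj i))
          fun β _ hβ => absurd (mem_univ β) hβ)).trans
          (ENNReal.ofReal_le_ofReal (mul_le_mul_of_nonneg_right ?_ (Real.exp_pos _).le))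
        rw [hA]; linarith
  have hsplit : ∀ j, ENNReal.ofReal ((1 / 2) ^ ∑ i, j i) * (if good j then
      ENNReal.ofReal (A * Real.exp (-max 0 ((Λ - Real.log 2 * minDeg S j) / D)))
      else ENNReal.ofReal (A * Real.exp (-max 0 ((Λ - Real.log 2 * minDeg S j) / d)))) ≤
        T₁ j + ∑ β ∈ B, T₂ β j := by
    intro j
    by_cases hg : good j
    · rw [if_pos hg, ofReal_half_pow_mul_shell_term]
      exact le_self_add
    · rw [if_neg hg, ofReal_half_pow_mul_shell_term]
      simp only [good] at hg
      push Not at hg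
      obtain ⟨β, hβ, hβC, hlt⟩ := hg
      refine le_trans ?_ le_add_self
      refine le_trans (le_of_eq ?_) (Finset.single_le_sum (f := fun β => T₂ β j)
        (fun _ _ => zero_le) ((hBmem β).2 ⟨hβ, hβC⟩))
      simp only [T₂, if_pos hlt]
  have hudef' : ∀ j : Fin n → ℕ, ∑ i, |u i ⬝ᵥ toPoint j| ≤
      (k : ℝ) * (d * ∑ i, (j i : ℝ) - minDeg S j) := fun j => by
    calc _ ≤ ∑ _i : Fin k, (d * ∑ i, (j i : ℝ) - minDeg S j) :=
          Finset.sum_le_sum fun i _ => hudef j i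
      _ = _ := by rw [Finset.sum_const, Finset.card_univ, Fintype.card_fin, nsmul_eq_mul]
  have hS₁ : ∑' j, T₁ j ≤
      ENNReal.ofReal (A * Real.exp (-(Λ / d)) * (K₁ * L ^ (n - k - 1))) := by
    refine tsum_le_of_le_exp hA0.le (hsum₁ (Fin.snoc 0 L) L hL) fun j =>
      ENNReal.ofReal_le_ofReal (mul_le_mul_of_nonneg_left (Real.exp_le_exp.2 (neg_le_neg ?_))
        hA0.le)
    rw [Fin.sum_univ_castSucc]
    simp only [Fin.snoc_castSucc, Fin.snoc_last, Pi.zero_apply, sub_zero]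
    have h3 : (fun _ : Fin n => (1 : ℝ)) ⬝ᵥ toPoint j = ∑ i, (j i : ℝ) := by
      simp [dotProduct, toPoint]
    rw [h3]
    exact weight_ge_of_gain hlog hD0 hDd (Nat.cast_nonneg k) (hm j) (hudef' j)
  have hS₂ : ∀ β ∈ B, ∑' j, T₂ β j ≤
      ENNReal.ofReal (A * Real.exp (-(Λ / d - Real.log 2 * J₁)) * (K₂ β * L ^ (n - k - 1))) := by
    intro β hβ
    refine tsum_le_of_le_exp hA0.le (hsum₂ β hβ L hL) fun j => ?_
    by_cases hlt : dot j β < minDeg S j + J₁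
    swap
    · simp only [T₂, if_neg hlt]; exact zero_le
    simp only [T₂, if_pos hlt]
    refine ENNReal.ofReal_le_ofReal (mul_le_mul_of_nonneg_left (Real.exp_le_exp.2 (neg_le_neg ?_))
        hA0.le)
    refine weight_ge_of_defect hlog hd hN (Nat.cast_nonneg J₁) (hm j) ?_
    rw [Fin.sum_univ_castSucc]
    simp only [Fin.snoc_castSucc, Fin.snoc_last, Pi.zero_apply, sub_zero]
    have h3 : (toPoint β - fun _ => d) ⬝ᵥ toPoint j = dot j β - d * ∑ i, (j i : ℝ) := by
      rw [sub_dotProduct, dotProduct_comm, toPoint_dotProduct_toPoint]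
      congr 1
      rw [dotProduct, Finset.mul_sum]; rfl
    have h4 : (minDeg S j : ℝ) ≤ dot j β := by
      exact_mod_cast minDeg_le j (minExponents_subset S ((hBmem β).1 hβ).1)
    have h5 : (dot j β : ℝ) ≤ minDeg S j + J₁ := by exact_mod_cast hlt.le
    have h6 : |(dot j β : ℝ) - d * ∑ i, (j i : ℝ)| ≤ (d * ∑ i, (j i : ℝ) - minDeg S j) + J₁ := by
      have := hm j
      have h7 : (0 : ℝ) ≤ J₁ := Nat.cast_nonneg _
      rw [abs_le]; constructor <;> linarith
    rw [h3]
    have := hudef' j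
    linarith
  refine (hvol.trans (ENNReal.tsum_le_tsum hsplit)).trans ?_
  rw [ENNReal.tsum_add, Summable.tsum_finsetSum fun _ _ => ENNReal.summable]
  refine (add_le_add hS₁ (Finset.sum_le_sum hS₂)).trans (le_of_eq ?_)
  have hnn : ∀ β ∈ B, 0 ≤ A * Real.exp (-(Λ / d - Real.log 2 * J₁)) * (K₂ β * L ^ (n - k - 1)) :=
    fun β _ => by have := hK₂ β; positivity
  rw [← ENNReal.ofReal_sum_of_nonneg hnn, ← ENNReal.ofReal_add (by positivity)
    (Finset.sum_nonneg hnn)]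
  congr 1
  have h8 : Real.exp (-(Λ / d - Real.log 2 * J₁)) = ε ^ (1 / d) * τ := by
    rw [← exp_neg_div_eq_rpow hε, hτ, ← Real.exp_add]
    congr 1; ring
  have h9 : L ^ (n - k - 1) = |Real.log ε| ^ (n - k - 1) * ((d * Real.log 2)⁻¹) ^ (n - k - 1) := by
    rw [abs_of_nonpos (by
      have : 0 < d * Real.log 2 := by positivity
      linarith), ← hΛ, hLdef, div_eq_mul_inv, mul_pow]
  clear_value A
  rw [h8, exp_neg_div_eq_rpow hε, h9]
  simp only [mul_add, add_mul, Finset.mul_sum, Finset.sum_mul]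
  congr 1
  · ring
  · exact Finset.sum_congr rfl fun β _ => by ring

/-! ### Lower bound for the measure of sublevel sets -/

/-- There are `n - k - 1` vectors orthogonal to the directions of a `k`-dimensional set and to
`(1, …, 1)`, scaled so that distinct natural combinations have distance at least `1`. Those of the
central face are used to move inside its normal cone without changing `|j|`. -/
theorem exists_transversal {n : ℕ} (C : Set (Fin n → ℝ)) :
    ∃ (t : ℕ) (v : Fin t → Fin n → ℝ), t = n - faceDim C - 1 ∧ (∀ r, ∑ i, v r i = 0) ∧
      (∀ r, ∀ x ∈ vectorSpan ℝ C, v r ⬝ᵥ x = 0) ∧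
      ∀ a a' : Fin t → ℕ,
        (∀ i, |∑ r, (a r : ℝ) * v r i - ∑ r, (a' r : ℝ) * v r i| < 1) → a = a' := by
  let b := Module.finBasis ℝ (vectorSpan ℝ C)
  let Φ : (Fin n → ℝ) →ₗ[ℝ] (Fin (faceDim C) → ℝ) × ℝ :=
    (LinearMap.pi fun i => dotProductBilin ℝ ℝ (b i : Fin n → ℝ)).prod
      (dotProductBilin ℝ ℝ fun _ => 1)
  have hker : n - faceDim C - 1 ≤ Module.finrank ℝ (LinearMap.ker Φ) := by
    have h1 := LinearMap.finrank_range_add_finrank_ker Φ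
    have h2 : Module.finrank ℝ (LinearMap.range Φ) ≤ faceDim C + 1 := by
      refine (Submodule.finrank_le _).trans ?_
      simp
    rw [Module.finrank_fin_fun] at h1
    omega
  let w := Module.finBasis ℝ (LinearMap.ker Φ)
  let v₀ : Fin (n - faceDim C - 1) → Fin n → ℝ := fun r => (w (Fin.castLE hker r) : Fin n → ℝ)
  have hv₀ : LinearIndependent ℝ v₀ :=
    (w.linearIndependent.map' (LinearMap.ker Φ).subtype (Submodule.ker_subtype _)).comp _
      (Fin.castLE_injective hker)
  have hmem : ∀ r, Φ (v₀ r) = 0 := fun r => (w (Fin.castLE hker r)).2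
  have hsum : ∀ r, ∑ i, v₀ r i = 0 := fun r => by
    have h1 : (fun _ => (1 : ℝ)) ⬝ᵥ v₀ r = 0 := congrArg Prod.snd (hmem r)
    simpa [dotProduct] using h1
  have horth : ∀ r, ∀ x ∈ vectorSpan ℝ C, v₀ r ⬝ᵥ x = 0 := by
    intro r x hx
    have h1 : (dotProductBilin ℝ ℝ (v₀ r)).comp (vectorSpan ℝ C).subtype = 0 := by
      refine b.ext fun i => ?_
      have h2 : (b i : Fin n → ℝ) ⬝ᵥ v₀ r = 0 := congrFun (congrArg Prod.fst (hmem r)) i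
      rw [dotProduct_comm] at h2
      exact h2
    exact LinearMap.congr_fun h1 ⟨x, hx⟩
  let T : (Fin (n - faceDim C - 1) → ℝ) →ₗ[ℝ] (Fin n → ℝ) := Fintype.linearCombination ℝ v₀
  have hT : LinearMap.ker T = ⊥ := by
    rw [LinearMap.ker_eq_bot]
    exact hv₀.fintypeLinearCombination_injective
  obtain ⟨K, -, hK⟩ := T.exists_antilipschitzWith hT
  have hR : (0 : ℝ) < K + 1 := by have := K.2; change (0 : ℝ) ≤ K at this; linarith
  refine ⟨_, fun r => ((K : ℝ) + 1) • v₀ r, rfl, fun r => ?_, fun r x hx => ?_, fun a a' h => ?_⟩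
  · simp only [Pi.smul_apply, smul_eq_mul]
    rw [← Finset.mul_sum, hsum, mul_zero]
  · rw [smul_dotProduct, horth r x hx, smul_zero]
  · have h1 : dist (T fun r => (a r : ℝ)) (T fun r => (a' r : ℝ)) ≤ ((K : ℝ) + 1)⁻¹ := by
      rw [dist_pi_le_iff (by positivity)]
      intro i
      have h2 := (h i).le
      have h3 : ∀ a : Fin (n - faceDim C - 1) → ℕ,
          ∑ r, (a r : ℝ) * (((K : ℝ) + 1) • v₀ r) i = ((K : ℝ) + 1) * T (fun r => (a r : ℝ)) i := by
        intro a
        simp only [T, Fintype.linearCombination_apply, Finset.sum_apply, Pi.smul_apply, smul_eq_mul,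
          Finset.mul_sum]
        exact Finset.sum_congr rfl fun r _ => by ring
      rw [h3, h3, ← mul_sub, abs_mul, abs_of_pos hR] at h2
      rw [Real.dist_eq, ← one_div, le_div_iff₀ hR, mul_comm]
      exact h2
    have h3 : dist (fun r => (a r : ℝ)) (fun r => (a' r : ℝ)) < 1 := by
      have h4 := hK.le_mul_dist (fun r => (a r : ℝ)) (fun r => (a' r : ℝ))
      have h5 : (K : ℝ) * dist (T fun r => (a r : ℝ)) (T fun r => (a' r : ℝ)) ≤
          K * ((K : ℝ) + 1)⁻¹ := mul_le_mul_of_nonneg_left h1 K.2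
      have h6 : (K : ℝ) * ((K : ℝ) + 1)⁻¹ < 1 := by
        rw [← div_eq_mul_inv, div_lt_one hR]; linarith
      linarith
    funext r
    have h7 := (dist_le_pi_dist (fun r => (a r : ℝ)) (fun r => (a' r : ℝ)) r).trans_lt h3
    rw [Real.dist_eq] at h7
    have h8 : |(a r : ℤ) - (a' r : ℤ)| < 1 := by exact_mod_cast h7
    have := Int.abs_lt_one_iff.1 h8
    omega

/-- The open dyadic box at scale `j` in the positive orthant. -/
def dyadicBox {n : ℕ} (j : Fin n → ℕ) : Set (Fin n → ℝ) :=
  Set.pi univ fun i => Ioo (1 / 2 ^ j i) (2 / 2 ^ j i)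

theorem volume_dyadicBox {n : ℕ} (j : Fin n → ℕ) :
    volume (dyadicBox j) = ENNReal.ofReal ((1 / 2) ^ ∑ i, j i) := by
  rw [dyadicBox, Real.volume_pi_Ioo, ← Finset.prod_pow_eq_pow_sum,
    ENNReal.ofReal_prod_of_nonneg fun i _ => by positivity]
  refine Finset.prod_congr rfl fun i _ => ?_
  congr 1
  rw [div_pow, one_pow]; ring

theorem eq_of_mem_dyadicBox {n : ℕ} {j j' : Fin n → ℕ} {x : Fin n → ℝ} (h : x ∈ dyadicBox j)
    (h' : x ∈ dyadicBox j') : j = j' := by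
  have key : ∀ {j j' : Fin n → ℕ}, x ∈ dyadicBox j → x ∈ dyadicBox j' → ∀ i, j' i ≤ j i := by
    intro j j' h h' i
    have h1 := (h i (mem_univ i)).1.trans (h' i (mem_univ i)).2
    rw [div_lt_div_iff₀ (by positivity) (by positivity), one_mul, mul_comm, ← pow_succ] at h1
    have := (pow_lt_pow_iff_right₀ one_lt_two).1 h1
    omega
  funext i
  exact le_antisymm (key h' h i) (key h h' i)

theorem exists_mem_shell_of_mem_dyadicBox {n : ℕ} {j : Fin n → ℕ} {x : Fin n → ℝ}
    (h : x ∈ dyadicBox j) : ∃ y ∈ shell n, dyadicScale j y = x := by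
  refine ⟨fun i => x i * 2 ^ j i, fun i => ?_, funext fun i => ?_⟩
  · have h1 := h i (mem_univ i)
    have h2 : (0 : ℝ) < 2 ^ j i := by positivity
    have h3 := (div_lt_iff₀ h2).1 h1.1
    have h4 := (lt_div_iff₀ h2).1 h1.2
    rw [abs_of_pos (by linarith)]
    exact ⟨h3.le, h4.le⟩
  · rw [dyadicScale, mul_div_cancel_right₀ _ (by positivity)]

theorem exists_abs_le_on_dyadicBox {n : ℕ} {S : (Fin n → ℝ) → ℝ} (hS : AnalyticAt ℝ S 0) :
    ∃ (J : ℕ) (K : ℝ), 1 ≤ K ∧ ∀ j : Fin n → ℕ, (∀ i, J ≤ j i) → ∀ x ∈ dyadicBox j,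
      |S x| ≤ K * Real.exp (-(Real.log 2 * minDeg S j)) := by
  obtain ⟨J, b, hb, h⟩ := exists_scaled_expansion hS
  refine ⟨J, max 1 (∑' α, b α), le_max_left _ _, fun j hj x hx => ?_⟩
  obtain ⟨y, hy, rfl⟩ := exists_mem_shell_of_mem_dyadicBox hx
  have hy4 : ∀ i, |y i| ≤ 4 := fun i => (hy i).2.trans (by norm_num)
  have h1 := (h j hj).2 y hy4
  have h2 : |2 ^ minDeg S j * S (dyadicScale j y)| ≤ ∑' α, b α := by
    rw [← h1.tsum_eq, ← Real.norm_eq_abs]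
    refine tsum_of_norm_bounded hb.hasSum fun α => ?_
    rw [norm_mul, Real.norm_eq_abs, Real.norm_eq_abs]
    exact (mul_le_mul_of_nonneg_left (abs_monom_le α hy4) (abs_nonneg _)).trans ((h j hj).1 α)
  rw [abs_mul, abs_of_pos (by positivity : (0 : ℝ) < 2 ^ minDeg S j)] at h2
  rw [← half_pow_eq_exp, div_pow, one_pow, mul_one_div, le_div_iff₀ (by positivity), mul_comm]
  exact h2.trans (le_max_right _ _)

/-- In the normal cone of the central face, at height about `log (1 / ε)`, there are of the order of
`|log ε| ^ (n - k - 1)` dyadic boxes on which `|S| < ε`, each of measure about `ε ^ (1 / d)`. -/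
theorem exists_le_volume_sublevel {n : ℕ} {S : (Fin n → ℝ) → ℝ}
    (hS : AnalyticAt ℝ S 0) (hne : (taylorSupport S).Nonempty) (h0 : taylorCoeff S 0 = 0)
    {C : Set (Fin n → ℝ)} (hC : IsCentralFace S C) (J : ℕ) :
    ∃ c : ℝ, 0 < c ∧ ∀ᶠ ε in 𝓝[>] (0 : ℝ),
      ENNReal.ofReal (c * |Real.log ε| ^ (n - faceDim C - 1) * ε ^ (1 / newtonDistance S)) ≤
        volume {x : Fin n → ℝ | (∀ i, |x i| ≤ (1 / 2) ^ J) ∧ |S x| < ε} := by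
  classical
  obtain ⟨hd, l', hl'0, hl'pos, hl'N, hl'C, η', hη', hball⟩ := hC.exists_form h0
  set d := newtonDistance S with hdef
  have hlog : 0 < Real.log 2 := Real.log_pos one_lt_two
  have hqC : (fun _ : Fin n => d) ∈ C := by
    have := hball 0 (zero_mem _) (by simpa using hη'.le)
    simpa using this
  have hqN := ((hl'C _).1 hqC).1
  -- normalize the supporting form
  set l : Fin n → ℝ := fun i => l' i / ∑ i, l' i with hl
  have hl0 : ∀ i, 0 ≤ l i := fun i => div_nonneg (hl'0 i) hl'pos.le
  have hl1 : ∑ i, l i = 1 := by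
    simp only [hl]; rw [← Finset.sum_div, div_self hl'pos.ne']
  have hll' : ∀ p : Fin n → ℝ, l ⬝ᵥ p = (l' ⬝ᵥ p) / ∑ i, l' i := fun p => by
    simp only [hl, dotProduct, Finset.sum_div]
    exact Finset.sum_congr rfl fun i _ => by ring
  have hlq : (l ⬝ᵥ fun _ => d) = d := by
    rw [dotProduct, ← Finset.sum_mul, hl1, one_mul]
  have hlN : ∀ p ∈ newtonPolyhedron S, d ≤ l ⬝ᵥ p := fun p hp => by
    rw [← hlq, hll', hll']
    exact div_le_div_of_nonneg_right (hl'N p hp) hl'pos.le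
  have hlC : ∀ p, p ∈ C ↔ p ∈ newtonPolyhedron S ∧ l ⬝ᵥ p = d := fun p => by
    have h1 : l ⬝ᵥ p = d ↔ l ⬝ᵥ p = l ⬝ᵥ fun _ => d := by rw [hlq]
    rw [hl'C, h1, hll', hll', div_left_inj' hl'pos.ne']
  obtain ⟨t, v, ht, hv1, hvC, hvsep⟩ := exists_transversal C
  rw [← ht]
  have hvβC : ∀ r, ∀ p ∈ C, v r ⬝ᵥ p = 0 := by
    intro r p hp
    have h1 := hvC r _ (vsub_mem_vectorSpan ℝ hp hqC)
    rw [vsub_eq_sub, dotProduct_sub, sub_eq_zero] at h1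
    rw [h1, dotProduct, ← Finset.sum_mul, hv1, zero_mul]
  have hvl : ∀ r i, l i = 0 → v r i = 0 := by
    intro r i hi
    have h1 : (fun _ => d) + Pi.single i 1 ∈ C := by
      refine (hlC _).2 ⟨newtonPolyhedron_mono hqN
        (le_add_of_nonneg_right (Pi.single_nonneg.2 zero_le_one)), ?_⟩
      rw [dotProduct_add, hlq, dotProduct_single, hi, zero_mul, add_zero]
    have h2 := hvC r _ (vsub_mem_vectorSpan ℝ h1 hqC)
    simpa using h2
  -- a cone of integer combinations on which all constraints persist
  obtain ⟨η, hη0, hηl, hηβ⟩ : ∃ η : ℝ, 0 < η ∧ (∀ i, η * ∑ r, |v r i| ≤ l i) ∧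
      ∀ β ∈ minExponents S, η * ∑ r, |v r ⬝ᵥ toPoint β| ≤ l ⬝ᵥ toPoint β - d := by
    have hsmall : ∀ X Y : ℝ, 0 < Y → ∀ᶠ η in 𝓝[>] (0 : ℝ), η * X ≤ Y := by
      intro X Y hY
      have h1 : Tendsto (fun η : ℝ => η * X) (𝓝[>] 0) (𝓝 (0 * X)) :=
        (tendsto_id.mono_left nhdsWithin_le_nhds).mul_const X
      rw [zero_mul] at h1
      exact h1.eventually_le_const hY
    have h1 : ∀ᶠ η in 𝓝[>] (0 : ℝ), ∀ i, η * ∑ r, |v r i| ≤ l i := by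
      rw [eventually_all]
      intro i
      rcases (hl0 i).eq_or_lt with h | h
      · refine Eventually.of_forall fun η => ?_
        simp [hvl _ i h.symm, ← h]
      · exact hsmall _ _ h
    have h2 : ∀ᶠ η in 𝓝[>] (0 : ℝ), ∀ β ∈ minExponents S,
        η * ∑ r, |v r ⬝ᵥ toPoint β| ≤ l ⬝ᵥ toPoint β - d := by
      rw [eventually_all_finite (finite_minExponents S)]
      intro β hβ
      have hβN := mem_newtonPolyhedron (minExponents_subset S hβ) le_rfl
      by_cases hβC : toPoint β ∈ C
      · refine Eventually.of_forall fun η => ?_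
        simp [hvβC _ _ hβC, ((hlC _).1 hβC).2]
      · refine hsmall _ _ (sub_pos.2 (lt_of_le_of_ne (hlN _ hβN) fun h => hβC ?_))
        exact (hlC _).2 ⟨hβN, h.symm⟩
    obtain ⟨η, ⟨h3, h4⟩, h5⟩ := ((h1.and h2).and self_mem_nhdsWithin).exists
    exact ⟨η, h5, h3, h4⟩
  obtain ⟨J₀, K, hK1, hSK⟩ := exists_abs_le_on_dyadicBox hS
  set J' := J₀ + J + 1 with hJ'
  have hlogK : 0 ≤ Real.log (2 * K) := Real.log_nonneg (by linarith)
  refine ⟨(η * (d * Real.log 2)⁻¹) ^ t * Real.exp (-(Real.log (2 * K) / d + Real.log 2 * (n * J'))),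
    by positivity, ?_⟩
  filter_upwards [self_mem_nhdsWithin, eventually_le_neg_log 0] with ε hε hεL
  have hε : 0 < ε := hε
  set Λ := -Real.log ε with hΛ
  -- the height for which the bound `K * 2 ^ (-s * d)` for `|S|` equals `ε / 2`
  set s : ℝ := (Λ + Real.log (2 * K)) / (d * Real.log 2) with hs
  have hs0 : 0 ≤ s := by positivity
  set M := ⌊η * s⌋₊ with hM
  let y : (Fin t → ℕ) → Fin n → ℝ := fun a i => s * l i + ∑ r, (a r : ℝ) * v r i
  let j : (Fin t → ℕ) → Fin n → ℕ := fun a i => ⌊y a i⌋₊ + J'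
  set I : Finset (Fin t → ℕ) := Fintype.piFinset fun _ => Finset.range (M + 1) with hI
  have hcomb : ∀ a ∈ I, ∀ X : Fin t → ℝ, ∀ Y : ℝ, η * ∑ r, |X r| ≤ Y →
      0 ≤ s * Y + ∑ r, (a r : ℝ) * X r := by
    intro a ha X Y hXY
    have h1 : ∀ r, (a r : ℝ) ≤ η * s := fun r => by
      have h2 : a r ≤ M := Nat.lt_succ_iff.1 (Finset.mem_range.1 (Fintype.mem_piFinset.1 ha r))
      calc (a r : ℝ) ≤ M := by exact_mod_cast h2
        _ ≤ _ := Nat.floor_le (by positivity)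
    have h2 : -(s * Y) ≤ ∑ r, (a r : ℝ) * X r := by
      calc -(s * Y) ≤ -(s * (η * ∑ r, |X r|)) := neg_le_neg (mul_le_mul_of_nonneg_left hXY hs0)
        _ = ∑ r, -(η * s * |X r|) := by
            rw [Finset.sum_neg_distrib, ← Finset.mul_sum]; ring
        _ ≤ _ := by
            refine Finset.sum_le_sum fun r _ => ?_
            have h3 : (a r : ℝ) * |X r| ≤ η * s * |X r| :=
              mul_le_mul_of_nonneg_right (h1 r) (abs_nonneg _)
            have h4 := neg_abs_le (X r)
            have h5 : (0 : ℝ) ≤ a r := Nat.cast_nonneg _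
            nlinarith
    linarith
  have hy0 : ∀ a ∈ I, ∀ i, 0 ≤ y a i := fun a ha i => hcomb a ha (fun r => v r i) (l i) (hηl i)
  have hysum : ∀ a, ∑ i, y a i = s := by
    intro a
    simp only [y]
    rw [Finset.sum_add_distrib, ← Finset.mul_sum, hl1, mul_one, Finset.sum_comm]
    simp only [← Finset.mul_sum, hv1, mul_zero, Finset.sum_const_zero, add_zero]
  have hyβ : ∀ a ∈ I, ∀ β ∈ minExponents S, s * d ≤ y a ⬝ᵥ toPoint β := by
    intro a ha β hβ
    have h1 := hcomb a ha (fun r => v r ⬝ᵥ toPoint β) _ (hηβ β hβ)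
    have h2 : y a ⬝ᵥ toPoint β = s * (l ⬝ᵥ toPoint β) + ∑ r, (a r : ℝ) * (v r ⬝ᵥ toPoint β) := by
      simp only [y, dotProduct, add_mul, Finset.sum_add_distrib, Finset.mul_sum, Finset.sum_mul]
      rw [Finset.sum_comm]
      congr 1
      · exact Finset.sum_congr rfl fun i _ => by ring
      · exact Finset.sum_congr rfl fun r _ => Finset.sum_congr rfl fun i _ => by ring
    rw [h2]
    linarith
  have hjy : ∀ a ∈ I, ∀ i, y a i ≤ j a i ∧ (j a i : ℝ) ≤ y a i + J' := by
    intro a ha i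
    have h1 := Nat.floor_le (hy0 a ha i)
    have h2 := (Nat.lt_floor_add_one (y a i)).le
    have h3 : (1 : ℝ) ≤ J' := by exact_mod_cast (by omega : 1 ≤ J')
    simp only [j]
    push_cast
    constructor <;> linarith
  have hmin : ∀ a ∈ I, s * d ≤ minDeg S (j a) := by
    intro a ha
    obtain ⟨β, hβ, hβm⟩ := exists_dot_eq_minDeg hne (j a)
    rw [← hβm, ← toPoint_dotProduct_toPoint]
    refine (hyβ a ha β hβ).trans (Finset.sum_le_sum fun i _ => ?_)
    exact mul_le_mul_of_nonneg_right (hjy a ha i).1 (Nat.cast_nonneg _)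
  have hinj : ∀ a ∈ I, ∀ a' ∈ I, j a = j a' → a = a' := by
    intro a ha a' ha' h
    refine hvsep a a' fun i => ?_
    have h1 := congrFun h i
    simp only [j, Nat.add_right_cancel_iff] at h1
    have h2 := Nat.floor_le (hy0 a ha i)
    have h3 := Nat.lt_floor_add_one (y a i)
    have h4 := Nat.floor_le (hy0 a' ha' i)
    have h5 := Nat.lt_floor_add_one (y a' i)
    rw [h1] at h2 h3
    have h6 : ∑ r, (a r : ℝ) * v r i - ∑ r, (a' r : ℝ) * v r i = y a i - y a' i := by
      simp only [y]; ring
    rw [h6, abs_lt]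
    constructor <;> linarith
  have hsub : (⋃ a ∈ I, dyadicBox (j a)) ⊆
      {x : Fin n → ℝ | (∀ i, |x i| ≤ (1 / 2) ^ J) ∧ |S x| < ε} := by
    refine iUnion₂_subset fun a ha x hx => ⟨fun i => ?_, ?_⟩
    · have h1 := hx i (mem_univ i)
      have h2 : (0 : ℝ) < 1 / 2 ^ j a i := by positivity
      rw [abs_of_pos (h2.trans h1.1)]
      refine h1.2.le.trans ?_
      rw [div_pow, one_pow, div_le_div_iff₀ (by positivity) (by positivity), one_mul, ← pow_succ']
      exact pow_le_pow_right₀ one_le_two (by simp only [j]; omega)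
    · refine (hSK (j a) (fun i => by simp only [j]; omega) x hx).trans_lt ?_
      have h1 : Real.log 2 * (s * d) = Λ + Real.log (2 * K) := by
        rw [hs]; field_simp
      calc K * Real.exp (-(Real.log 2 * minDeg S (j a)))
          ≤ K * Real.exp (-(Real.log 2 * (s * d))) := by
            have := hmin a ha
            gcongr
        _ = ε / 2 := by
            rw [h1, neg_add, Real.exp_add, hΛ, neg_neg, Real.exp_log hε, Real.exp_neg,
              Real.exp_log (by positivity)]
            field_simp
        _ < ε := half_lt_self hε
  have hdisj : Set.PairwiseDisjoint (I : Set (Fin t → ℕ)) fun a => dyadicBox (j a) := by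
    intro a ha a' ha' hne
    refine Set.disjoint_left.2 fun x hx hx' => hne (hinj a ha a' ha' (eq_of_mem_dyadicBox hx hx'))
  have hterm : ∀ a ∈ I, Real.exp (-(Λ / d)) *
      Real.exp (-(Real.log (2 * K) / d + Real.log 2 * (n * J'))) ≤ (1 / 2) ^ ∑ i, j a i := by
    intro a ha
    rw [half_pow_eq_exp, ← Real.exp_add]
    refine Real.exp_le_exp.2 ?_
    have h1 : ((∑ i, j a i : ℕ) : ℝ) ≤ s + n * J' := by
      push_cast
      calc ∑ i, (j a i : ℝ) ≤ ∑ i, (y a i + J') := Finset.sum_le_sum fun i _ => (hjy a ha i).2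
        _ = _ := by rw [Finset.sum_add_distrib, hysum]; simp
    have h2 := mul_le_mul_of_nonneg_left h1 hlog.le
    have h3 : Real.log 2 * s = Λ / d + Real.log (2 * K) / d := by
      rw [hs]; field_simp
    rw [mul_add, h3] at h2
    linarith
  refine le_trans ?_ (measure_mono hsub)
  rw [measure_biUnion_finset hdisj fun a _ =>
    (MeasurableSet.univ_pi fun i => measurableSet_Ioo)]
  simp only [volume_dyadicBox]
  rw [← ENNReal.ofReal_sum_of_nonneg fun a _ => by positivity]
  refine ENNReal.ofReal_le_ofReal ?_
  have hcard : (I.card : ℝ) = ((M : ℝ) + 1) ^ t := by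
    rw [hI, Fintype.card_piFinset]; simp
  have hM1 : η * (d * Real.log 2)⁻¹ * |Real.log ε| ≤ (M : ℝ) + 1 := by
    have h1 : η * s ≤ M + 1 := (Nat.lt_floor_add_one _).le
    have h2 : η * ((d * Real.log 2)⁻¹ * Λ) ≤ η * s := by
      refine mul_le_mul_of_nonneg_left ?_ hη0.le
      rw [hs, div_eq_inv_mul]
      exact mul_le_mul_of_nonneg_left (by linarith) (by positivity)
    rw [abs_of_nonpos (by linarith), ← hΛ]
    linarith
  calc _ = (η * (d * Real.log 2)⁻¹ * |Real.log ε|) ^ t * (ε ^ (1 / d) *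
        Real.exp (-(Real.log (2 * K) / d + Real.log 2 * (n * J')))) := by
        rw [mul_pow _ |Real.log ε|]; ring
    _ ≤ ((M : ℝ) + 1) ^ t * (ε ^ (1 / d) *
        Real.exp (-(Real.log (2 * K) / d + Real.log 2 * (n * J')))) := by
        refine mul_le_mul_of_nonneg_right (pow_le_pow_left₀ (by positivity) hM1 _) (by positivity)
    _ = ∑ _a ∈ I, (ε ^ (1 / d) *
        Real.exp (-(Real.log (2 * K) / d + Real.log 2 * (n * J')))) := by
        rw [Finset.sum_const, nsmul_eq_mul, hcard]
    _ ≤ _ := by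
        refine Finset.sum_le_sum fun a ha => ?_
        rw [← exp_neg_div_eq_rpow hε]
        exact hterm a ha

/-! ### Sublevel integrals -/

theorem measurableSet_sublevel {n : ℕ} {U : Set (Fin n → ℝ)} (hU : IsOpen U)
    {S : (Fin n → ℝ) → ℝ} (hS : ContinuousOn S U) (ε : ℝ) :
    MeasurableSet {x | x ∈ U ∧ |S x| < ε} :=
  (hS.abs.isOpen_inter_preimage hU isOpen_Iio).measurableSet

theorem IsAmplitude.integrable {n : ℕ} {V : Set (Fin n → ℝ)} {φ : (Fin n → ℝ) → ℝ}
    (hφ : IsAmplitude V φ) : Integrable φ :=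
  hφ.smooth.continuous.integrable_of_hasCompactSupport hφ.hasCompactSupport

theorem sublevelIntegral_lower {n : ℕ} {U : Set (Fin n → ℝ)} (hU : IsOpen U) (h0U : 0 ∈ U)
    {S : (Fin n → ℝ) → ℝ} (hS : ContinuousOn S U) {φ : (Fin n → ℝ) → ℝ} (hφ : IsAmplitude U φ)
    {t : ℕ} {d : ℝ} (h : ∀ J : ℕ, ∃ c : ℝ, 0 < c ∧ ∀ᶠ ε in 𝓝[>] (0 : ℝ),
      ENNReal.ofReal (c * |Real.log ε| ^ t * ε ^ (1 / d)) ≤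
        volume {x : Fin n → ℝ | (∀ i, |x i| ≤ (1 / 2) ^ J) ∧ |S x| < ε}) :
    ∃ c : ℝ, 0 < c ∧ ∀ᶠ ε in 𝓝[>] (0 : ℝ),
      c * |Real.log ε| ^ t * ε ^ (1 / d) < sublevelIntegral U S φ ε := by
  have hev : ∀ᶠ x in 𝓝 (0 : Fin n → ℝ), x ∈ U ∧ φ 0 / 2 < φ x :=
    (hU.eventually_mem h0U).and (hφ.smooth.continuous.continuousAt.eventually_const_lt
      (half_lt_self hφ.pos_zero))
  obtain ⟨ρ, hρ, hball⟩ := Metric.eventually_nhds_iff_ball.1 hev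
  obtain ⟨J, hJ⟩ := exists_pow_lt_of_lt_one hρ (show (1 / 2 : ℝ) < 1 by norm_num)
  have hbox : ∀ x : Fin n → ℝ, (∀ i, |x i| ≤ (1 / 2) ^ J) → x ∈ U ∧ φ 0 / 2 < φ x := by
    intro x hx
    refine hball x ?_
    rw [Metric.mem_ball, dist_zero_right]
    exact ((pi_norm_le_iff_of_nonneg (by positivity)).2 hx).trans_lt hJ
  obtain ⟨c, hc, hvol⟩ := h J
  have hφ0 := hφ.pos_zero
  refine ⟨φ 0 / 2 * c / 2, by positivity, ?_⟩
  filter_upwards [hvol, self_mem_nhdsWithin, eventually_le_neg_log 1] with ε hε hε0 hεL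
  have hε0 : 0 < ε := hε0
  set B := {x : Fin n → ℝ | (∀ i, |x i| ≤ (1 / 2) ^ J) ∧ |S x| < ε} with hB
  have hBsub : B ⊆ {x | x ∈ U ∧ |S x| < ε} := fun x hx => ⟨(hbox x hx.1).1, hx.2⟩
  have hBmeas : MeasurableSet B := by
    have h1 : B = {x | x ∈ U ∧ |S x| < ε} ∩ Metric.closedBall 0 ((1 / 2) ^ J) := by
      ext x
      simp only [mem_inter_iff, Metric.mem_closedBall, dist_zero_right,
        pi_norm_le_iff_of_nonneg (show (0 : ℝ) ≤ (1 / 2) ^ J by positivity), Real.norm_eq_abs]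
      exact ⟨fun hx => ⟨hBsub hx, hx.1⟩, fun hx => ⟨hx.2, hx.1.2⟩⟩
    rw [h1]
    exact (measurableSet_sublevel hU hS ε).inter Metric.isClosed_closedBall.measurableSet
  have hBfin : volume B ≠ ⊤ := by
    refine ((measure_mono fun x hx => ?_).trans_lt
      (isCompact_closedBall (0 : Fin n → ℝ) ((1 / 2) ^ J)).measure_lt_top).ne
    rw [Metric.mem_closedBall, dist_zero_right]
    exact (pi_norm_le_iff_of_nonneg (by positivity)).2 hx.1
  have h1 : φ 0 / 2 * volume.real B ≤ ∫ x in B, φ x :=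
    setIntegral_ge_of_const_le_real hBmeas hBfin (fun x hx => (hbox x hx.1).2.le)
      hφ.integrable.integrableOn
  have h2 : ∫ x in B, φ x ≤ sublevelIntegral U S φ ε :=
    setIntegral_mono_set hφ.integrable.integrableOn (Eventually.of_forall hφ.nonneg)
      (Eventually.of_forall hBsub)
  have h3 : c * |Real.log ε| ^ t * ε ^ (1 / d) ≤ volume.real B :=
    (ENNReal.ofReal_le_iff_le_toReal hBfin).1 hε
  have hX : 0 < c * |Real.log ε| ^ t * ε ^ (1 / d) := by
    have : 0 < |Real.log ε| := abs_pos.2 (by linarith : Real.log ε < 0).ne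
    positivity
  have h4 := mul_le_mul_of_nonneg_left h3 (half_pos hφ0).le
  have h5 : φ 0 / 2 * c / 2 * |Real.log ε| ^ t * ε ^ (1 / d) =
      φ 0 / 2 * (c * |Real.log ε| ^ t * ε ^ (1 / d)) / 2 := by ring
  rw [h5]
  have h6 : 0 < φ 0 / 2 * (c * |Real.log ε| ^ t * ε ^ (1 / d)) := by positivity
  linarith

theorem sublevelIntegral_upper {n : ℕ} {U V : Set (Fin n → ℝ)} (hU : IsOpen U)
    {S φ : (Fin n → ℝ) → ℝ} (hS : ContinuousOn S U) {J : ℕ}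
    (hVJ : ∀ x ∈ V, ∀ i, |x i| < (1 / 2) ^ J) (hφ : IsAmplitude V φ) {X : ℝ → ℝ}
    (hX : ∀ᶠ ε in 𝓝[>] (0 : ℝ), 0 < X ε) {K : ℝ} (hK : 0 < K)
    (h : ∀ᶠ ε in 𝓝[>] (0 : ℝ),
      volume {x : Fin n → ℝ | (∀ i, |x i| < (1 / 2) ^ J) ∧ |S x| < ε} ≤
        ENNReal.ofReal (K * X ε)) :
    ∃ c : ℝ, 0 < c ∧ ∀ᶠ ε in 𝓝[>] (0 : ℝ), sublevelIntegral U S φ ε < c * X ε := by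
  obtain ⟨M, hM⟩ := hφ.hasCompactSupport.exists_bound_of_continuous hφ.smooth.continuous
  have hM0 : 0 ≤ M := (norm_nonneg _).trans (hM 0)
  refine ⟨(M + 1) * K, by positivity, ?_⟩
  filter_upwards [hX, h] with ε hXε hε
  have hKX : 0 < K * X ε := by positivity
  have hA := measurableSet_sublevel hU hS ε
  set A := {x | x ∈ U ∧ |S x| < ε} with hAdef
  have hvol : volume (A ∩ tsupport φ) ≤ ENNReal.ofReal (K * X ε) :=
    hε.trans' (measure_mono fun _ hx => ⟨hVJ _ (hφ.tsupport_subset hx.2), hx.1.2⟩)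
  have h1 : sublevelIntegral U S φ ε = ∫ x in A ∩ tsupport φ, φ x :=
    setIntegral_eq_of_subset_of_forall_sdiff_eq_zero hA inter_subset_left fun x hx =>
      image_eq_zero_of_notMem_tsupport fun h => hx.2 ⟨hx.1, h⟩
  have h2 : ‖∫ x in A ∩ tsupport φ, φ x‖ ≤ M * volume.real (A ∩ tsupport φ) :=
    norm_setIntegral_le_of_norm_le_const (hvol.trans_lt ENNReal.ofReal_lt_top) fun x _ => hM x
  have h3 := mul_le_mul_of_nonneg_left (ENNReal.toReal_le_of_le_ofReal hKX.le hvol) hM0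
  rw [h1]
  calc ∫ x in A ∩ tsupport φ, φ x ≤ M * (K * X ε) := (le_abs_self _).trans (h2.trans h3)
    _ < (M + 1) * K * X ε := by linarith

end NewtonPoly

end

theorem theorem1p2 {n : ℕ} (U : Set (Fin n → ℝ)) (hU : IsOpen U) (h0U : (0 : Fin n → ℝ) ∈ U)
    (S : (Fin n → ℝ) → ℝ) (hS : AnalyticOnNhd ℝ S U)
    (hS_ne : ¬ ∀ᶠ x in 𝓝 (0 : Fin n → ℝ), S x = 0)
    (hS0 : S 0 = 0) (hdS0 : fderiv ℝ S 0 = 0)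
    (C : Set (Fin n → ℝ)) (hC : NewtonPoly.IsCentralFace S C)
    (d : ℝ) (hd : d = NewtonPoly.newtonDistance S)
    (k : ℕ) (hk : k = NewtonPoly.faceDim C) :
    -- part (a)
    (∀ φ : (Fin n → ℝ) → ℝ, NewtonPoly.IsAmplitude U φ →
      ∃ c : ℝ, 0 < c ∧ ∀ᶠ ε in 𝓝[>] (0 : ℝ),
        c * |Real.log ε| ^ (n - k - 1) * ε ^ (1 / d) < NewtonPoly.sublevelIntegral U S φ ε) ∧
    -- parts (b) and (c), for amplitudes supported sufficiently close to the origin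
    ∃ V : Set (Fin n → ℝ), IsOpen V ∧ (0 : Fin n → ℝ) ∈ V ∧ V ⊆ U ∧
      ∀ φ : (Fin n → ℝ) → ℝ, NewtonPoly.IsAmplitude V φ →
        ((∀ F, NewtonPoly.IsCompactFace S F → ∀ m : ℕ,
            NewtonPoly.FaceHasZeroOfOrder S F m → (m : ℝ) ≤ d) →
          (∃ c' : ℝ, 0 < c' ∧ ∀ᶠ ε in 𝓝[>] (0 : ℝ),
            NewtonPoly.sublevelIntegral U S φ ε < c' * |Real.log ε| ^ (n - k) * ε ^ (1 / d)) ∧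
          ((¬ ∃ F, NewtonPoly.IsCompactFace S F ∧ F ⊆ C ∧
              ∃ m : ℕ, (m : ℝ) = d ∧ NewtonPoly.FaceHasZeroOfOrder S F m) →
            ∃ c' : ℝ, 0 < c' ∧ ∀ᶠ ε in 𝓝[>] (0 : ℝ),
              NewtonPoly.sublevelIntegral U S φ ε <
                c' * |Real.log ε| ^ (n - k - 1) * ε ^ (1 / d))) ∧
        (∀ d' : ℕ,
          IsGreatest {m : ℕ | ∃ F, NewtonPoly.IsCompactFace S F ∧
            NewtonPoly.FaceHasZeroOfOrder S F m} d' →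
          d < d' →
          ∃ c' : ℝ, 0 < c' ∧ ∀ᶠ ε in 𝓝[>] (0 : ℝ),
            NewtonPoly.sublevelIntegral U S φ ε < c' * ε ^ (1 / (d' : ℝ))) := by
  open NewtonPoly in
  classical
  subst hd hk
  have hn : 0 < n := by
    rcases Nat.eq_zero_or_pos n with rfl | hn
    · exact absurd (Eventually.of_forall fun x => by rw [Subsingleton.elim x 0, hS0]) hS_ne
    · exact hn
  have hSa : AnalyticAt ℝ S 0 := hS 0 h0U
  have hSc : ContinuousOn S U := hS.continuousOn
  have hne := taylorSupport_nonempty hSa hS_ne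
  have h0 : taylorCoeff S 0 = 0 := (taylorCoeff_zero hSa).trans hS0
  refine ⟨fun φ hφ => sublevelIntegral_lower hU h0U hSc hφ
    fun J => exists_le_volume_sublevel hSa hne h0 hC J, ?_⟩
  -- each upper bound holds on some dyadic cube, which depends only on `S`
  have hpick : ∀ P : Prop, ∀ X : ℝ → ℝ, (P → ∃ (J : ℕ) (K : ℝ), 0 < K ∧ ∀ᶠ ε in 𝓝[>] (0 : ℝ),
      volume {x : Fin n → ℝ | (∀ i, |x i| < (1 / 2) ^ J) ∧ |S x| < ε} ≤
        ENNReal.ofReal (K * X ε)) →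
      ∃ J : ℕ, P → ∃ K : ℝ, 0 < K ∧ ∀ᶠ ε in 𝓝[>] (0 : ℝ),
      volume {x : Fin n → ℝ | (∀ i, |x i| < (1 / 2) ^ J) ∧ |S x| < ε} ≤
        ENNReal.ofReal (K * X ε) := by
    intro P X h
    by_cases hP : P
    · obtain ⟨J, hJ⟩ := h hP
      exact ⟨J, fun _ => hJ⟩
    · exact ⟨0, fun h => absurd h hP⟩
  obtain ⟨J₁, h₁⟩ := hpick _ (fun ε => |Real.log ε| ^ (n - faceDim C) *
      ε ^ (1 / newtonDistance S)) fun hQ => by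
    simpa only [mul_assoc] using exists_volume_sublevel_le_of_le hn hSa hne h0 hC hQ
  obtain ⟨J₂, h₂⟩ := hpick (_ ∧ _) (fun ε => |Real.log ε| ^ (n - faceDim C - 1) *
      ε ^ (1 / newtonDistance S)) fun hQ => by
    simpa only [mul_assoc] using exists_volume_sublevel_le_of_central hn hSa hne h0 hC hQ.1 hQ.2
  obtain ⟨J₃, h₃⟩ : ∃ J : ℕ, ∀ d' : ℕ, IsGreatest {m : ℕ | ∃ F, IsCompactFace S F ∧
      FaceHasZeroOfOrder S F m} d' → newtonDistance S < d' → ∃ K : ℝ, 0 < K ∧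
      ∀ᶠ ε in 𝓝[>] (0 : ℝ), volume {x : Fin n → ℝ | (∀ i, |x i| < (1 / 2) ^ J) ∧ |S x| < ε} ≤
        ENNReal.ofReal (K * ε ^ (1 / (d' : ℝ))) := by
    by_cases hP : ∃ d' : ℕ, IsGreatest {m : ℕ | ∃ F, IsCompactFace S F ∧
      FaceHasZeroOfOrder S F m} d' ∧ newtonDistance S < d'
    · obtain ⟨d', hd', hlt⟩ := hP
      obtain ⟨J, hJ⟩ := exists_volume_sublevel_le_of_lt hn hSa hne h0 hC hlt
        fun F hF m hm => by exact_mod_cast hd'.2 ⟨F, hF, hm⟩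
      refine ⟨J, fun d'' hd'' _ => ?_⟩
      rw [hd''.unique hd']
      exact hJ
    · exact ⟨0, fun d' hd' hlt => absurd ⟨d', hd', hlt⟩ hP⟩
  set J := max J₁ (max J₂ J₃) with hJ
  have hpow : ∀ {J'}, J' ≤ J → ((1 : ℝ) / 2) ^ J ≤ (1 / 2) ^ J' := fun h =>
    pow_le_pow_of_le_one (by norm_num) (by norm_num) h
  have hVJ : ∀ {J'}, J' ≤ J → ∀ x ∈ U ∩ Metric.ball (0 : Fin n → ℝ) ((1 / 2) ^ J),
      ∀ i, |x i| < (1 / 2) ^ J' := by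
    intro J' hJ' x hx i
    have h := hx.2
    rw [Metric.mem_ball, dist_zero_right] at h
    exact (norm_le_pi_norm x i).trans_lt (h.trans_le (hpow hJ'))
  have hpos : ∀ (t : ℕ) (D : ℝ), ∀ᶠ ε in 𝓝[>] (0 : ℝ), 0 < |Real.log ε| ^ t * ε ^ (1 / D) := by
    intro t D
    filter_upwards [self_mem_nhdsWithin, eventually_le_neg_log 1] with ε hε hεL
    have hε : 0 < ε := hε
    have h : 0 < |Real.log ε| := abs_pos.2 (by linarith : Real.log ε < 0).ne
    positivity
  refine ⟨U ∩ Metric.ball 0 ((1 / 2) ^ J), hU.inter Metric.isOpen_ball,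
    ⟨h0U, Metric.mem_ball_self (by positivity)⟩, inter_subset_left, fun φ hφ =>
    ⟨fun hQ => ⟨?_, fun hQC => ?_⟩, fun d' hd' hlt => ?_⟩⟩
  · obtain ⟨K, hK, h⟩ := h₁ hQ
    simpa only [mul_assoc] using
      sublevelIntegral_upper hU hSc (hVJ (by omega)) hφ (hpos _ _) hK h
  · obtain ⟨K, hK, h⟩ := h₂ ⟨hQ, hQC⟩
    simpa only [mul_assoc] using
      sublevelIntegral_upper hU hSc (hVJ (by omega)) hφ (hpos _ _) hK h
  · obtain ⟨K, hK, h⟩ := h₃ d' hd' hlt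
    refine sublevelIntegral_upper hU hSc (hVJ (by omega)) hφ ?_ hK h
    simpa using hpos 0 d'
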